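/- **Theorem (Euler–Lagrange equation for problems with higher-order $\Delta$-derivatives).** *Notation.* Let $a,b$ be points of a time scale (a nonempty closed subset of $\mathbb{R}$), and let $\mathbb{T}$ be its part in $[a,b]$, considered as a time scale with minimum $a$ and maximum $b$. Let $\sigma(t)=\inf\{s\in\mathbb{T}:s>t\}$ and $\rho(t)=\sup\{s\in\mathbb{T}:s<t\}$ be its jump operators (with $\sigma(b)=b$, $\rho(a)=a$), $\mathbb{T}^{\kappa}$ the set of points of $\mathbb{T}$ that are non-maximal or left-dense, $\mathbb{T}^{\kappa^{0}}=\mathbb{T}$, $\mathbb{T}^{\kappa^{n+1}}=(\mathbb{T}^{\kappa^{n}})^{\kappa}$, and $[c,d]_{\mathbb{T}}=\mathbb{T}\cap[c,d]$. For $f:\mathbb{T}\to\mathbb{R}$ and $t\in\mathbb{T}^{\kappa}$, the number $f^{\Delta}(t)$ is the $\Delta$-derivative of $f$ at $t$ if for every $\varepsilon>0$ one has $|f(\sigma(t))-f(s)-f^{\Delta}(t)(\sigma(t)-s)|\le\varepsilon|\sigma(t)-s|$ for all $s\in\mathbb{T}$ near $t$; $f^{\Delta^{0}}=f$, and $f^{\Delta^{n+1}}:\mathbb{T}^{\kappa^{n+1}}\to\mathbb{R}$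 is the $\Delta$-derivative of $f^{\Delta^n}:\mathbb{T}^{\kappa^n}\to\mathbb{R}$. We write $f^{\sigma^k\Delta^i}=(f\circ\sigma^k)^{\Delta^i}$. The integral $\int_c^d f(t)\,\Delta t$ is $F(d)-F(c)$ for any $F$ with $F^\Delta=f$. For $n\ge 0$ let $C^{n}$ be the set of all $y:\mathbb{T}\to\mathbb{R}$ such that $y^{\Delta^{n}}$ exists and is continuous on $\mathbb{T}^{\kappa^{n}}$. *Hypotheses.* Let $r\ge 1$ be an integer, let $\mathbb{T}$ have at least $2r+1$ points, and suppose that there are $a_1>0$ and $a_0\in\mathbb{R}$ with $\sigma(t)=a_1t+a_0$ for all $t\in[a,\rho(b)]_{\mathbb{T}}$. Let $L(t,u_0,\dots,u_r)$, defined for $t\in\mathbb{T}^{\kappa^{r}}$ and $(u_0,\dots,u_r)\in\mathbb{R}^{r+1}$, have continuous partial derivatives up to total order $r+1$ (in any order of differentiation), where the derivatives with respect to $u_0,\dots,u_r$ are the usual ones and those with respect to $t$ are $\Delta$-derivatives. Given $y_a^{0},\dots,y_a^{r-1},y_b^{0},\dots,y_b^{r-1}\in\mathbb{R}$, consider the problem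 of minimising $$\mathcal{L}[y]=\int_a^{\rho^{r-1}(b)}L\bigl(t,y^{\sigma^r}(t),y^{\sigma^{r-1}\Delta}(t),\dots,y^{\sigma\Delta^{r-1}}(t),y^{\Delta^r}(t)\bigr)\,\Delta t$$ among all $y\in C^{2r}$ such that $y^{\Delta^k}(a)=y_a^{k}$ and $y^{\Delta^k}(\rho^{r-1}(b))=y_b^{k}$ for $k=0,\dots,r-1$ (admissible functions). Let $y_*$ be a weak local minimum: $y_*$ is admissible and there is $\delta>0$ such that $\mathcal{L}[y_*]\le\mathcal{L}[y]$ for every admissible $y$ with $\|y-y_*\|_{r,\infty}<\delta$, where $\|y\|_{r,\infty}=\sum_{i=0}^{r}\sup_{t\in\mathbb{T}^{\kappa^r}}|y^{\sigma^i\Delta^{r-i}}(t)|$. *Conclusion.* For $i=0,\dots,r$ the function $L_{u_i}(\cdot):t\mapsto L_{u_i}\bigl(t,y_*^{\sigma^r}(t),y_*^{\sigma^{r-1}\Delta}(t),\dots,y_*^{\Delta^r}(t)\bigr)$ on $\mathbb{T}^{\kappa^r}$ is $i$ times $\Delta$-differentiable (its $i$-th $\Delta$-derivative exists on $\mathbb{T}^{\kappa^{r+i}}$),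 and $$\sum_{i=0}^{r}(-1)^i\left(\frac1{a_1}\right)^{\frac{i(i-1)}{2}}L_{u_i}^{\Delta^i}(\cdot)(t)=0\qquad\text{for all }t\in[a,\rho^{2r}(b)]_{\mathbb{T}}.$$ -/

import Mathlib

/-! Calculus on a time scale, i.e. a nonempty closed set `T ⊆ ℝ`.  A real function on `T` (or on one
of the subsets `T^{κ^n}`) is represented by a total function `ℝ → ℝ`; all the notions below that are
used for such a function depend only on its values on that set. -/

namespace TimeScale

open Classical in
/-- The forward jump operator `σ(t) = inf {s ∈ T : s > t}`, with `inf ∅ = sup T`. -/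
noncomputable def sigma (T : Set ℝ) (t : ℝ) : ℝ :=
  if (T ∩ Set.Ioi t).Nonempty then sInf (T ∩ Set.Ioi t) else sSup T

open Classical in
/-- The backward jump operator `ρ(t) = sup {s ∈ T : s < t}`, with `sup ∅ = inf T`. -/
noncomputable def rho (T : Set ℝ) (t : ℝ) : ℝ :=
  if (T ∩ Set.Iio t).Nonempty then sSup (T ∩ Set.Iio t) else sInf T

/-- `T^κ`: the points of `T` that are non-maximal or left-dense. -/
def kappa (T : Set ℝ) : Set ℝ :=
  {t | t ∈ T ∧ (¬ IsGreatest T t ∨ rho T t = t)}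

/-- `T^{κ^n}`, with `T^{κ^0} = T`. -/
def kappaIter (T : Set ℝ) (n : ℕ) : Set ℝ :=
  kappa^[n] T

/-- The time scales interval `[a, b]_T`. -/
def interval (T : Set ℝ) (a b : ℝ) : Set ℝ :=
  {t | t ∈ T ∧ a ≤ t ∧ t ≤ b}

/-- `f : T → ℝ` is `Δ`-differentiable at `t` with `f^Δ(t) = d` (to be used for `t ∈ T^κ`). -/
def HasDeltaDerivAt (T : Set ℝ) (f : ℝ → ℝ) (d t : ℝ) : Prop :=
  ∀ ε > 0, ∃ δ > 0, ∀ s ∈ T, |s - t| < δ →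
    |f (sigma T t) - f s - d * (sigma T t - s)| ≤ ε * |sigma T t - s|

open Classical in
/-- The `Δ`-derivative `f^Δ(t)` of `f : T → ℝ` at `t ∈ T^κ` (`0` if it does not exist). -/
noncomputable def deltaDeriv (T : Set ℝ) (f : ℝ → ℝ) (t : ℝ) : ℝ :=
  if h : ∃ d, HasDeltaDerivAt T f d t then h.choose else 0

/-- `f^{Δ^n}`, a function on `T^{κ^n}`: `f^{Δ^0} = f`, and `f^{Δ^{n+1}}` is the `Δ`-derivative of
`f^{Δ^n} : T^{κ^n} → ℝ`. -/
noncomputable def deltaIter (T : Set ℝ) (f : ℝ → ℝ) : ℕ → ℝ → ℝ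
  | 0 => f
  | n + 1 => deltaDeriv (kappaIter T n) (deltaIter T f n)

/-- `f : T → ℝ` is `n` times `Δ`-differentiable: `f^{Δ^n}` exists on `T^{κ^n}`. -/
def DeltaDifferentiable (T : Set ℝ) (n : ℕ) (f : ℝ → ℝ) : Prop :=
  ∀ k < n, ∀ t ∈ kappaIter T (k + 1),
    ∃ d, HasDeltaDerivAt (kappaIter T k) (deltaIter T f k) d t

/-- The class `C^n`: `f^{Δ^n}` exists and is continuous on `T^{κ^n}`. -/
def DeltaC (T : Set ℝ) (n : ℕ) (f : ℝ → ℝ) : Prop :=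
  DeltaDifferentiable T n f ∧ ContinuousOn (deltaIter T f n) (kappaIter T n)

/-- `f : T^κ → ℝ` has the antiderivative `G : T → ℝ`. -/
def IsAntiderivative (T : Set ℝ) (f G : ℝ → ℝ) : Prop :=
  ∀ t ∈ kappa T, HasDeltaDerivAt T G (f t) t

open Classical in
/-- The `Δ`-integral `∫_c^d f(t) Δt` of `f : T^κ → ℝ` on the time scale `T`, for `c, d ∈ T`:
the increment of an antiderivative (`0` if there is none). -/
noncomputable def integral (T : Set ℝ) (f : ℝ → ℝ) (c d : ℝ) : ℝ :=
  if h : ∃ G, IsAntiderivative T f G then h.choose d - h.choose c else 0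

/-- The usual partial derivative `F_{u_i}(t, u)`. -/
noncomputable def partialU {m : ℕ} (F : ℝ → (Fin m → ℝ) → ℝ) (i : Fin m) (t : ℝ)
    (u : Fin m → ℝ) : ℝ :=
  deriv (fun x => F t (Function.update u i x)) (u i)

/-- `F(t, u)` is of class `C^n` on `T × ℝ^m`: all its iterated partial derivatives of total order at
most `n`, in any order of differentiation, usual in the variables `u_i` and `Δ` in the variable `t`,
exist and are jointly continuous.  A `Δ`-differentiation in `t` replaces the time scale `T` by
`T^κ`. -/
def MixedC {m : ℕ} : ℕ → Set ℝ → (ℝ → (Fin m → ℝ) → ℝ) → Prop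
  | 0, T, F => ContinuousOn (fun p : ℝ × (Fin m → ℝ) => F p.1 p.2) (T ×ˢ Set.univ)
  | n + 1, T, F =>
      ContinuousOn (fun p : ℝ × (Fin m → ℝ) => F p.1 p.2) (T ×ˢ Set.univ) ∧
      (∀ i : Fin m, ∃ G : ℝ → (Fin m → ℝ) → ℝ,
        (∀ t ∈ T, ∀ u, HasDerivAt (fun x => F t (Function.update u i x)) (G t u) (u i)) ∧
        MixedC n T G) ∧
      ∃ G : ℝ → (Fin m → ℝ) → ℝ,
        (∀ t ∈ kappa T, ∀ u, HasDeltaDerivAt T (fun s => F s u) (G t u) t) ∧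
        MixedC n (kappa T) G

/-- The vector `(y^{σ^r}(t), y^{σ^{r-1}Δ}(t), …, y^{σΔ^{r-1}}(t), y^{Δ^r}(t))`, `t ∈ T^{κ^r}`;
its entry of index `i` is `(y ∘ σ^{r-i})^{Δ^i}(t)`. -/
noncomputable def jet (T : Set ℝ) (r : ℕ) (y : ℝ → ℝ) (t : ℝ) : Fin (r + 1) → ℝ :=
  fun i => deltaIter T (y ∘ (sigma T)^[r - i]) i t

/-- The functional `∫_a^{ρ^{r-1}(b)} L(t, y^{σ^r}, y^{σ^{r-1}Δ}, …, y^{Δ^r}) Δt` on a time scale `T`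
with minimum `a` and maximum `b`.  The integrand lives on `T^{κ^r}`, so the integral is that of the
time scale `T^{κ^{r-1}}`. -/
noncomputable def functional (T : Set ℝ) (a b : ℝ) (r : ℕ) (L : ℝ → (Fin (r + 1) → ℝ) → ℝ)
    (y : ℝ → ℝ) : ℝ :=
  integral (kappaIter T (r - 1)) (fun t => L t (jet T r y t)) a ((rho T)^[r - 1] b)

/-- `y ∈ C^{2r}` and `y` satisfies the boundary conditions `y^{Δ^k}(a) = α_k`,
`y^{Δ^k}(ρ^{r-1}(b)) = β_k`, `0 ≤ k ≤ r - 1`. -/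
def Admissible (T : Set ℝ) (a b : ℝ) (r : ℕ) (α β : Fin r → ℝ) (y : ℝ → ℝ) : Prop :=
  DeltaC T (2 * r) y ∧
    ∀ k : Fin r, deltaIter T y k a = α k ∧ deltaIter T y k ((rho T)^[r - 1] b) = β k

/-- The norm `‖y‖_{r,∞} = ∑_{i=0}^r sup_{t ∈ T^{κ^r}} |y^{σ^i Δ^{r-i}}(t)|`. -/
noncomputable def weakNorm (T : Set ℝ) (r : ℕ) (y : ℝ → ℝ) : ℝ :=
  ∑ i ∈ Finset.range (r + 1),
    sSup ((fun t => |deltaIter T (y ∘ (sigma T)^[i]) (r - i) t|) '' kappaIter T r)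

/-- `y` is a weak local minimum of the functional among the admissible functions. -/
def IsWeakLocalMin (T : Set ℝ) (a b : ℝ) (r : ℕ) (L : ℝ → (Fin (r + 1) → ℝ) → ℝ)
    (α β : Fin r → ℝ) (y : ℝ → ℝ) : Prop :=
  Admissible T a b r α β y ∧
    ∃ δ > 0, ∀ z, Admissible T a b r α β z → weakNorm T r (fun t => z t - y t) < δ →
      functional T a b r L y ≤ functional T a b r L z

/-- `t ↦ L_{u_i}(t, y^{σ^r}(t), y^{σ^{r-1}Δ}(t), …, y^{Δ^r}(t))`, a function on `T^{κ^r}`. -/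
noncomputable def partialAlong (T : Set ℝ) (r : ℕ) (L : ℝ → (Fin (r + 1) → ℝ) → ℝ) (y : ℝ → ℝ)
    (i : Fin (r + 1)) (t : ℝ) : ℝ :=
  partialU L i t (jet T r y t)

end TimeScale

/-!
A compact time scale on which `σ` is affine up to `ρ(b)` is of one of two kinds. If `σ` is the
identity there, then `T` is the interval `[a, b]` (`TimeScale.eq_Icc_of_sigma_eq_self`) and
`Δ`-derivatives are ordinary one-dimensional derivatives. Otherwise all points of `T` are isolated,
except possibly one point `p`, the fixed point of the affine map, around which `T` is geometric
(`TimeScale.IsGeometric`, `TimeScale.exists_isGeometric`).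

In both cases the equation comes from the vanishing of the first variation
(`TimeScale.IsWeakLocalMin.first_variation`). This holds on every compact time scale: the
`Δ`-integral is the Lebesgue integral of the function made constant on the gaps of `T`
(`TimeScale.integral_eq_integral_floorPt`), so one may differentiate under the integral sign.

On an interval this is the classical theorem, where the regularity of the extremal and of `L` is
assumed and integration by parts is immediate (`TimeScale.IsWeakLocalMin.eulerLagrange_Icc`).

On a geometric time scale, the equation at an isolated point `t` follows by varying `y` at the
single point `σ^r(t)`. The first variation is then a finite sum over `t, σ(t), …, σ^r(t)`, which is
summed by parts; as `μ(σ(t)) = a₁ μ(t)`, moving `σ` past `Δ` produces the powers of `1 / a₁`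
(`TimeScale.sum_mul_seqQuot_iterate_single`, `TimeScale.IsWeakLocalMin.eulerLagrange_of_ne`). The
point `p`, where `T` accumulates, is reached by continuity
(`TimeScale.IsWeakLocalMin.eulerLagrange_of_isGeometric`), once the derivatives in the equation are
known to exist and to be continuous there. For this, having `n` continuous `Δ`-derivatives is
translated into having a Taylor expansion of order `n` at `p` (`TimeScale.HasExpansion`): since
consecutive points approach `p` geometrically, difference quotients of an `o((t - p)^(n+1))` are
`o((t - p)^n)`, and conversely by a mean value inequality. Expansions are stable under composition
with functions of class `C^n` in the mixed sense (`TimeScale.MixedC.hasExpansion_comp`), although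
`Δ`-derivatives obey no chain rule.
-/

namespace TimeScale

open Set Filter Topology

/-! ### Jump operators and the sets `T^{κ^n}` -/

variable {T : Set ℝ} {f g : ℝ → ℝ} {a b c d s t : ℝ}

theorem isGLB_sigma (h : (T ∩ Ioi t).Nonempty) : IsGLB (T ∩ Ioi t) (sigma T t) := by
  rw [sigma, if_pos h]
  exact isGLB_csInf h ⟨t, fun x hx => hx.2.le⟩

theorem sigma_mem (hT : IsCompact T) (ht : t ∈ T) : sigma T t ∈ T := by
  by_cases h : (T ∩ Ioi t).Nonempty
  · exact closure_minimal inter_subset_left hT.isClosed ((isGLB_sigma h).mem_closure h)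
  · rw [sigma, if_neg h]
    exact hT.sSup_mem ⟨t, ht⟩

theorem le_sigma (hT : IsCompact T) (ht : t ∈ T) : t ≤ sigma T t := by
  by_cases h : (T ∩ Ioi t).Nonempty
  · exact (isGLB_sigma h).2 fun x hx => hx.2.le
  · rw [sigma, if_neg h]
    exact le_csSup hT.bddAbove ht

theorem sigma_le (hs : s ∈ T) (h : t < s) : sigma T t ≤ s :=
  (isGLB_sigma ⟨s, hs, h⟩).1 ⟨hs, h⟩

theorem le_of_lt_sigma (hs : s ∈ T) (h : s < sigma T t) : s ≤ t := by
  by_contra! hc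
  exact absurd (sigma_le hs hc) h.not_ge

theorem sigma_le_sigma (hT : IsCompact T) (ht : t ∈ T) (h : s ≤ t) :
    sigma T s ≤ sigma T t := by
  rcases h.eq_or_lt with rfl | h
  · exact le_rfl
  · exact (sigma_le ht h).trans (le_sigma hT ht)

theorem sigma_eq_of_isGreatest (h : IsGreatest T b) : sigma T b = b := by
  have : ¬ (T ∩ Ioi b).Nonempty := fun ⟨x, hx, hbx⟩ => absurd (h.2 hx) (not_le.2 hbx)
  rw [sigma, if_neg this]
  exact h.csSup_eq

theorem exists_right_near (hs : s ∈ T) (hts : t < s) (h : sigma T t = t) {δ : ℝ} (hδ : 0 < δ) :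
    ∃ x ∈ T, t < x ∧ x < t + δ := by
  have h1 := isGLB_sigma (T := T) (t := t) ⟨s, hs, hts⟩
  rw [h] at h1
  obtain ⟨x, hx, h2, h3⟩ := h1.exists_between (show t < t + δ by linarith)
  exact ⟨x, hx.1, hx.2, h3⟩

theorem isLUB_rho (h : (T ∩ Iio t).Nonempty) : IsLUB (T ∩ Iio t) (rho T t) := by
  rw [rho, if_pos h]
  exact isLUB_csSup h ⟨t, fun x hx => hx.2.le⟩

theorem rho_mem (hT : IsCompact T) (ht : t ∈ T) : rho T t ∈ T := by
  by_cases h : (T ∩ Iio t).Nonempty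
  · exact closure_minimal inter_subset_left hT.isClosed ((isLUB_rho h).mem_closure h)
  · rw [rho, if_neg h]
    exact hT.sInf_mem ⟨t, ht⟩

theorem rho_le (hT : IsCompact T) (ht : t ∈ T) : rho T t ≤ t := by
  by_cases h : (T ∩ Iio t).Nonempty
  · exact (isLUB_rho h).2 fun x hx => hx.2.le
  · rw [rho, if_neg h]
    exact csInf_le hT.bddBelow ht

theorem le_rho (hs : s ∈ T) (h : s < t) : s ≤ rho T t :=
  (isLUB_rho ⟨s, hs, h⟩).1 ⟨hs, h⟩

theorem exists_left_near (hs : s ∈ T) (hst : s < t) (h : rho T t = t) {δ : ℝ} (hδ : 0 < δ) :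
    ∃ x ∈ T, t - δ < x ∧ x < t := by
  have h1 := isLUB_rho (T := T) (t := t) ⟨s, hs, hst⟩
  rw [h] at h1
  obtain ⟨x, hx, h2, h3⟩ := h1.exists_between (show t - δ < t by linarith)
  exact ⟨x, hx.1, h2, hx.2⟩

theorem sigma_rho (hT : IsCompact T) (ht : t ∈ T) (h : rho T t < t) : sigma T (rho T t) = t := by
  refine le_antisymm (sigma_le ht h) ?_
  by_contra! hc
  have h1 : sigma T (rho T t) ≤ rho T t := le_rho (sigma_mem hT (rho_mem hT ht)) hc
  have h2 := le_antisymm h1 (le_sigma hT (rho_mem hT ht))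
  obtain ⟨x, hx, h3, h4⟩ := exists_right_near ht h h2 (sub_pos.2 h)
  exact absurd (le_rho hx (by linarith)) h3.not_ge

theorem sigma_inter_Iic (hc : c ∈ T) (h : t < c) : sigma (T ∩ Iic c) t = sigma T t := by
  have h1 := isGLB_sigma (T := T ∩ Iic c) (t := t) ⟨c, ⟨hc, self_mem_Iic⟩, h⟩
  have h2 := isGLB_sigma (T := T) (t := t) ⟨c, hc, h⟩
  refine h1.unique ⟨fun x hx => h2.1 ⟨hx.1.1, hx.2⟩, fun x hx => h2.2 fun z hz => ?_⟩
  rcases le_total z c with hz' | hz'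
  · exact hx ⟨⟨hz.1, hz'⟩, hz.2⟩
  · exact (hx ⟨⟨hc, self_mem_Iic⟩, h⟩).trans hz'

theorem rho_inter_Iic (hc : c ∈ T) : rho (T ∩ Iic c) c = rho T c := by
  have h1 : T ∩ Iic c ∩ Iio c = T ∩ Iio c := by
    ext x; simp only [mem_inter_iff, mem_Iic, mem_Iio]
    exact ⟨fun h => ⟨h.1.1, h.2⟩, fun h => ⟨⟨h.1, h.2.le⟩, h.2⟩⟩
  by_cases h : (T ∩ Iio c).Nonempty
  · rw [rho, rho, h1, if_pos h, if_pos h]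
  · rw [rho, rho, h1, if_neg h, if_neg h]
    have hl : ∀ x ∈ T, c ≤ x := fun x hx => by
      by_contra! hc
      exact h ⟨x, hx, hc⟩
    have h2 : IsLeast T c := ⟨hc, hl⟩
    have h3 : IsLeast (T ∩ Iic c) c := ⟨⟨hc, self_mem_Iic⟩, fun x hx => hl x hx.1⟩
    rw [h2.csInf_eq, h3.csInf_eq]

theorem kappa_subset : kappa T ⊆ T := fun _ h => h.1

theorem mem_kappa_of_lt (ht : t ∈ T) (hs : s ∈ T) (h : t < s) : t ∈ kappa T :=
  ⟨ht, Or.inl fun hg => absurd (hg.2 hs) h.not_ge⟩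

theorem kappa_eq (hT : IsCompact T) (hb : IsGreatest T b) : kappa T = T ∩ Iic (rho T b) := by
  ext x
  constructor
  · rintro ⟨hx, h⟩
    refine ⟨hx, ?_⟩
    rcases (hb.2 hx).eq_or_lt with rfl | hlt
    · rcases h with h | h
      · exact absurd hb h
      · exact h.ge
    · exact le_rho hx hlt
  · rintro ⟨hx, h⟩
    rcases (hb.2 hx).eq_or_lt with rfl | hlt
    · exact ⟨hx, Or.inr (le_antisymm (rho_le hT hx) h)⟩
    · exact mem_kappa_of_lt hx hb.1 hlt

theorem isCompact_kappa (hT : IsCompact T) : IsCompact (kappa T) := by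
  rcases T.eq_empty_or_nonempty with rfl | h
  · have : kappa (∅ : Set ℝ) = ∅ := subset_empty_iff.1 kappa_subset
    rw [this]; exact isCompact_empty
  · rw [kappa_eq hT (hT.isGreatest_sSup h)]
    exact hT.inter_right isClosed_Iic

theorem kappaIter_succ (T : Set ℝ) (n : ℕ) : kappaIter T (n + 1) = kappa (kappaIter T n) :=
  Function.iterate_succ_apply' _ _ _

theorem kappaIter_add (T : Set ℝ) (m n : ℕ) :
    kappaIter (kappaIter T m) n = kappaIter T (m + n) := by
  rw [kappaIter, kappaIter, kappaIter, add_comm, Function.iterate_add_apply]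

theorem kappaIter_antitone (T : Set ℝ) : Antitone (kappaIter T) :=
  antitone_nat_of_succ_le fun n => by rw [kappaIter_succ]; exact kappa_subset

theorem isCompact_kappaIter (hT : IsCompact T) (n : ℕ) : IsCompact (kappaIter T n) := by
  induction n with
  | zero => exact hT
  | succ n ih => rw [kappaIter_succ]; exact isCompact_kappa ih

theorem iterate_rho_mem (hT : IsCompact T) (hb : b ∈ T) (n : ℕ) : (rho T)^[n] b ∈ T := by
  induction n with
  | zero => exact hb
  | succ n ih => rw [Function.iterate_succ_apply']; exact rho_mem hT ih

/-- `T^{κ^n}` is the initial segment of `T` that ends at `ρ^n(b)`. -/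
theorem kappaIter_eq (hT : IsCompact T) (hb : IsGreatest T b) (n : ℕ) :
    kappaIter T n = T ∩ Iic ((rho T)^[n] b) := by
  induction n with
  | zero => exact (inter_eq_left.2 fun x hx => hb.2 hx).symm
  | succ n ih =>
    have hm := iterate_rho_mem hT hb.1 n
    have hg : IsGreatest (kappaIter T n) ((rho T)^[n] b) := by
      rw [ih]; exact ⟨⟨hm, self_mem_Iic⟩, fun x hx => hx.2⟩
    rw [kappaIter_succ, kappa_eq (isCompact_kappaIter hT n) hg, ih, rho_inter_Iic hm,
      Function.iterate_succ_apply', inter_assoc, Iic_inter_Iic, min_eq_right (rho_le hT hm)]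

theorem isGreatest_kappaIter (hT : IsCompact T) (hb : IsGreatest T b) (n : ℕ) :
    IsGreatest (kappaIter T n) ((rho T)^[n] b) := by
  rw [kappaIter_eq hT hb]
  exact ⟨⟨iterate_rho_mem hT hb.1 n, self_mem_Iic⟩, fun x hx => hx.2⟩

/-- `T^κ` lacks at most the maximum of `T`. -/
theorem encard_le_encard_kappa_add_one (hT : IsCompact T) : T.encard ≤ (kappa T).encard + 1 := by
  rcases T.eq_empty_or_nonempty with rfl | h
  · simp
  · have hg := hT.isGreatest_sSup h
    have : T ⊆ insert (sSup T) (kappa T) := by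
      intro x hx
      rcases (hg.2 hx).eq_or_lt with h | h
      · exact Or.inl h
      · exact Or.inr (mem_kappa_of_lt hx hg.1 h)
    exact (encard_le_encard this).trans (encard_insert_le _ _)

theorem encard_le_encard_kappaIter_add (hT : IsCompact T) (n : ℕ) :
    T.encard ≤ (kappaIter T n).encard + n := by
  induction n with
  | zero => simp [kappaIter]
  | succ n ih =>
    refine ih.trans ?_
    rw [kappaIter_succ, Nat.cast_succ, add_comm (n : ℕ∞) 1, ← add_assoc]
    gcongr
    exact encard_le_encard_kappa_add_one (isCompact_kappaIter hT n)

theorem nontrivial_kappaIter (hT : IsCompact T) {m n : ℕ} (hc : ((m + 1 : ℕ) : ℕ∞) ≤ T.encard)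
    (h : n < m) : (kappaIter T n).Nontrivial := by
  rw [← one_lt_encard_iff_nontrivial]
  by_contra! hle
  have h1 := hc.trans ((encard_le_encard_kappaIter_add hT n).trans (add_le_add_left hle _))
  have h2 : ((m + 1 : ℕ) : ℕ∞) ≤ ((1 + n : ℕ) : ℕ∞) := by exact_mod_cast h1
  have := Nat.cast_le.1 h2
  omega

/-! ### The `Δ`-derivative -/

/-- At `s = t` the defining estimate holds for every `ε`, so it is an equality. -/
theorem HasDeltaDerivAt.sigma_sub (h : HasDeltaDerivAt T f d t) (ht : t ∈ T) :
    f (sigma T t) - f t = d * (sigma T t - t) := by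
  by_cases hst : sigma T t = t
  · rw [hst]; ring
  · have hpos : 0 < |sigma T t - t| := abs_pos.2 (sub_ne_zero.2 hst)
    rw [← sub_eq_zero, ← abs_eq_zero]
    refine le_antisymm (le_of_forall_pos_le_add fun ε hε => ?_) (abs_nonneg _)
    obtain ⟨δ, hδ, h1⟩ := h (ε / |sigma T t - t|) (div_pos hε hpos)
    have := h1 t ht (by simpa using hδ)
    rwa [div_mul_cancel₀ _ hpos.ne', ← zero_add ε] at this

/-- At a right-dense point (and at the maximum) the `Δ`-derivative is the derivative within `T`. -/
theorem hasDeltaDerivAt_iff_hasDerivWithinAt (h : sigma T t = t) :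
    HasDeltaDerivAt T f d t ↔ HasDerivWithinAt f d T t := by
  rw [hasDerivWithinAt_iff_isLittleO, Asymptotics.isLittleO_iff, HasDeltaDerivAt, h]
  refine forall_congr' fun ε => forall_congr' fun hε => ?_
  rw [eventually_iff, Metric.mem_nhdsWithin_iff]
  refine exists_congr fun δ => and_congr_right fun hδ => ?_
  have key : ∀ s, ‖f s - f t - (s - t) • d‖ = |f t - f s - d * (t - s)| := fun s => by
    rw [Real.norm_eq_abs, ← abs_neg]; congr 1; simp only [smul_eq_mul]; ring
  constructor
  · rintro h1 s ⟨hs, hsT⟩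
    rw [Metric.mem_ball, Real.dist_eq] at hs
    rw [mem_ofPred_eq, key, Real.norm_eq_abs, abs_sub_comm s t]
    exact h1 s hsT hs
  · intro h1 s hsT hs
    have : s ∈ {s | ‖f s - f t - (s - t) • d‖ ≤ ε * ‖s - t‖} :=
      h1 ⟨by rwa [Metric.mem_ball, Real.dist_eq], hsT⟩
    rwa [mem_ofPred_eq, key, Real.norm_eq_abs, abs_sub_comm s t] at this

theorem HasDeltaDerivAt.continuousWithinAt (h : HasDeltaDerivAt T f d t) (ht : t ∈ T) :
    ContinuousWithinAt f T t := by
  have hσ := h.sigma_sub ht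
  rw [Metric.continuousWithinAt_iff]
  intro ε hε
  set m := |sigma T t - t|
  have hm : 0 ≤ m := abs_nonneg _
  obtain ⟨δ, hδ, h1⟩ := h (ε / (2 * (m + 1))) (by positivity)
  refine ⟨min δ (min 1 (ε / (2 * (|d| + 1)))), by positivity, fun s hs hd => ?_⟩
  rw [Real.dist_eq] at hd ⊢
  obtain ⟨hd1, hd2, hd3⟩ : |s - t| < δ ∧ |s - t| < 1 ∧ |s - t| < ε / (2 * (|d| + 1)) := by
    simpa [lt_min_iff] using hd
  have h2 := h1 s hs hd1
  have h3 : f s - f t = d * (s - t) - (f (sigma T t) - f s - d * (sigma T t - s)) := by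
    linear_combination hσ
  have h4 : |sigma T t - s| ≤ m + 1 := by
    have := abs_sub_abs_le_abs_sub (sigma T t - s) (sigma T t - t)
    have h5 : sigma T t - s - (sigma T t - t) = -(s - t) := by ring
    rw [h5, abs_neg] at this
    linarith
  have h5 : ε / (2 * (m + 1)) * |sigma T t - s| ≤ ε / 2 := by
    calc _ ≤ ε / (2 * (m + 1)) * (m + 1) := by gcongr
      _ = ε / 2 := by field_simp
  have h6 : |d * (s - t)| < ε / 2 := by
    rw [abs_mul]
    calc |d| * |s - t| ≤ (|d| + 1) * |s - t| := by gcongr; linarith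
      _ < (|d| + 1) * (ε / (2 * (|d| + 1))) := by gcongr
      _ = ε / 2 := by field_simp
  rw [h3]
  calc _ ≤ |d * (s - t)| + |f (sigma T t) - f s - d * (sigma T t - s)| := abs_sub _ _
    _ < ε := by linarith

/-- In a time scale with more than one point, `T^κ` consists of points at which the difference
quotients of the `Δ`-derivative make sense. -/
theorem exists_near_ne_sigma (hn : T.Nontrivial) (ht : t ∈ kappa T) {δ : ℝ}
    (hδ : 0 < δ) : ∃ s ∈ T, |s - t| < δ ∧ s ≠ sigma T t := by
  by_cases h : sigma T t = t
  · rw [h]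
    by_cases hg : IsGreatest T t
    · have hρ : rho T t = t := ht.2.resolve_left (not_not.2 hg)
      obtain ⟨s, hs, hst⟩ := hn.exists_ne t
      obtain ⟨x, hx, h1, h2⟩ := exists_left_near hs ((hg.2 hs).lt_of_ne hst) hρ hδ
      exact ⟨x, hx, by rw [abs_lt]; constructor <;> linarith, h2.ne⟩
    · obtain ⟨s, hs, hst⟩ : ∃ s ∈ T, t < s := by
        by_contra! hc
        exact hg ⟨ht.1, hc⟩
      obtain ⟨x, hx, h1, h2⟩ := exists_right_near hs hst h hδ
      exact ⟨x, hx, by rw [abs_lt]; constructor <;> linarith, h1.ne'⟩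
  · exact ⟨t, ht.1, by simpa using hδ, Ne.symm h⟩

theorem HasDeltaDerivAt.unique {d' : ℝ} (hn : T.Nontrivial) (ht : t ∈ kappa T)
    (h : HasDeltaDerivAt T f d t) (h' : HasDeltaDerivAt T f d' t) : d = d' := by
  rw [← sub_eq_zero, ← abs_eq_zero]
  refine le_antisymm (le_of_forall_pos_le_add fun ε hε => ?_) (abs_nonneg _)
  obtain ⟨δ, hδ, h1⟩ := h (ε / 2) (by positivity)
  obtain ⟨δ', hδ', h1'⟩ := h' (ε / 2) (by positivity)
  obtain ⟨s, hs, hst, hne⟩ := exists_near_ne_sigma hn ht (lt_min hδ hδ')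
  have h2 := h1 s hs (hst.trans_le (min_le_left _ _))
  have h3 := h1' s hs (hst.trans_le (min_le_right _ _))
  have hpos : 0 < |sigma T t - s| := abs_pos.2 (sub_ne_zero.2 hne.symm)
  have h4 : |d - d'| * |sigma T t - s| ≤ ε * |sigma T t - s| := by
    rw [← abs_mul]
    have : (d - d') * (sigma T t - s) = (f (sigma T t) - f s - d' * (sigma T t - s)) -
        (f (sigma T t) - f s - d * (sigma T t - s)) := by ring
    rw [this]
    exact (abs_sub _ _).trans (by linarith)
  simpa using le_of_mul_le_mul_right h4 hpos

theorem hasDeltaDerivAt_deltaDeriv (h : ∃ d, HasDeltaDerivAt T f d t) :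
    HasDeltaDerivAt T f (deltaDeriv T f t) t := by
  rw [deltaDeriv, dif_pos h]
  exact h.choose_spec

theorem HasDeltaDerivAt.deltaDeriv_eq (hn : T.Nontrivial) (ht : t ∈ kappa T)
    (h : HasDeltaDerivAt T f d t) : deltaDeriv T f t = d :=
  (hasDeltaDerivAt_deltaDeriv ⟨d, h⟩).unique hn ht h

theorem hasDeltaDerivAt_congr (hT : IsCompact T) (ht : t ∈ T) (h : ∀ s ∈ T, f s = g s) (d : ℝ) :
    HasDeltaDerivAt T f d t ↔ HasDeltaDerivAt T g d t := by
  refine forall_congr' fun ε => forall_congr' fun _ => exists_congr fun δ =>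
    and_congr_right fun _ => forall_congr' fun s => forall_congr' fun hs => ?_
  rw [h s hs, h _ (sigma_mem hT ht)]

theorem deltaDeriv_congr (hT : IsCompact T) (ht : t ∈ T) (h : ∀ s ∈ T, f s = g s) :
    deltaDeriv T f t = deltaDeriv T g t := by
  classical
  have h1 : ∀ p q : ℝ → Prop, p = q → ((if h : ∃ d, p d then h.choose else 0) : ℝ) =
      if h : ∃ d, q d then h.choose else 0 := by
    rintro p _ rfl; rfl
  exact h1 _ _ (funext fun d => propext (hasDeltaDerivAt_congr hT ht h d))

theorem deltaIter_congr (hT : IsCompact T) (h : ∀ s ∈ T, f s = g s) (n : ℕ)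
    (ht : t ∈ kappaIter T n) : deltaIter T f n t = deltaIter T g n t := by
  induction n generalizing t with
  | zero => exact h t ht
  | succ n ih =>
    exact deltaDeriv_congr (isCompact_kappaIter hT n) (kappaIter_antitone T n.le_succ ht)
      fun s hs => ih hs

theorem DeltaDifferentiable.congr (hT : IsCompact T) (h : ∀ s ∈ T, f s = g s) {n : ℕ}
    (hf : DeltaDifferentiable T n f) : DeltaDifferentiable T n g := fun k hk t ht => by
  obtain ⟨d, hd⟩ := hf k hk t ht
  exact ⟨d, (hasDeltaDerivAt_congr (isCompact_kappaIter hT k)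
    (kappaIter_antitone T k.le_succ ht) (fun s hs => deltaIter_congr hT h k hs) d).1 hd⟩

theorem HasDeltaDerivAt.add_const_mul {d' : ℝ} (hf : HasDeltaDerivAt T f d t)
    (hg : HasDeltaDerivAt T g d' t) (c : ℝ) :
    HasDeltaDerivAt T (fun s => f s + c * g s) (d + c * d') t := by
  intro ε hε
  obtain ⟨δ, hδ, h⟩ := hf (ε / 2) (by positivity)
  obtain ⟨δ', hδ', h'⟩ := hg (ε / (2 * (|c| + 1))) (by positivity)
  refine ⟨min δ δ', by positivity, fun s hs hst => ?_⟩
  have h1 := h s hs (hst.trans_le (min_le_left _ _))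
  have h2 := h' s hs (hst.trans_le (min_le_right _ _))
  set m := |sigma T t - s|
  have h3 : |c * (g (sigma T t) - g s - d' * (sigma T t - s))| ≤ ε / 2 * m := by
    rw [abs_mul]
    calc _ ≤ (|c| + 1) * (ε / (2 * (|c| + 1)) * m) := by gcongr; linarith
      _ = ε / 2 * m := by field_simp
  have : f (sigma T t) + c * g (sigma T t) - (f s + c * g s) - (d + c * d') * (sigma T t - s) =
      (f (sigma T t) - f s - d * (sigma T t - s)) +
        c * (g (sigma T t) - g s - d' * (sigma T t - s)) := by ring
  rw [this]
  exact (abs_add_le _ _).trans (by linarith)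

theorem deltaIter_add_const_mul (hT : IsCompact T) {n : ℕ}
    (hn : ∀ k < n, (kappaIter T k).Nontrivial) (hf : DeltaDifferentiable T n f)
    (hg : DeltaDifferentiable T n g) (c : ℝ) :
    DeltaDifferentiable T n (fun s => f s + c * g s) ∧ ∀ t ∈ kappaIter T n,
      deltaIter T (fun s => f s + c * g s) n t = deltaIter T f n t + c * deltaIter T g n t := by
  induction n with
  | zero => exact ⟨fun k hk => absurd hk k.not_lt_zero, fun t _ => rfl⟩
  | succ n ih =>
    obtain ⟨ih1, ih2⟩ := ih (fun k hk => hn k (by omega)) (fun k hk => hf k (by omega))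
      (fun k hk => hg k (by omega))
    have key : ∀ t ∈ kappaIter T (n + 1), HasDeltaDerivAt (kappaIter T n)
        (deltaIter T (fun s => f s + c * g s) n)
        (deltaIter T f (n + 1) t + c * deltaIter T g (n + 1) t) t := fun t ht =>
      (hasDeltaDerivAt_congr (isCompact_kappaIter hT n) (kappaIter_antitone T n.le_succ ht) ih2 _).2
        ((hasDeltaDerivAt_deltaDeriv (hf n n.lt_succ_self t ht)).add_const_mul
          (hasDeltaDerivAt_deltaDeriv (hg n n.lt_succ_self t ht)) c)
    refine ⟨fun k hk t ht => ?_, fun t ht => ?_⟩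
    · rcases Nat.lt_succ_iff_lt_or_eq.1 hk with hk | rfl
      · exact ih1 k hk t ht
      · exact ⟨_, key t ht⟩
    · exact (key t ht).deltaDeriv_eq (hn n n.lt_succ_self)
        (by rwa [← kappaIter_succ])

theorem deltaDifferentiable_zero (T : Set ℝ) (n : ℕ) (hT : IsCompact T)
    (hn : ∀ k < n, (kappaIter T k).Nontrivial) :
    DeltaDifferentiable T n (fun _ => 0) ∧ ∀ t ∈ kappaIter T n, deltaIter T (fun _ => 0) n t = 0 := by
  induction n with
  | zero => exact ⟨fun k hk => absurd hk k.not_lt_zero, fun t _ => rfl⟩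
  | succ n ih =>
    obtain ⟨ih1, ih2⟩ := ih fun k hk => hn k (by omega)
    have key : ∀ t ∈ kappaIter T (n + 1), HasDeltaDerivAt (kappaIter T n)
        (deltaIter T (fun _ => 0) n) 0 t := fun t ht =>
      (hasDeltaDerivAt_congr (isCompact_kappaIter hT n) (kappaIter_antitone T n.le_succ ht) ih2 _).2
        fun ε hε => ⟨1, one_pos, fun s _ _ => by simp; positivity⟩
    refine ⟨fun k hk t ht => ?_, fun t ht => ?_⟩
    · rcases Nat.lt_succ_iff_lt_or_eq.1 hk with hk | rfl
      · exact ih1 k hk t ht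
      · exact ⟨_, key t ht⟩
    · exact (key t ht).deltaDeriv_eq (hn n n.lt_succ_self)
        (by rwa [← kappaIter_succ])

theorem deltaIter_const_mul (hT : IsCompact T) {n : ℕ}
    (hn : ∀ k < n, (kappaIter T k).Nontrivial) (hg : DeltaDifferentiable T n g) (c : ℝ)
    (ht : t ∈ kappaIter T n) :
    deltaIter T (fun s => c * g s) n t = c * deltaIter T g n t := by
  have h0 := deltaDifferentiable_zero T n hT hn
  have := (deltaIter_add_const_mul hT hn h0.1 hg c).2 t ht
  simpa [h0.2 t ht] using this

/-- The mean value inequality on a time scale. -/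
theorem abs_sub_le_of_hasDeltaDerivAt (hT : IsCompact T) {g' : ℝ → ℝ} {M : ℝ}
    (hc : c ∈ T) (hd : d ∈ T) (hcd : c ≤ d)
    (hg : ∀ s ∈ kappa T, c ≤ s → s ≤ d → HasDeltaDerivAt T g (g' s) s ∧ |g' s| ≤ M) :
    |g d - g c| ≤ M * (d - c) := by
  -- with `M + ε` in place of `M`, consider the infimum of the points that violate the bound
  suffices H : ∀ ε > 0, ∀ x ∈ T, c ≤ x → x ≤ d → |g x - g c| ≤ (M + ε) * (x - c) by
    refine le_of_forall_pos_le_add fun ε hε => ?_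
    have := H (ε / (d - c + 1)) (by have := sub_nonneg.2 hcd; positivity) d hd hcd le_rfl
    refine this.trans ?_
    rw [add_mul]
    have h0 := sub_nonneg.2 hcd
    gcongr
    calc ε / (d - c + 1) * (d - c) ≤ ε / (d - c + 1) * (d - c + 1) := by gcongr; linarith
      _ = ε := by field_simp
  intro ε hε
  by_contra! hcon
  set B : Set ℝ := {x | x ∈ T ∧ c ≤ x ∧ x ≤ d ∧ (M + ε) * (x - c) < |g x - g c|} with hB
  have hne : B.Nonempty := by
    obtain ⟨x, h1, h2, h3, h4⟩ := hcon
    exact ⟨x, h1, h2, h3, h4⟩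
  have hbd : BddBelow B := ⟨c, fun x hx => hx.2.1⟩
  have hglb := isGLB_csInf hne hbd
  set z := sInf B
  have hzT : z ∈ T :=
    closure_minimal (fun x hx => hx.1) hT.isClosed (hglb.mem_closure hne)
  have hcz : c ≤ z := hglb.2 fun x hx => hx.2.1
  obtain ⟨x₀, hx₀⟩ := hne
  have hzd : z ≤ d := (hglb.1 hx₀).trans hx₀.2.2.1
  have hlow : ∀ x ∈ T, c ≤ x → x < z → |g x - g c| ≤ (M + ε) * (x - c) := by
    intro x hx hcx hxz
    by_contra! h
    exact absurd (hglb.1 ⟨hx, hcx, (hxz.le.trans hzd), h⟩) hxz.not_ge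
  by_cases hzB : z ∈ B
  · have hcz' : c < z := by
      rcases hcz.eq_or_lt with h | h
      · have := hzB.2.2.2
        rw [← h] at this
        simp at this
      · exact h
    rcases (rho_le hT hzT).eq_or_lt with hρ | hρ
    · have hzκ : z ∈ kappa T := ⟨hzT, Or.inr hρ⟩
      have hcont := (hg z hzκ hcz hzd).1.continuousWithinAt hzT
      have h1 : ContinuousWithinAt (fun x => (M + ε) * (x - c) - |g x - g c|) T z :=
        ((continuous_const.mul (continuous_id.sub continuous_const)).continuousWithinAt).sub
          (hcont.sub continuousWithinAt_const).abs
      have h2 := h1.eventually (gt_mem_nhds (sub_neg.2 hzB.2.2.2))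
      rw [eventually_iff, Metric.mem_nhdsWithin_iff] at h2
      obtain ⟨δ, hδ, h2⟩ := h2
      obtain ⟨x, hx, h3, h4⟩ := exists_left_near hc hcz' hρ (lt_min hδ (sub_pos.2 hcz'))
      have h5 : z - δ < x := by have := min_le_left δ (z - c); linarith
      have h6 : c < x := by have := min_le_right δ (z - c); linarith
      have h7 := h2 ⟨by rw [Metric.mem_ball, Real.dist_eq, abs_lt]; constructor <;> linarith, hx⟩
      have h8 := hlow x hx h6.le h4
      have h9 : (M + ε) * (x - c) - |g x - g c| < 0 := h7
      linarith
    · have hρT := rho_mem hT hzT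
      have hcρ : c ≤ rho T z := le_rho hc hcz'
      have h1 := hg _ (mem_kappa_of_lt hρT hzT hρ) hcρ (hρ.le.trans hzd)
      have h2 := h1.1.sigma_sub hρT
      rw [sigma_rho hT hzT hρ] at h2
      have h3 := hlow _ hρT hcρ hρ
      have h4 : |g z - g (rho T z)| ≤ (M + ε) * (z - rho T z) := by
        rw [h2, abs_mul, abs_of_pos (sub_pos.2 hρ)]
        have := sub_pos.2 hρ
        gcongr
        linarith [h1.2]
      have h5 := hzB.2.2.2
      have h6 : |g z - g c| ≤ |g z - g (rho T z)| + |g (rho T z) - g c| := abs_sub_le _ _ _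
      nlinarith
  · -- the violating points accumulate at `z` from the right
    have hz : |g z - g c| ≤ (M + ε) * (z - c) := by
      by_contra! h
      exact hzB ⟨hzT, hcz, hzd, h⟩
    have hlt : ∀ x ∈ B, z < x := fun x hx =>
      (hglb.1 hx).lt_of_ne fun h => hzB (h ▸ hx)
    have hσ : sigma T z = z := by
      refine le_antisymm (hglb.2 fun x hx => sigma_le hx.1 (hlt x hx)) (le_sigma hT hzT)
    obtain ⟨h1, h2⟩ := hg z (mem_kappa_of_lt hzT hx₀.1 (hlt _ hx₀)) hcz hzd
    obtain ⟨δ, hδ, h3⟩ := h1 ε hε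
    obtain ⟨x, hx, h4, h5⟩ := hglb.exists_between (show z < z + δ by linarith)
    have h6 := h3 x hx.1 (by rw [abs_lt]; constructor <;> linarith [hlt x hx])
    have h7 := hlt x hx
    rw [hσ, abs_sub_comm z x, abs_of_pos (sub_pos.2 h7)] at h6
    have h8 : |g x - g c| ≤ |g z - g c| + (|g' z * (z - x)| + |g z - g x - g' z * (z - x)|) := by
      have : g x - g c = (g z - g c) - (g' z * (z - x) + (g z - g x - g' z * (z - x))) := by ring
      rw [this]
      exact (abs_sub _ _).trans (add_le_add_right (abs_add_le _ _) _)
    have h9 : |g' z * (z - x)| ≤ M * (x - z) := by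
      rw [abs_mul, abs_sub_comm z x, abs_of_pos (sub_pos.2 h7)]
      have := sub_pos.2 h7
      gcongr
    have := hx.2.2.2
    nlinarith

end TimeScale

namespace TimeScale

open Set Filter Topology MeasureTheory

/-! ### The `Δ`-integral as a Lebesgue integral -/

variable {T : Set ℝ} {f g : ℝ → ℝ} {a b c d s t x : ℝ}

/-- The last point of `T` that is at most `x`; for `x` to the left of `T` it is the minimum of `T`,
which makes it a monotone map of `ℝ` into `T`. -/
noncomputable def floorPt (T : Set ℝ) (x : ℝ) : ℝ :=
  sSup (T ∩ Iic (max x (sInf T)))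

theorem isGreatest_floorPt (hT : IsCompact T) (hne : T.Nonempty) (x : ℝ) :
    IsGreatest (T ∩ Iic (max x (sInf T))) (floorPt T x) :=
  (hT.inter_right isClosed_Iic).isGreatest_sSup ⟨sInf T, hT.sInf_mem hne, mem_Iic.2 (le_max_right _ _)⟩

theorem floorPt_mem (hT : IsCompact T) (hne : T.Nonempty) (x : ℝ) : floorPt T x ∈ T :=
  (isGreatest_floorPt hT hne x).1.1

theorem floorPt_mono (hT : IsCompact T) (hne : T.Nonempty) : Monotone (floorPt T) := fun x y h =>
  (isGreatest_floorPt hT hne y).2 ⟨floorPt_mem hT hne x,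
    (isGreatest_floorPt hT hne x).1.2.trans (max_le_max_right _ h)⟩

theorem floorPt_le (hT : IsCompact T) (ht : t ∈ T) (h : t ≤ x) : floorPt T x ≤ x := by
  have h1 := (isGreatest_floorPt hT ⟨t, ht⟩ x).1.2
  rwa [mem_Iic, max_eq_left ((csInf_le hT.bddBelow ht).trans h)] at h1

theorem le_floorPt (hT : IsCompact T) (ht : t ∈ T) (h : t ≤ x) : t ≤ floorPt T x :=
  (isGreatest_floorPt hT ⟨t, ht⟩ x).2 ⟨ht, h.trans (le_max_left _ _)⟩

theorem floorPt_of_mem (hT : IsCompact T) (ht : t ∈ T) : floorPt T t = t :=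
  le_antisymm (floorPt_le hT ht le_rfl) (le_floorPt hT ht le_rfl)

theorem floorPt_eq (hT : IsCompact T) (ht : t ∈ T) (h : t ≤ x) (hx : x < sigma T t) :
    floorPt T x = t :=
  le_antisymm (le_of_lt_sigma (floorPt_mem hT ⟨t, ht⟩ x) ((floorPt_le hT ht h).trans_lt hx))
    (le_floorPt hT ht h)

theorem floorPt_mem_kappa (hT : IsCompact T) (hc : c ∈ T) (hd : d ∈ T) (h : c ≤ x) (hx : x < d) :
    floorPt T x ∈ kappa T :=
  mem_kappa_of_lt (floorPt_mem hT ⟨c, hc⟩ x) hd ((floorPt_le hT hc h).trans_lt hx)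

/-- At the right end of an integral `floorPt T` may leave `T^κ`, where `f` is not controlled; the
indicator makes the integrand measurable and bounded on the whole line. -/
theorem measurable_indicator_floorPt (hT : IsCompact T) (hne : T.Nonempty)
    (hf : ContinuousOn f (kappa T)) : Measurable fun x => (kappa T).indicator f (floorPt T x) := by
  classical
  have h1 : Measurable ((kappa T).indicator f) := by
    rw [← piecewise_eq_indicator]
    exact hf.measurable_piecewise continuousOn_const (isCompact_kappa hT).measurableSet
  exact h1.comp (floorPt_mono hT hne).measurable

theorem intervalIntegrable_indicator_floorPt (hT : IsCompact T) (hne : T.Nonempty)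
    (hf : ContinuousOn f (kappa T)) (c d : ℝ) :
    IntervalIntegrable (fun x => (kappa T).indicator f (floorPt T x)) volume c d := by
  obtain ⟨C, hC⟩ := (isCompact_kappa hT).exists_bound_of_continuousOn hf
  rw [intervalIntegrable_iff]
  refine Measure.integrableOn_of_bounded (M := max C 0) (by simp)
    (measurable_indicator_floorPt hT hne hf).aestronglyMeasurable (ae_of_all _ fun x => ?_)
  by_cases hx : floorPt T x ∈ kappa T
  · rw [indicator_of_mem hx]; exact (hC _ hx).trans (le_max_left _ _)
  · rw [indicator_of_notMem hx]; simp

theorem indicator_floorPt_ae_eq (hT : IsCompact T) (hc : c ∈ T) (hd : d ∈ T) (hcd : c ≤ d)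
    (f : ℝ → ℝ) :
    ∀ᵐ x, x ∈ uIoc c d → (kappa T).indicator f (floorPt T x) = f (floorPt T x) := by
  filter_upwards [Measure.ae_ne volume d] with x hx hxI
  rw [uIoc_of_le hcd] at hxI
  exact indicator_of_mem (floorPt_mem_kappa hT hc hd hxI.1.le (hxI.2.lt_of_ne hx)) f

theorem intervalIntegrable_floorPt (hT : IsCompact T) (hf : ContinuousOn f (kappa T))
    (hc : c ∈ T) (hd : d ∈ T) (hcd : c ≤ d) :
    IntervalIntegrable (fun x => f (floorPt T x)) volume c d :=
  (intervalIntegrable_indicator_floorPt hT ⟨c, hc⟩ hf c d).congr_ae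
    ((ae_restrict_iff' measurableSet_uIoc).2 (indicator_floorPt_ae_eq hT hc hd hcd f))

/-- A continuous function on `T^κ` has an antiderivative: the Lebesgue integral of its extension to
the real line that is constant on the gaps of `T`. -/
theorem isAntiderivative_integral_floorPt (hT : IsCompact T) (hf : ContinuousOn f (kappa T))
    (hc : c ∈ T) :
    IsAntiderivative T f fun t => ∫ x in c..t, (kappa T).indicator f (floorPt T x) := by
  intro t ht ε hε
  have hint := intervalIntegrable_indicator_floorPt hT ⟨c, hc⟩ hf
  obtain ⟨δ₀, hδ₀, h0⟩ := Metric.continuousWithinAt_iff.1 (hf t ht) ε hε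
  -- if `t` is right-scattered, then all points of `T` within `δ` of `t` are at most `σ(t)`
  obtain ⟨δ, hδ, hδδ₀, hδσ⟩ : ∃ δ > 0, δ ≤ δ₀ ∧ (t < sigma T t → δ ≤ sigma T t - t) := by
    by_cases h : t < sigma T t
    · exact ⟨min δ₀ (sigma T t - t), lt_min hδ₀ (sub_pos.2 h), min_le_left _ _,
        fun _ => min_le_right _ _⟩
    · exact ⟨δ₀, hδ₀, le_rfl, fun h' => absurd h' h⟩
  refine ⟨δ, hδ, fun s hs hst => ?_⟩
  have hσ := le_sigma hT ht.1
  have h1 : (∫ x in c..sigma T t, (kappa T).indicator f (floorPt T x)) -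
      (∫ x in c..s, (kappa T).indicator f (floorPt T x)) - f t * (sigma T t - s) =
      ∫ x in s..sigma T t, ((kappa T).indicator f (floorPt T x) - f t) := by
    rw [intervalIntegral.integral_sub (hint _ _) intervalIntegrable_const,
      intervalIntegral.integral_interval_sub_left (hint _ _) (hint _ _),
      intervalIntegral.integral_const, smul_eq_mul]
    ring
  rw [h1, ← Real.norm_eq_abs]
  refine intervalIntegral.norm_integral_le_of_norm_le_const_ae ?_
  filter_upwards [Measure.ae_ne volume s, Measure.ae_ne volume (sigma T t)] with x hxs hxσ hx
  -- between `s` and `σ(t)`, the map `floorPt T` takes values between `s` and `t`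
  obtain ⟨hκ, hle⟩ : floorPt T x ∈ kappa T ∧ |floorPt T x - t| ≤ |s - t| := by
    rcases le_total s (sigma T t) with h | h
    · rw [uIoc_of_le h] at hx
      have h2 := floorPt_le hT hs hx.1.le
      have h3 := le_floorPt hT hs hx.1.le
      have h4 : floorPt T x ≤ t := le_of_lt_sigma (floorPt_mem hT ⟨s, hs⟩ x)
        (h2.trans_lt (hx.2.lt_of_ne hxσ))
      refine ⟨?_, ?_⟩
      · rcases h4.eq_or_lt with h5 | h5
        · rw [h5]; exact ht
        · exact mem_kappa_of_lt (floorPt_mem hT ⟨s, hs⟩ x) ht.1 h5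
      · rw [abs_of_nonpos (by linarith), abs_of_nonpos (by linarith)]
        linarith
    · rw [uIoc_of_ge h] at hx
      have h5 : sigma T t = t := by
        by_contra hne
        have h6 := hδσ (hσ.lt_of_ne (Ne.symm hne))
        have h7 := (le_abs_self _).trans_lt hst
        linarith
      rw [h5] at hx h
      have h2 := floorPt_le hT ht.1 hx.1.le
      have h3 := le_floorPt hT ht.1 hx.1.le
      refine ⟨floorPt_mem_kappa hT ht.1 hs hx.1.le (hx.2.lt_of_ne hxs), ?_⟩
      rw [abs_of_nonneg (by linarith), abs_of_nonneg (by linarith)]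
      linarith [hx.2]
  rw [indicator_of_mem hκ, ← dist_eq_norm]
  exact (h0 hκ (by rw [Real.dist_eq]; linarith)).le

/-- Antiderivatives differ by a constant, by the mean value inequality; so the integral does not
depend on the chosen one. -/
theorem IsAntiderivative.sub_eq (hT : IsCompact T) {F G : ℝ → ℝ} (hF : IsAntiderivative T f F)
    (hG : IsAntiderivative T f G) (hc : c ∈ T) (hd : d ∈ T) (hcd : c ≤ d) :
    F d - F c = G d - G c := by
  have h := abs_sub_le_of_hasDeltaDerivAt (g := fun s => F s + (-1) * G s) (g' := fun _ => 0)
    (M := 0) hT hc hd hcd fun s hs _ _ => by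
      have h1 := (hF s hs).add_const_mul (hG s hs) (-1)
      exact ⟨by simpa using h1, by simp⟩
  rw [zero_mul] at h
  have := abs_nonpos_iff.1 h
  linarith

/-- The `Δ`-integral of a continuous function is the Lebesgue integral of its extension that is
constant on the gaps of `T`. -/
theorem integral_eq_integral_floorPt (hT : IsCompact T) (hf : ContinuousOn f (kappa T))
    (hc : c ∈ T) (hd : d ∈ T) (hcd : c ≤ d) :
    integral T f c d = ∫ x in c..d, f (floorPt T x) := by
  have hA := isAntiderivative_integral_floorPt hT hf hc
  have hex : ∃ G, IsAntiderivative T f G := ⟨_, hA⟩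
  rw [integral, dif_pos hex, hex.choose_spec.sub_eq hT hA hc hd hcd,
    intervalIntegral.integral_same, sub_zero]
  exact intervalIntegral.integral_congr_ae (indicator_floorPt_ae_eq hT hc hd hcd f)

end TimeScale

namespace TimeScale

open Set Filter Topology MeasureTheory

/-! ### Functions with continuous partial derivatives -/

/-- `F(t, u)` and its partial derivatives `G i` in the variables `u_i` are jointly continuous
on `K × ℝ^m`. -/
structure HasPartials {m : ℕ} (K : Set ℝ) (F : ℝ → (Fin m → ℝ) → ℝ)
    (G : Fin m → ℝ → (Fin m → ℝ) → ℝ) : Prop where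
  cont : ContinuousOn (fun p : ℝ × (Fin m → ℝ) => F p.1 p.2) (K ×ˢ Set.univ)
  deriv : ∀ i, ∀ t ∈ K, ∀ u, HasDerivAt (fun x => F t (Function.update u i x)) (G i t u) (u i)
  cont_deriv : ∀ i, ContinuousOn (fun p : ℝ × (Fin m → ℝ) => G i p.1 p.2) (K ×ˢ Set.univ)

section

variable {m : ℕ} {K : Set ℝ} {F : ℝ → (Fin m → ℝ) → ℝ} {G : Fin m → ℝ → (Fin m → ℝ) → ℝ}

theorem MixedC.continuousOn {n : ℕ} (h : MixedC n K F) :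
    ContinuousOn (fun p : ℝ × (Fin m → ℝ) => F p.1 p.2) (K ×ˢ Set.univ) := by
  cases n with
  | zero => exact h
  | succ n => exact h.1

theorem MixedC.exists_hasPartials {n : ℕ} (h : MixedC (n + 1) K F) :
    ∃ G : Fin m → ℝ → (Fin m → ℝ) → ℝ, HasPartials K F G ∧ ∀ i, MixedC n K (G i) := by
  choose G h1 h2 using h.2.1
  exact ⟨G, ⟨h.continuousOn, h1, fun i => (h2 i).continuousOn⟩, h2⟩

theorem HasPartials.partialU_eq (h : HasPartials K F G) (i : Fin m) {t : ℝ} (ht : t ∈ K)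
    (u : Fin m → ℝ) : partialU F i t u = G i t u :=
  (h.deriv i t ht u).deriv

/-- Strict differentiability in `u`, locally uniform in `t`: the coordinates of `u'` are replaced
by those of `u` one by one, with the mean value inequality for each of them. -/
theorem HasPartials.exists_forall_abs_sub_le (h : HasPartials K F G) {t₀ : ℝ} (ht₀ : t₀ ∈ K)
    (u₀ : Fin m → ℝ) {ε : ℝ} (hε : 0 < ε) :
    ∃ δ > 0, ∀ t ∈ K, |t - t₀| < δ → ∀ u u' : Fin m → ℝ, dist u u₀ < δ → dist u' u₀ < δ →
      |F t u - F t u' - ∑ i, G i t₀ u₀ * (u i - u' i)| ≤ ε * ∑ i, |u i - u' i| := by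
  have h1 : ∀ i, ∃ δ > 0, ∀ t ∈ K, |t - t₀| < δ → ∀ u : Fin m → ℝ, dist u u₀ < δ →
      |G i t u - G i t₀ u₀| ≤ ε := by
    intro i
    obtain ⟨δ, hδ, h2⟩ := Metric.continuousWithinAt_iff.1
      (h.cont_deriv i (t₀, u₀) ⟨ht₀, mem_univ _⟩) ε hε
    refine ⟨δ, hδ, fun t ht htt u hu => ?_⟩
    have := h2 (x := (t, u)) ⟨ht, mem_univ _⟩ (by
      rw [Prod.dist_eq]; exact max_lt (by simpa [Real.dist_eq] using htt) hu)
    exact this.le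
  choose δ hδ h2 using h1
  obtain ⟨δ₀, hδ₀, hle⟩ : ∃ δ₀ > 0, ∀ i, δ₀ ≤ δ i := by
    have := Finite.exists_min (fun i : Option (Fin m) => i.elim 1 δ)
    obtain ⟨i₀, hi₀⟩ := this
    refine ⟨i₀.elim 1 δ, ?_, fun i => hi₀ (some i)⟩
    cases i₀ with
    | none => exact one_pos
    | some i => exact hδ i
  refine ⟨δ₀, hδ₀, fun t ht htt => ?_⟩
  suffices H : ∀ s : Finset (Fin m), ∀ u u' : Fin m → ℝ, dist u u₀ < δ₀ → dist u' u₀ < δ₀ →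
      (∀ i ∉ s, u i = u' i) →
      |F t u - F t u' - ∑ i ∈ s, G i t₀ u₀ * (u i - u' i)| ≤ ε * ∑ i ∈ s, |u i - u' i| from
    fun u u' hu hu' => H Finset.univ u u' hu hu' (fun i hi => absurd (Finset.mem_univ i) hi)
  intro s
  induction s using Finset.induction_on with
  | empty =>
    intro u u' _ _ he
    have : u = u' := funext fun i => he i (Finset.notMem_empty i)
    simp [this]
  | insert j s hj ih =>
    intro u u' hu hu' he
    -- `v` agrees with `u` at `j` and with `u'` at the other coordinates
    set v : Fin m → ℝ := Function.update u' j (u j) with hv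
    have hvi : ∀ i ∈ s, v i = u' i := fun i hi => by
      exact Function.update_of_ne (ne_of_mem_of_not_mem hi hj) _ _
    have hball : ∀ x, |x - u₀ j| < δ₀ → dist (Function.update u' j x) u₀ < δ₀ := by
      intro x hx
      rw [dist_pi_lt_iff hδ₀] at hu' ⊢
      intro i
      rcases eq_or_ne i j with rfl | hij
      · rw [Function.update_self]; exact hx
      · rw [Function.update_of_ne hij]; exact hu' i
    have hvu : dist v u₀ < δ₀ := hball _ (by
      rw [dist_pi_lt_iff hδ₀] at hu; exact hu j)
    have h3 := ih u v hu hvu fun i hi => by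
      rcases eq_or_ne i j with rfl | hij
      · rw [hv, Function.update_self]
      · rw [hv, Function.update_of_ne hij]
        exact he i (by simp [hij, hi])
    have h4 : |F t v - F t u' - G j t₀ u₀ * (u j - u' j)| ≤ ε * |u j - u' j| := by
      have h5 := Convex.norm_image_sub_le_of_norm_hasDerivWithin_le
        (f := fun x => F t (Function.update u' j x) - G j t₀ u₀ * x)
        (f' := fun x => G j t (Function.update u' j x) - G j t₀ u₀) (C := ε)
        (s := Metric.ball (u₀ j) δ₀) (x := u' j) (y := u j)
        (fun x _ => by
          have h6 := h.deriv j t ht (Function.update u' j x)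
          simp only [Function.update_idem, Function.update_self] at h6
          have h7 := (hasDerivAt_id x).const_mul (G j t₀ u₀)
          rw [mul_one] at h7
          exact (h6.sub h7).hasDerivWithinAt)
        (fun x hx => h2 j t ht (htt.trans_le (hle j)) _
          ((hball x (by rwa [Metric.mem_ball, Real.dist_eq] at hx)).trans_le (hle j)))
        (convex_ball _ _)
        (by rw [dist_pi_lt_iff hδ₀] at hu'; exact hu' j)
        (by rw [dist_pi_lt_iff hδ₀] at hu; exact hu j)
      rw [Real.norm_eq_abs, Real.norm_eq_abs, Function.update_eq_self] at h5
      convert h5 using 2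
      ring
    rw [Finset.sum_insert hj, Finset.sum_insert hj]
    have e1 : ∑ i ∈ s, G i t₀ u₀ * (u i - v i) = ∑ i ∈ s, G i t₀ u₀ * (u i - u' i) :=
      Finset.sum_congr rfl fun i hi => by rw [hvi i hi]
    have e2 : ∑ i ∈ s, |u i - v i| = ∑ i ∈ s, |u i - u' i| :=
      Finset.sum_congr rfl fun i hi => by rw [hvi i hi]
    rw [e1, e2] at h3
    have e3 : F t u - F t u' - (G j t₀ u₀ * (u j - u' j) + ∑ i ∈ s, G i t₀ u₀ * (u i - u' i)) =
        (F t u - F t v - ∑ i ∈ s, G i t₀ u₀ * (u i - u' i)) +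
          (F t v - F t u' - G j t₀ u₀ * (u j - u' j)) := by ring
    rw [e3, mul_add]
    exact (abs_add_le _ _).trans (by linarith)

theorem HasPartials.hasFDerivAt (h : HasPartials K F G) {t : ℝ} (ht : t ∈ K) (u : Fin m → ℝ) :
    HasFDerivAt (F t) (∑ i, G i t u • (ContinuousLinearMap.proj i : (Fin m → ℝ) →L[ℝ] ℝ)) u := by
  rw [hasFDerivAt_iff_isLittleO, Asymptotics.isLittleO_iff]
  intro ε hε
  obtain ⟨δ, hδ, h1⟩ := h.exists_forall_abs_sub_le ht u (show 0 < ε / (m + 1) by positivity)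
  filter_upwards [Metric.ball_mem_nhds u hδ] with u' hu'
  have h2 := h1 t ht (by simpa using hδ) u' u hu' (by simpa using hδ)
  have e1 : (∑ i, G i t u • (ContinuousLinearMap.proj i : (Fin m → ℝ) →L[ℝ] ℝ)) (u' - u) =
      ∑ i, G i t u * (u' i - u i) := by
    simp
  rw [e1, Real.norm_eq_abs]
  refine h2.trans ?_
  have h3 : ∑ i, |u' i - u i| ≤ m * ‖u' - u‖ := by
    refine (Finset.sum_le_sum fun i _ => norm_le_pi_norm (u' - u) i).trans ?_
    simp
  calc _ ≤ ε / (m + 1) * ((m + 1) * ‖u' - u‖) := by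
        gcongr
        exact h3.trans (by gcongr; linarith)
    _ = ε * ‖u' - u‖ := by field_simp

/-- The chain rule for `F(t, ·)` along a curve. -/
theorem HasPartials.hasDerivAt_curve (h : HasPartials K F G) {t : ℝ} (ht : t ∈ K)
    {c : ℝ → Fin m → ℝ} {c' : Fin m → ℝ} {s : ℝ} (hc : ∀ i, HasDerivAt (fun s => c s i) (c' i) s) :
    HasDerivAt (fun s => F t (c s)) (∑ i, G i t (c s) * c' i) s := by
  have := (h.hasFDerivAt ht (c s)).comp_hasDerivAt s (hasDerivAt_pi.2 hc)
  simpa [Function.comp_def] using this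

theorem HasPartials.hasDerivAt_line (h : HasPartials K F G) {t : ℝ} (ht : t ∈ K)
    (u w : Fin m → ℝ) (e : ℝ) :
    HasDerivAt (fun e => F t (u + e • w)) (∑ i, G i t (u + e • w) * w i) e :=
  h.hasDerivAt_curve ht fun i => by
    simpa using ((hasDerivAt_id e).mul_const (w i)).const_add (u i)

/-- Differentiation of the `Δ`-integral along a line of variations. -/
theorem HasPartials.hasDerivAt_integral {V : Set ℝ} (hV : IsCompact V)
    (h : HasPartials (kappa V) F G) {u w : ℝ → Fin m → ℝ} (hu : ContinuousOn u (kappa V))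
    (hw : ContinuousOn w (kappa V)) {c d : ℝ} (hc : c ∈ V) (hd : d ∈ V) (hcd : c ≤ d) :
    HasDerivAt (fun e : ℝ => ∫ x in c..d,
        F (floorPt V x) (u (floorPt V x) + e • w (floorPt V x)))
      (∫ x in c..d, ∑ i, G i (floorPt V x) (u (floorPt V x)) * w (floorPt V x) i) 0 := by
  set K := kappa V
  have hF : ∀ e : ℝ, ContinuousOn (fun t => F t (u t + e • w t)) K := fun e =>
    h.cont.comp (continuousOn_id.prodMk (hu.add (hw.const_smul e))) fun t ht => ⟨ht, mem_univ _⟩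
  have hG : ContinuousOn (fun q : ℝ × ℝ => ∑ i, G i q.2 (u q.2 + q.1 • w q.2) * w q.2 i)
      (Icc (-1) 1 ×ˢ K) := by
    have hs : MapsTo Prod.snd (Icc (-1 : ℝ) 1 ×ˢ K) K := fun q hq => hq.2
    have hw' := hw.comp (continuousOn_snd (s := Icc (-1 : ℝ) 1 ×ˢ K)) hs
    have hu' := hu.comp (continuousOn_snd (s := Icc (-1 : ℝ) 1 ×ˢ K)) hs
    refine continuousOn_finsetSum _ fun i _ => ContinuousOn.mul ?_ ?_
    · exact (h.cont_deriv i).comp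
        (continuousOn_snd.prodMk (hu'.add (continuousOn_fst.smul hw'))) fun q hq =>
          ⟨hq.2, mem_univ _⟩
    · exact (continuous_apply i).comp_continuousOn hw'
  obtain ⟨C, hC⟩ := (isCompact_Icc.prod (isCompact_kappa hV)).exists_bound_of_continuousOn hG
  have hGe : ContinuousOn (fun t => ∑ i, G i t (u t + (0 : ℝ) • w t) * w t i) K :=
    hG.comp (f := fun t => ((0 : ℝ), t)) (by fun_prop) fun t ht => ⟨by simp, ht⟩
  have hmem : ∀ᵐ x, x ∈ uIoc c d → floorPt V x ∈ K := by
    filter_upwards [Measure.ae_ne volume d] with x hx hxI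
    rw [uIoc_of_le hcd] at hxI
    exact floorPt_mem_kappa hV hc hd hxI.1.le (hxI.2.lt_of_ne hx)
  have key := (intervalIntegral.hasDerivAt_integral_of_dominated_loc_of_deriv_le (μ := volume)
    (a := c) (b := d) (F := fun e x => F (floorPt V x) (u (floorPt V x) + e • w (floorPt V x)))
    (F' := fun e x => ∑ i, G i (floorPt V x) (u (floorPt V x) + e • w (floorPt V x)) *
      w (floorPt V x) i) (x₀ := (0 : ℝ)) (s := Icc (-1) 1) (bound := fun _ => C)
    (Icc_mem_nhds (by norm_num) (by norm_num))
    (Eventually.of_forall fun e =>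
      (intervalIntegrable_floorPt hV (hF e) hc hd hcd).def'.aestronglyMeasurable)
    (intervalIntegrable_floorPt hV (hF 0) hc hd hcd)
    (intervalIntegrable_floorPt hV hGe hc hd hcd).def'.aestronglyMeasurable
    (by
      filter_upwards [hmem] with x hx hxI e he
      exact hC (e, floorPt V x) ⟨he, hx hxI⟩)
    intervalIntegrable_const
    (by
      filter_upwards [hmem] with x hx hxI e _
      exact h.hasDerivAt_line (hx hxI) _ _ e)).2
  simpa only [zero_smul, add_zero] using key

end

/-! ### The first variation -/

/-- The entries `(f ∘ σ^{r-i})^{Δ^i}` of the jet of `f` exist and are continuous. -/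
def JetRegular (T : Set ℝ) (r : ℕ) (f : ℝ → ℝ) : Prop :=
  ∀ i ≤ r, DeltaDifferentiable T i (f ∘ (sigma T)^[r - i]) ∧
    ContinuousOn (deltaIter T (f ∘ (sigma T)^[r - i]) i) (kappaIter T r)

section

variable {T : Set ℝ} {a b : ℝ} {r : ℕ} {y η : ℝ → ℝ}

theorem JetRegular.continuousOn_jet (h : JetRegular T r y) :
    ContinuousOn (jet T r y) (kappaIter T r) :=
  continuousOn_pi.2 fun i => (h i (Nat.lt_succ_iff.1 i.2)).2

theorem jet_add_const_mul (hT : IsCompact T) (hn : ∀ k < r, (kappaIter T k).Nontrivial)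
    (hy : JetRegular T r y) (hη : JetRegular T r η) (e : ℝ) {t : ℝ} (ht : t ∈ kappaIter T r) :
    jet T r (fun s => y s + e * η s) t = jet T r y t + e • jet T r η t := by
  funext i
  have hi := Nat.lt_succ_iff.1 i.2
  exact (deltaIter_add_const_mul hT (fun k hk => hn k (by omega)) (hy i hi).1 (hη i hi).1 e).2 t
    (kappaIter_antitone T hi ht)

theorem weakNorm_const_mul (hT : IsCompact T) (hn : ∀ k < r, (kappaIter T k).Nontrivial)
    (hη : JetRegular T r η) (e : ℝ) :
    weakNorm T r (fun s => e * η s) = |e| * weakNorm T r η := by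
  rw [weakNorm, weakNorm, Finset.mul_sum]
  refine Finset.sum_congr rfl fun j hj => ?_
  have hj' : j ≤ r := Nat.lt_succ_iff.1 (Finset.mem_range.1 hj)
  have hd := (hη (r - j) (by omega)).1
  rw [Nat.sub_sub_self hj'] at hd
  rw [← smul_eq_mul, ← Real.sSup_smul_of_nonneg (abs_nonneg e), ← image_smul, image_image]
  congr 1
  refine image_congr fun t ht => ?_
  have := deltaIter_const_mul hT (fun k hk => hn k (by omega)) hd e
    (kappaIter_antitone T (by omega : r - j ≤ r) ht)
  rw [smul_eq_mul, ← abs_mul, ← this]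
  rfl

theorem Admissible.add_const_mul (hT : IsCompact T) (ha : IsLeast T a) (hb : IsGreatest T b)
    (hn : ∀ k < 2 * r, (kappaIter T k).Nontrivial) {α β : Fin r → ℝ}
    (hy : Admissible T a b r α β y) (hη : DeltaC T (2 * r) η)
    (h0 : ∀ k : Fin r, deltaIter T η k a = 0 ∧ deltaIter T η k ((rho T)^[r - 1] b) = 0) (e : ℝ) :
    Admissible T a b r α β (fun s => y s + e * η s) := by
  have h1 := deltaIter_add_const_mul hT hn hy.1.1 hη.1 e
  refine ⟨⟨h1.1, ?_⟩, fun k => ?_⟩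
  · exact (hy.1.2.add (continuousOn_const.mul hη.2)).congr h1.2
  · have hk : (k : ℕ) ≤ r - 1 := by have := k.2; omega
    have h2 := deltaIter_add_const_mul (n := (k : ℕ)) hT (fun j hj => hn j (by omega))
      (fun j hj => hy.1.1 j (by omega)) (fun j hj => hη.1 j (by omega)) e
    have hm : (rho T)^[r - 1] b ∈ kappaIter T k :=
      kappaIter_antitone T hk (isGreatest_kappaIter hT hb (r - 1)).1
    have ha' : a ∈ kappaIter T k := by
      rw [kappaIter_eq hT hb]
      exact ⟨ha.1, ha.2 (iterate_rho_mem hT hb.1 k)⟩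
    rw [h2.2 a ha', h2.2 _ hm, (h0 k).1, (h0 k).2, mul_zero, add_zero, add_zero]
    exact hy.2 k

/-- The first variation of the functional vanishes at a weak local minimum. -/
theorem IsWeakLocalMin.first_variation (hT : IsCompact T) (ha : IsLeast T a)
    (hb : IsGreatest T b) (hr : 1 ≤ r) (hn : ∀ k < 2 * r, (kappaIter T k).Nontrivial)
    {L : ℝ → (Fin (r + 1) → ℝ) → ℝ} {G : Fin (r + 1) → ℝ → (Fin (r + 1) → ℝ) → ℝ}
    (hL : HasPartials (kappaIter T r) L G) {α β : Fin r → ℝ} (hy : IsWeakLocalMin T a b r L α β y)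
    (hyr : JetRegular T r y) (hη : DeltaC T (2 * r) η) (hηr : JetRegular T r η)
    (h0 : ∀ k : Fin r, deltaIter T η k a = 0 ∧ deltaIter T η k ((rho T)^[r - 1] b) = 0) :
    ∫ x in a..(rho T)^[r - 1] b, ∑ i, G i (floorPt (kappaIter T (r - 1)) x)
      (jet T r y (floorPt (kappaIter T (r - 1)) x)) *
        jet T r η (floorPt (kappaIter T (r - 1)) x) i = 0 := by
  set V := kappaIter T (r - 1) with hVdef
  have hV : IsCompact V := isCompact_kappaIter hT _
  have hκ : kappaIter T r = kappa V := by
    rw [hVdef, ← kappaIter_succ, Nat.sub_add_cancel hr]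
  have hdV : (rho T)^[r - 1] b ∈ V := (isGreatest_kappaIter hT hb (r - 1)).1
  have had : a ≤ (rho T)^[r - 1] b := ha.2 (iterate_rho_mem hT hb.1 _)
  have haV : a ∈ V := by
    rw [hVdef, kappaIter_eq hT hb]
    exact ⟨ha.1, had⟩
  have hnr : ∀ k < r, (kappaIter T k).Nontrivial := fun k hk => hn k (by omega)
  have hju := hyr.continuousOn_jet
  have hjw := hηr.continuousOn_jet
  have hfun : ∀ e : ℝ, functional T a b r L (fun s => y s + e * η s) =
      ∫ x in a..(rho T)^[r - 1] b,
        L (floorPt V x) (jet T r y (floorPt V x) + e • jet T r η (floorPt V x)) := by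
    intro e
    have hc : ContinuousOn (fun t => L t (jet T r y t + e • jet T r η t)) (kappa V) := by
      rw [← hκ]
      exact hL.cont.comp (continuousOn_id.prodMk (hju.add (hjw.const_smul e)))
        fun t ht => ⟨ht, mem_univ _⟩
    have hc' : ContinuousOn (fun t => L t (jet T r (fun s => y s + e * η s) t)) (kappa V) :=
      hc.congr fun t ht => by
        rw [← hκ] at ht
        simp only [jet_add_const_mul hT hnr hyr hηr e ht]
    rw [functional, ← hVdef, integral_eq_integral_floorPt hV hc' haV hdV had]
    refine intervalIntegral.integral_congr_ae ?_
    filter_upwards [Measure.ae_ne volume ((rho T)^[r - 1] b)] with x hx hxI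
    rw [uIoc_of_le had] at hxI
    have hm := floorPt_mem_kappa hV haV hdV hxI.1.le (hxI.2.lt_of_ne hx)
    rw [← hκ] at hm
    rw [jet_add_const_mul hT hnr hyr hηr e hm]
  rw [hκ] at hL hju hjw
  have hder := hL.hasDerivAt_integral hV hju hjw haV hdV had
  obtain ⟨hadm, δ, hδ, hmin⟩ := hy
  refine IsLocalMin.hasDerivAt_eq_zero ?_ hder
  have hsmall : ∀ᶠ e : ℝ in 𝓝 0, |e| * weakNorm T r η < δ := by
    have : Tendsto (fun e : ℝ => |e| * weakNorm T r η) (𝓝 0) (𝓝 (|0| * weakNorm T r η)) :=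
      (continuous_abs.mul continuous_const).tendsto 0
    rw [abs_zero, zero_mul] at this
    exact this.eventually (gt_mem_nhds hδ)
  filter_upwards [hsmall] with e he
  rw [← hfun, ← hfun]
  have h1 := hmin _ (hadm.add_const_mul hT ha hb hn hη h0 e) (by
    have : (fun t => y t + e * η t - y t) = fun t => e * η t := by funext t; ring
    rwa [this, weakNorm_const_mul hT hnr hηr])
  simpa using h1

end

end TimeScale

namespace TimeScale

open Set Filter Topology Asymptotics Polynomial

/-! ### Time scales of isolated points around a fixed point of `σ` -/

/-- A compact time scale whose points other than `p` are isolated, where either `p` does not belong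
to `T`, or `p` is an accumulation point of `T` and `σ` multiplies the distance to `p` by `q ≠ 1` near
`p`. No other point is mapped to `p` by `σ`, so that orbits of isolated points stay isolated. A finite
`T` is covered by any `p` outside `T`, with an arbitrary `q > 0`. The condition is inherited by
`T^κ`. -/
structure IsGeometric (T : Set ℝ) (p q : ℝ) : Prop where
  isCompact : IsCompact T
  isolated : ∀ t ∈ T, t ≠ p → ∃ δ > 0, ∀ s ∈ T, |s - t| < δ → s = t
  sigma_ne : ∀ t ∈ T, t ≠ p → sigma T t ≠ p
  accPt : p ∈ T → (𝓝[T \ {p}] p).NeBot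
  q_pos : 0 < q
  q_ne : p ∈ T → q ≠ 1
  sigma_near : ∀ᶠ t in 𝓝[T] p, sigma T t = p + q * (t - p)

/-- The difference quotient of `f` over the gap to the right of `t`. -/
noncomputable def deltaQuot (T : Set ℝ) (f : ℝ → ℝ) (t : ℝ) : ℝ :=
  (f (sigma T t) - f t) / (sigma T t - t)

variable {T : Set ℝ} {p q : ℝ} {f g : ℝ → ℝ} {t : ℝ}

theorem sigma_kappa_eq_or (hT : IsCompact T) (ht : t ∈ kappa T) :
    sigma (kappa T) t = sigma T t ∨ IsGreatest (kappa T) t := by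
  by_cases h : IsGreatest (kappa T) t
  · exact Or.inr h
  · have hb := hT.isGreatest_sSup ⟨t, ht.1⟩
    obtain ⟨s, hs, hts⟩ : ∃ s ∈ kappa T, t < s := by
      by_contra! hc
      exact h ⟨ht, hc⟩
    rw [kappa_eq hT hb] at hs ⊢
    exact Or.inl (sigma_inter_Iic (rho_mem hT hb.1) (hts.trans_le hs.2))

/-- A maximum at which `T` accumulates is left-dense. -/
theorem rho_eq_self_of_neBot (hT : IsCompact T) (hp : IsGreatest T p)
    (hne : (𝓝[T \ {p}] p).NeBot) : rho T p = p := by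
  refine le_antisymm (rho_le hT hp.1) ?_
  by_contra! hlt
  have h1 : T \ {p} ∩ Ioi (rho T p) ∈ 𝓝[T \ {p}] p :=
    inter_mem self_mem_nhdsWithin (mem_nhdsWithin_of_mem_nhds (Ioi_mem_nhds hlt))
  obtain ⟨x, hx, hx'⟩ := Filter.nonempty_of_mem h1
  exact absurd (le_rho hx.1 ((hp.2 hx.1).lt_of_ne hx.2)) (not_le.2 hx')

namespace IsGeometric

theorem sigma_self (h : IsGeometric T p q) (hp : p ∈ T) : sigma T p = p := by
  simpa using h.sigma_near.self_of_nhdsWithin hp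

theorem nontrivial (h : IsGeometric T p q) (hp : p ∈ T) : T.Nontrivial := by
  have := h.accPt hp
  obtain ⟨x, hx⟩ := Filter.nonempty_of_mem (self_mem_nhdsWithin : T \ {p} ∈ 𝓝[T \ {p}] p)
  exact ⟨x, hx.1, p, hp, hx.2⟩

theorem rho_self (h : IsGeometric T p q) (hp : IsGreatest T p) : rho T p = p :=
  rho_eq_self_of_neBot h.isCompact hp (h.accPt hp.1)

theorem mem_kappa (h : IsGeometric T p q) (hp : p ∈ T) : p ∈ kappa T := by
  by_cases hg : IsGreatest T p
  · exact ⟨hp, Or.inr (h.rho_self hg)⟩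
  · exact ⟨hp, Or.inl hg⟩

/-- Near `p`, passing to `T^κ` removes no point. -/
theorem kappa_mem_nhdsWithin (h : IsGeometric T p q) (hp : p ∈ T) : kappa T ∈ 𝓝[T] p := by
  by_cases hg : IsGreatest T p
  · rw [kappa_eq h.isCompact hg, h.rho_self hg]
    exact inter_mem self_mem_nhdsWithin (mem_of_superset self_mem_nhdsWithin fun x hx => hg.2 hx)
  · obtain ⟨s, hs, hps⟩ : ∃ s ∈ T, p < s := by
      by_contra! hc
      exact hg ⟨hp, hc⟩
    filter_upwards [self_mem_nhdsWithin, mem_nhdsWithin_of_mem_nhds (Iio_mem_nhds hps)]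
      with x hx hx'
    exact mem_kappa_of_lt hx hs hx'

theorem nhdsWithin_kappa (h : IsGeometric T p q) (hp : p ∈ T) : 𝓝[kappa T] p = 𝓝[T] p :=
  le_antisymm (nhdsWithin_mono _ kappa_subset)
    (le_inf inf_le_left (le_principal_iff.2 (h.kappa_mem_nhdsWithin hp)))

protected theorem kappa (h : IsGeometric T p q) : IsGeometric (kappa T) p q where
  isCompact := isCompact_kappa h.isCompact
  isolated t ht htp := by
    obtain ⟨δ, hδ, h1⟩ := h.isolated t ht.1 htp
    exact ⟨δ, hδ, fun s hs => h1 s hs.1⟩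
  sigma_ne t ht htp := by
    rcases sigma_kappa_eq_or h.isCompact ht with h1 | h1
    · rw [h1]; exact h.sigma_ne t ht.1 htp
    · rwa [sigma_eq_of_isGreatest h1]
  accPt hp := by
    have hp' := kappa_subset hp
    have h1 := h.accPt hp'
    have h2 : ∀ S : Set ℝ, 𝓝[S \ {p}] p = 𝓝[S] p ⊓ 𝓟 {p}ᶜ := fun S => by
      rw [sdiff_eq, nhdsWithin, nhdsWithin, ← inf_principal, inf_assoc]
    rwa [h2, h.nhdsWithin_kappa hp', ← h2]
  q_pos := h.q_pos
  q_ne hp := h.q_ne (kappa_subset hp)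
  sigma_near := by
    by_cases hp : p ∈ T
    · rw [h.nhdsWithin_kappa hp]
      have hb := h.isCompact.isGreatest_sSup ⟨p, hp⟩
      have hne : ∀ᶠ t in 𝓝[T] p, t = p ∨ t ≠ rho T (sSup T) := by
        by_cases hρ : rho T (sSup T) = p
        · exact Eventually.of_forall fun t => by rw [hρ]; exact em _
        · filter_upwards [mem_nhdsWithin_of_mem_nhds (isOpen_ne.mem_nhds (Ne.symm hρ))] with t ht
          exact Or.inr ht
      filter_upwards [h.sigma_near, hne, h.kappa_mem_nhdsWithin hp] with t h1 h2 h3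
      rcases sigma_kappa_eq_or h.isCompact h3 with h4 | h4
      · rw [h4, h1]
      · rcases h2 with rfl | h2
        · rw [sigma_eq_of_isGreatest h4]; simp
        · rw [kappa_eq h.isCompact hb] at h3
          have h6 : IsGreatest (kappa T) (rho T (sSup T)) := by
            rw [kappa_eq h.isCompact hb]
            exact ⟨⟨rho_mem h.isCompact hb.1, self_mem_Iic⟩, fun x hx => hx.2⟩
          exact absurd (h4.unique h6) h2
    · have : p ∉ closure (kappa T) := by
        rw [(isCompact_kappa h.isCompact).isClosed.closure_eq]
        exact fun h' => hp h'.1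
      rw [notMem_closure_iff_nhdsWithin_eq_bot.1 this]
      exact eventually_bot

protected theorem kappaIter (h : IsGeometric T p q) (n : ℕ) : IsGeometric (kappaIter T n) p q := by
  induction n with
  | zero => exact h
  | succ n ih => rw [kappaIter_succ]; exact ih.kappa

theorem mem_kappaIter (h : IsGeometric T p q) (hp : p ∈ T) (n : ℕ) : p ∈ kappaIter T n := by
  induction n with
  | zero => exact hp
  | succ n ih => rw [kappaIter_succ]; exact (h.kappaIter n).mem_kappa ih

theorem hasDeltaDerivAt_of_ne (h : IsGeometric T p q) (ht : t ∈ T) (htp : t ≠ p) (f : ℝ → ℝ) :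
    HasDeltaDerivAt T f (deltaQuot T f t) t := by
  intro ε hε
  obtain ⟨δ, hδ, h1⟩ := h.isolated t ht htp
  refine ⟨δ, hδ, fun s hs hst => ?_⟩
  rw [h1 s hs hst]
  have : f (sigma T t) - f t - deltaQuot T f t * (sigma T t - t) = 0 := by
    rw [deltaQuot]
    rcases eq_or_ne (sigma T t) t with h2 | h2
    · rw [h2]; simp
    · rw [div_mul_cancel₀ _ (sub_ne_zero.2 h2), sub_self]
  rw [this, abs_zero]
  positivity

theorem tendsto_sigma (h : IsGeometric T p q) :
    Tendsto (sigma T) (𝓝[T] p) (𝓝[T] p) := by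
  refine tendsto_nhdsWithin_iff.2 ⟨?_, ?_⟩
  · have h1 : Tendsto (fun t => p + q * (t - p)) (𝓝 p) (𝓝 (p + q * (p - p))) := by
      have : Continuous fun t => p + q * (t - p) := by fun_prop
      exact this.tendsto p
    rw [sub_self, mul_zero, add_zero] at h1
    exact (h1.mono_left inf_le_left).congr' (h.sigma_near.mono fun t ht => ht.symm)
  · filter_upwards [self_mem_nhdsWithin] with t ht
    exact sigma_mem h.isCompact ht

theorem sigma_sub_pow_isBigO (h : IsGeometric T p q) (n : ℕ) :
    (fun t => (sigma T t - p) ^ n) =O[𝓝[T] p] fun t => (t - p) ^ n := by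
  have : (fun t => q ^ n * (t - p) ^ n) =O[𝓝[T] p] fun t => (t - p) ^ n :=
    isBigO_const_mul_self _ _ _
  refine this.congr' ?_ EventuallyEq.rfl
  filter_upwards [h.sigma_near] with t ht
  rw [ht, add_sub_cancel_left, mul_pow]

end IsGeometric

/-! ### Taylor expansions at the accumulation point -/

/-- If `p ∈ T`, then `f` has a Taylor expansion of order `n` at `p` along `T`. -/
def HasExpansion (T : Set ℝ) (p : ℝ) (n : ℕ) (f : ℝ → ℝ) : Prop :=
  p ∈ T → ∃ P : ℝ[X], (fun t => f t - P.eval (t - p)) =o[𝓝[T] p] fun t => (t - p) ^ n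

theorem HasExpansion.mono_order {m n : ℕ} (hmn : m ≤ n) (h : HasExpansion T p n f) :
    HasExpansion T p m f := fun hp => by
  obtain ⟨P, hP⟩ := h hp
  refine ⟨P, hP.trans_isBigO ?_⟩
  have h1 : (fun t : ℝ => (t - p) ^ (n - m)) =O[𝓝[T] p] fun _ => (1 : ℝ) := by
    have : Continuous fun t : ℝ => (t - p) ^ (n - m) := by fun_prop
    exact (this.tendsto p).isBigO_one ℝ |>.mono inf_le_left
  have h2 := h1.mul (isBigO_refl (fun t : ℝ => (t - p) ^ m) (𝓝[T] p))
  simpa [← pow_add, Nat.sub_add_cancel hmn] using h2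

theorem HasExpansion.mono_set {n : ℕ} {S : Set ℝ} (hS : S ⊆ T) (h : HasExpansion T p n f) :
    HasExpansion S p n f := fun hp => by
  obtain ⟨P, hP⟩ := h (hS hp)
  exact ⟨P, hP.mono (nhdsWithin_mono _ hS)⟩

theorem HasExpansion.congr {n : ℕ} (h : HasExpansion T p n f) (hfg : ∀ t ∈ T, f t = g t) :
    HasExpansion T p n g := fun hp => by
  obtain ⟨P, hP⟩ := h hp
  refine ⟨P, hP.congr' ?_ EventuallyEq.rfl⟩
  filter_upwards [self_mem_nhdsWithin] with t ht
  rw [hfg t ht]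

theorem eq_eval_zero_of_isLittleO {n : ℕ} {P : ℝ[X]} (hp : p ∈ T)
    (h : (fun t => f t - P.eval (t - p)) =o[𝓝[T] p] fun t => (t - p) ^ n) : f p = P.eval 0 := by
  have h1 : (fun t : ℝ => (t - p) ^ n) =O[𝓝[T] p] fun _ => (1 : ℝ) := by
    have : Continuous fun t : ℝ => (t - p) ^ n := by fun_prop
    exact (this.tendsto p).isBigO_one ℝ |>.mono inf_le_left
  have h2 := (isLittleO_one_iff ℝ).1 (h.trans_isBigO h1)
  have h3 := tendsto_nhds_unique (h2.mono_left (pure_le_nhdsWithin hp)) (tendsto_pure_nhds _ _)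
  rw [sub_self] at h3
  linarith

theorem hasExpansion_zero_of_continuousOn (h : ContinuousOn f T) : HasExpansion T p 0 f :=
  fun hp => ⟨C (f p), by
    have h1 : Tendsto (fun t => f t - f p) (𝓝[T] p) (𝓝 (f p - f p)) :=
      (h p hp).tendsto.sub_const _
    rw [sub_self] at h1
    simpa using h1⟩

theorem HasExpansion.continuousOn {n : ℕ} (hT : IsGeometric T p q) (h : HasExpansion T p n f) :
    ContinuousOn f T := by
  intro t ht
  rcases eq_or_ne t p with rfl | htp
  · obtain ⟨P, hP⟩ := h.mono_order n.zero_le ht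
    have h1 := eq_eval_zero_of_isLittleO ht hP
    have h2 : Tendsto (fun s => f s - P.eval (s - t)) (𝓝[T] t) (𝓝 0) := by simpa using hP
    have h3 : Tendsto (fun s => P.eval (s - t)) (𝓝[T] t) (𝓝 (P.eval 0)) := by
      have h4 : Continuous fun s => P.eval (s - t) := P.continuous.comp (by fun_prop)
      have := h4.tendsto t
      rw [sub_self] at this
      exact this.mono_left inf_le_left
    have h4 := h2.add h3
    rw [zero_add, ← h1] at h4
    exact h4.congr fun s => by ring
  · exact (hT.hasDeltaDerivAt_of_ne ht htp f).continuousWithinAt ht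

theorem HasExpansion.comp_sigma {n : ℕ} (hT : IsGeometric T p q) (h : HasExpansion T p n f) :
    HasExpansion T p n (f ∘ sigma T) := fun hp => by
  obtain ⟨P, hP⟩ := h hp
  refine ⟨P.comp (C q * X), ?_⟩
  have h1 := hP.comp_tendsto (hT.tendsto_sigma)
  refine (h1.trans_isBigO (hT.sigma_sub_pow_isBigO n)).congr' ?_ EventuallyEq.rfl
  filter_upwards [hT.sigma_near] with t ht
  simp [ht]

theorem HasExpansion.comp_iterate_sigma {n : ℕ} (hT : IsGeometric T p q)
    (h : HasExpansion T p n f) (k : ℕ) : HasExpansion T p n (f ∘ (sigma T)^[k]) := by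
  induction k with
  | zero => exact h
  | succ k ih => rw [Function.iterate_succ, ← Function.comp_assoc]; exact ih.comp_sigma hT

/-- Every polynomial has a polynomial `q`-derivative. -/
theorem exists_polynomial_qDeriv (hq : q ≠ 1) (P : ℝ[X]) : ∃ Q : ℝ[X],
    (∀ x, P.eval (q * x) - P.eval x = (q - 1) * x * Q.eval x) ∧
      P.derivative.eval 0 = Q.eval 0 := by
  have hq' := sub_ne_zero.2 hq
  induction P using Polynomial.induction_on' with
  | add P P' h h' =>
    obtain ⟨Q, h1, h2⟩ := h
    obtain ⟨Q', h1', h2'⟩ := h'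
    refine ⟨Q + Q', fun x => ?_, by simp [h2, h2']⟩
    simp only [eval_add]
    linear_combination h1 x + h1' x
  | monomial n a =>
    cases n with
    | zero => exact ⟨0, by simp, by simp⟩
    | succ n =>
      refine ⟨monomial n (a * ((q ^ (n + 1) - 1) / (q - 1))), fun x => ?_, ?_⟩
      · simp only [eval_monomial]
        field_simp
        ring
      · rw [derivative_monomial]
        cases n with
        | zero => simp [hq']
        | succ n => simp

/-- Every polynomial has a polynomial `q`-antiderivative. -/
theorem exists_polynomial_qAntideriv (hq0 : 0 < q) (hq : q ≠ 1) (Q : ℝ[X]) : ∃ P : ℝ[X],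
    (∀ x, P.eval (q * x) - P.eval x = (q - 1) * x * Q.eval x) ∧
      P.derivative.eval 0 = Q.eval 0 := by
  have hq' := sub_ne_zero.2 hq
  induction Q using Polynomial.induction_on' with
  | add Q Q' h h' =>
    obtain ⟨P, h1, h2⟩ := h
    obtain ⟨P', h1', h2'⟩ := h'
    refine ⟨P + P', fun x => ?_, by simp [h2, h2']⟩
    simp only [eval_add]
    linear_combination h1 x + h1' x
  | monomial n a =>
    have hn : q ^ (n + 1) - 1 ≠ 0 := sub_ne_zero.2 fun h =>
      hq ((pow_eq_one_iff_of_nonneg hq0.le n.succ_ne_zero).1 h)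
    refine ⟨monomial (n + 1) (a * ((q - 1) / (q ^ (n + 1) - 1))), fun x => ?_, ?_⟩
    · simp only [eval_monomial]
      field_simp
      ring
    · rw [derivative_monomial]
      cases n with
      | zero => simp [hq']
      | succ n => simp

theorem nhdsWithin_eq_sup_pure (hp : p ∈ T) : 𝓝[T] p = pure p ⊔ 𝓝[T \ {p}] p := by
  rw [← nhdsWithin_insert, insert_sdiff_singleton, insert_eq_of_mem hp]

theorem hasDerivWithinAt_eval_sub (p : ℝ) (P : ℝ[X]) :
    HasDerivWithinAt (fun t => P.eval (t - p)) (P.derivative.eval 0) T p := by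
  have h := P.hasDerivAt (p - p)
  have h' := (h.comp_sub_const p p).hasDerivWithinAt (s := T)
  rwa [sub_self] at h'

theorem hasDerivWithinAt_of_isLittleO {n : ℕ} {P : ℝ[X]} (hp : p ∈ T)
    (h : (fun t => f t - P.eval (t - p)) =o[𝓝[T] p] fun t => (t - p) ^ (n + 1)) :
    HasDerivWithinAt f (P.derivative.eval 0) T p := by
  have h0 := eq_eval_zero_of_isLittleO hp h
  have h1 : (fun t => f t - P.eval (t - p)) =o[𝓝[T] p] fun t => t - p := by
    refine h.trans_isBigO ?_
    have h1 : (fun t : ℝ => (t - p) ^ n) =O[𝓝[T] p] fun _ => (1 : ℝ) := by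
      have : Continuous fun t : ℝ => (t - p) ^ n := by fun_prop
      exact (this.tendsto p).isBigO_one ℝ |>.mono inf_le_left
    simpa [pow_succ] using h1.mul (isBigO_refl (fun t : ℝ => t - p) (𝓝[T] p))
  have h2 := hasDerivWithinAt_eval_sub (T := T) p P
  rw [hasDerivWithinAt_iff_isLittleO] at h2 ⊢
  refine (h1.add h2).congr_left fun t => ?_
  simp only [sub_self, h0]
  ring

/-- An expansion of order `n + 1` of a function gives one of order `n` of its `Δ`-derivative: near
`p`, the `Δ`-derivative divides by `(q - 1) (t - p)` only. -/
theorem HasExpansion.deltaDeriv {n : ℕ} (hT : IsGeometric T p q) (h : HasExpansion T p (n + 1) f)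
    (hg : ∀ t ∈ kappa T, HasDeltaDerivAt T f (g t) t) : HasExpansion (kappa T) p n g := by
  intro hpκ
  have hp := kappa_subset hpκ
  obtain ⟨P, hP⟩ := h hp
  have hq := sub_ne_zero.2 (hT.q_ne hp)
  obtain ⟨Q, hQ, hQ0⟩ := exists_polynomial_qDeriv (hT.q_ne hp) P
  refine ⟨Q, ?_⟩
  rw [hT.nhdsWithin_kappa hp, nhdsWithin_eq_sup_pure hp, isLittleO_sup]
  have hgp : g p = Q.eval 0 := by
    rw [← hQ0]
    exact (hg p hpκ).unique (hT.nontrivial hp) hpκ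
      ((hasDeltaDerivAt_iff_hasDerivWithinAt (hT.sigma_self hp)).2
        (hasDerivWithinAt_of_isLittleO hp hP))
  refine ⟨?_, ?_⟩
  · rw [isLittleO_iff]
    intro ε hε
    rw [eventually_pure, sub_self, hgp, sub_self, norm_zero]
    positivity
  · set e : ℝ → ℝ := fun t => f t - P.eval (t - p) with he
    have hle : 𝓝[T \ {p}] p ≤ 𝓝[T] p := nhdsWithin_mono _ sdiff_subset
    have h2 : (fun t => e (sigma T t)) =o[𝓝[T] p] fun t => (t - p) ^ (n + 1) :=
      (hP.comp_tendsto hT.tendsto_sigma).trans_isBigO (hT.sigma_sub_pow_isBigO (n + 1))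
    have h3 := ((h2.sub hP).mono hle).mul_isBigO
      (isBigO_refl (fun t => ((q - 1) * (t - p))⁻¹) (𝓝[T \ {p}] p))
    have h4 : (fun t => (t - p) ^ (n + 1) * ((q - 1) * (t - p))⁻¹) =O[𝓝[T \ {p}] p]
        fun t => (t - p) ^ n := by
      have : (fun t => (q - 1)⁻¹ * (t - p) ^ n) =O[𝓝[T \ {p}] p] fun t => (t - p) ^ n :=
        isBigO_const_mul_self _ _ _
      refine this.congr' ?_ EventuallyEq.rfl
      filter_upwards [self_mem_nhdsWithin] with t ht
      have : t - p ≠ 0 := sub_ne_zero.2 ht.2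
      field_simp
      ring
    refine (h3.trans_isBigO h4).congr' ?_ EventuallyEq.rfl
    filter_upwards [self_mem_nhdsWithin, hle hT.sigma_near, hle (hT.kappa_mem_nhdsWithin hp)]
      with t ht h5 h6
    have htp : t - p ≠ 0 := sub_ne_zero.2 ht.2
    have h7 := (hg t h6).sigma_sub ht.1
    have h8 := hQ (t - p)
    simp only [he]
    rw [h5] at h7 ⊢
    rw [add_sub_cancel_left]
    have h9 : f (p + q * (t - p)) - P.eval (q * (t - p)) - (f t - P.eval (t - p)) =
        (g t - Q.eval (t - p)) * ((q - 1) * (t - p)) := by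
      linear_combination h7 - h8
    rw [h9, mul_inv_cancel_right₀ (mul_ne_zero hq htp)]

/-- The converse of `HasExpansion.deltaDeriv`: subtract a `q`-antiderivative of the expansion of the
`Δ`-derivative and estimate what remains by the mean value inequality. -/
theorem HasExpansion.of_deltaDeriv {n : ℕ} (hT : IsGeometric T p q)
    (h : HasExpansion (kappa T) p n g) (hg : ∀ t ∈ kappa T, HasDeltaDerivAt T f (g t) t) :
    HasExpansion T p (n + 1) f := by
  intro hp
  have hpκ := hT.mem_kappa hp
  obtain ⟨Q, hQ⟩ := h hpκ
  have hgp := eq_eval_zero_of_isLittleO hpκ hQ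
  have hq := sub_ne_zero.2 (hT.q_ne hp)
  obtain ⟨P, hP, hP0⟩ := exists_polynomial_qAntideriv hT.q_pos (hT.q_ne hp) Q
  refine ⟨P + C (f p - P.eval 0), ?_⟩
  have hder : ∀ᶠ t in 𝓝[kappa T] p,
      HasDeltaDerivAt T (fun s => f s + (-1) * P.eval (s - p)) (g t + (-1) * Q.eval (t - p)) t := by
    filter_upwards [self_mem_nhdsWithin, hT.nhdsWithin_kappa hp ▸ hT.sigma_near] with t ht hσ
    refine (hg t ht).add_const_mul ?_ (-1)
    rcases eq_or_ne t p with rfl | htp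
    · rw [sub_self, ← hP0]
      exact (hasDeltaDerivAt_iff_hasDerivWithinAt (hT.sigma_self hp)).2
        (hasDerivWithinAt_eval_sub t P)
    · have h1 := hT.hasDeltaDerivAt_of_ne ht.1 htp (fun s => P.eval (s - p))
      have h2 : deltaQuot T (fun s => P.eval (s - p)) t = Q.eval (t - p) := by
        have h3 := hP (t - p)
        have h4 : t - p ≠ 0 := sub_ne_zero.2 htp
        rw [deltaQuot, hσ, add_sub_cancel_left, h3,
          show p + q * (t - p) - t = (q - 1) * (t - p) by ring]
        field_simp
      rwa [h2] at h1
  rw [isLittleO_iff] at hQ ⊢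
  intro ε hε
  have hev := (hQ hε).and hder
  rw [eventually_iff, Metric.mem_nhdsWithin_iff] at hev
  obtain ⟨δ, hδ, hev⟩ := hev
  have hball : Metric.ball p δ ∈ 𝓝[T] p := mem_nhdsWithin_of_mem_nhds (Metric.ball_mem_nhds p hδ)
  filter_upwards [self_mem_nhdsWithin, hball] with x hx hxb
  rw [Metric.mem_ball, Real.dist_eq] at hxb
  have hM : ∀ s ∈ kappa T, |s - p| ≤ |x - p| →
      HasDeltaDerivAt T (fun s => f s + (-1) * P.eval (s - p)) (g s + (-1) * Q.eval (s - p)) s ∧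
        |g s + (-1) * Q.eval (s - p)| ≤ ε * |x - p| ^ n := by
    intro s hs hsx
    obtain ⟨h1, h2⟩ := hev ⟨by rw [Metric.mem_ball, Real.dist_eq]; linarith, hs⟩
    refine ⟨h2, ?_⟩
    rw [Real.norm_eq_abs, Real.norm_eq_abs, abs_pow] at h1
    rw [neg_one_mul, ← sub_eq_add_neg]
    exact h1.trans (by gcongr)
  have key : |(f x + (-1) * P.eval (x - p)) - (f p + (-1) * P.eval (p - p))| ≤
      ε * |x - p| ^ n * |x - p| := by
    rcases le_total p x with hpx | hpx
    · have := abs_sub_le_of_hasDeltaDerivAt hT.isCompact hp hx hpx fun s hs h1 h2 => hM s hs (by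
        rw [abs_of_nonneg (by linarith), abs_of_nonneg (by linarith)]; linarith)
      rwa [abs_of_nonneg (sub_nonneg.2 hpx)] at this ⊢
    · have := abs_sub_le_of_hasDeltaDerivAt hT.isCompact hx hp hpx fun s hs h1 h2 => hM s hs (by
        rw [abs_of_nonpos (by linarith), abs_of_nonpos (by linarith)]; linarith)
      rw [abs_sub_comm]
      rwa [abs_sub_comm x p, abs_of_nonneg (sub_nonneg.2 hpx)] at this ⊢
  rw [sub_self] at key
  rw [Real.norm_eq_abs, Real.norm_eq_abs, abs_pow, pow_succ, ← mul_assoc]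
  convert key using 2
  simp only [eval_add, eval_C]
  ring

theorem DeltaC.hasExpansion {n : ℕ} (hT : IsGeometric T p q) (h : DeltaC T n f) :
    HasExpansion T p n f := by
  suffices H : ∀ j k, k + j = n → HasExpansion (kappaIter T k) p j (deltaIter T f k) from
    H n 0 (zero_add n)
  intro j
  induction j with
  | zero =>
    rintro k rfl
    exact hasExpansion_zero_of_continuousOn h.2
  | succ j ih =>
    intro k hk
    have h1 := ih (k + 1) (by omega)
    rw [kappaIter_succ] at h1
    refine HasExpansion.of_deltaDeriv (hT.kappaIter k) h1 fun t ht => ?_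
    rw [← kappaIter_succ] at ht
    exact hasDeltaDerivAt_deltaDeriv (h.1 k (by omega) t ht)

theorem HasExpansion.exists_hasDeltaDerivAt {n : ℕ} (hT : IsGeometric T p q)
    (h : HasExpansion T p (n + 1) f) (ht : t ∈ T) : ∃ d, HasDeltaDerivAt T f d t := by
  rcases eq_or_ne t p with rfl | htp
  · obtain ⟨P, hP⟩ := h ht
    exact ⟨_, (hasDeltaDerivAt_iff_hasDerivWithinAt (hT.sigma_self ht)).2
      (hasDerivWithinAt_of_isLittleO ht hP)⟩
  · exact ⟨_, hT.hasDeltaDerivAt_of_ne ht htp f⟩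

theorem HasExpansion.deltaIter {n : ℕ} (hT : IsGeometric T p q) (h : HasExpansion T p n f) {k : ℕ}
    (hk : k ≤ n) : DeltaDifferentiable T k f ∧
      HasExpansion (kappaIter T k) p (n - k) (deltaIter T f k) := by
  induction k with
  | zero => exact ⟨fun k hk => absurd hk k.not_lt_zero, h⟩
  | succ k ih =>
    obtain ⟨h1, h2⟩ := ih (by omega)
    rw [show n - k = n - (k + 1) + 1 by omega] at h2
    have hex : ∀ t ∈ kappaIter T (k + 1),
        ∃ d, HasDeltaDerivAt (kappaIter T k) (TimeScale.deltaIter T f k) d t := fun t ht =>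
      h2.exists_hasDeltaDerivAt (hT.kappaIter k) (kappaIter_antitone T k.le_succ ht)
    refine ⟨fun j hj t ht => ?_, ?_⟩
    · rcases Nat.lt_succ_iff_lt_or_eq.1 hj with hj | rfl
      · exact h1 j hj t ht
      · exact hex t ht
    · rw [kappaIter_succ]
      refine h2.deltaDeriv (hT.kappaIter k) fun t ht => ?_
      rw [← kappaIter_succ] at ht
      exact hasDeltaDerivAt_deltaDeriv (hex t ht)

theorem HasExpansion.deltaC {n : ℕ} (hT : IsGeometric T p q) (h : HasExpansion T p n f) :
    DeltaC T n f := by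
  obtain ⟨h1, h2⟩ := h.deltaIter hT le_rfl
  exact ⟨h1, h2.continuousOn (hT.kappaIter n)⟩

theorem HasExpansion.jetRegular {r : ℕ} (hT : IsGeometric T p q) (h : HasExpansion T p r f) :
    JetRegular T r f := fun i hi => by
  obtain ⟨h1, h2⟩ := (h.comp_iterate_sigma hT (r - i)).deltaIter hT hi
  exact ⟨h1, (h2.continuousOn (hT.kappaIter i)).mono (kappaIter_antitone T hi)⟩

end TimeScale

namespace TimeScale

open Set Filter Topology Asymptotics Polynomial

variable {T : Set ℝ} {p q : ℝ}

/-! ### Expansions of composite functions -/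

/-- The restriction of a polynomial in two variables to the diagonal is a polynomial. -/
theorem exists_evalEval_diagonal (Q : ℝ[X][X]) : ∃ R : ℝ[X], ∀ x, R.eval x = evalEval x x Q := by
  induction Q using Polynomial.induction_on' with
  | add Q Q' h h' =>
    obtain ⟨R, hR⟩ := h
    obtain ⟨R', hR'⟩ := h'
    exact ⟨R + R', fun x => by rw [eval_add, hR, hR', evalEval_add]⟩
  | monomial n A =>
    exact ⟨A * X ^ n, fun x => by simp [evalEval]⟩

/-- A polynomial in two variables has a polynomial antiderivative in the second variable. -/
theorem exists_evalEval_antideriv (Q : ℝ[X][X]) : ∃ R : ℝ[X][X], ∀ x, evalEval x 0 R = 0 ∧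
    ∀ s, HasDerivAt (fun s => evalEval x s R) (evalEval x s Q) s := by
  induction Q using Polynomial.induction_on' with
  | add Q Q' h h' =>
    obtain ⟨R, hR⟩ := h
    obtain ⟨R', hR'⟩ := h'
    refine ⟨R + R', fun x => ⟨by rw [evalEval_add, (hR x).1, (hR' x).1, add_zero], fun s => ?_⟩⟩
    simp only [evalEval_add]
    exact ((hR x).2 s).add ((hR' x).2 s)
  | monomial n A =>
    refine ⟨monomial (n + 1) (A * C ((n + 1 : ℝ)⁻¹)), fun x => ⟨by simp [evalEval], fun s => ?_⟩⟩
    have h1 : ∀ s, evalEval x s (monomial (n + 1) (A * C ((n + 1 : ℝ)⁻¹))) =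
        A.eval x * (n + 1 : ℝ)⁻¹ * s ^ (n + 1) := fun s => by simp [evalEval]
    have h2 : evalEval x s (monomial n A) = A.eval x * (n + 1 : ℝ)⁻¹ * ((n + 1 : ℕ) * s ^ n) := by
      have : (n + 1 : ℝ) ≠ 0 := by positivity
      simp only [evalEval, eval_monomial, eval_mul, eval_pow, eval_C]
      push_cast
      field_simp
    simp only [h1]
    rw [h2]
    simpa using (hasDerivAt_pow (n + 1) s).const_mul (A.eval x * (n + 1 : ℝ)⁻¹)

/-- The Taylor expansion at `(p, 0)` of `F(t, P(s))` along a polynomial curve `P`, by induction on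
the order: integrate the expansion of the derivative in `s`, and on the line `s = 0` the expansion of
the `Δ`-derivative in `t`. -/
theorem MixedC.exists_expansion_along_curve {m : ℕ} (n : ℕ) :
    ∀ {T : Set ℝ} {F : ℝ → (Fin m → ℝ) → ℝ}, IsGeometric T p q → p ∈ T → MixedC n T F →
      ∀ P : Fin m → ℝ[X], ∃ Q : ℝ[X][X],
        (fun z : ℝ × ℝ => F z.1 (fun i => (P i).eval z.2) - evalEval (z.1 - p) z.2 Q)
          =o[𝓝[T] p ×ˢ 𝓝 0] fun z => (|z.1 - p| + |z.2|) ^ n := by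
  induction n with
  | zero =>
    intro T F hT hp hF P
    refine ⟨C (C (F p fun i => (P i).eval 0)), ?_⟩
    have h1 : Tendsto (fun z : ℝ × ℝ => F z.1 fun i => (P i).eval z.2) (𝓝[T] p ×ˢ 𝓝 0)
        (𝓝 (F p fun i => (P i).eval 0)) := by
      have h2 := (hF.continuousOn (p, fun i => (P i).eval 0) ⟨hp, mem_univ _⟩).tendsto
      have h3 : Tendsto (fun z : ℝ × ℝ => (z.1, fun i => (P i).eval z.2)) (𝓝[T] p ×ˢ 𝓝 0)
          (𝓝[T ×ˢ univ] (p, fun i => (P i).eval 0)) := by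
        refine tendsto_nhdsWithin_iff.2 ⟨?_, ?_⟩
        · rw [nhds_prod_eq]
          refine Tendsto.prodMk (tendsto_fst.mono_right inf_le_left) ?_
          refine tendsto_pi_nhds.2 fun i => ?_
          exact ((P i).continuous.tendsto 0).comp tendsto_snd
        · filter_upwards [tendsto_fst (self_mem_nhdsWithin (a := p) (s := T))] with z hz
          exact ⟨hz, mem_univ _⟩
      exact h2.comp h3
    have h3 := h1.sub_const (F p fun i => (P i).eval 0)
    rw [sub_self] at h3
    simpa [evalEval] using h3
  | succ n ih =>
    intro T F hT hp hF P
    obtain ⟨G, hG, hGn⟩ := hF.exists_hasPartials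
    obtain ⟨D, hD, hDn⟩ := hF.2.2
    choose Qj hQj using fun j => ih hT hp (hGn j) P
    -- the restriction to `s = 0`
    obtain ⟨Q₀, hQ₀⟩ := ih hT.kappa (hT.mem_kappa hp) hDn fun i => C ((P i).eval 0)
    have hx : HasExpansion T p (n + 1) fun t => F t fun i => (P i).eval 0 := by
      refine HasExpansion.of_deltaDeriv hT (g := fun t => D t fun i => (P i).eval 0) (fun _ => ?_)
        fun t ht => hD t ht _
      refine ⟨Q₀.eval (C 0), ?_⟩
      have h1 : Tendsto (fun t : ℝ => (t, (0 : ℝ))) (𝓝[kappa T] p) (𝓝[kappa T] p ×ˢ 𝓝 0) :=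
        tendsto_id.prodMk tendsto_const_nhds
      have h2 := hQ₀.comp_tendsto h1
      simp only [Function.comp_def, eval_C, abs_zero, add_zero] at h2
      refine IsLittleO.of_norm_right ?_
      simpa [evalEval] using h2
    obtain ⟨R, hR⟩ := hx hp
    obtain ⟨Q, hQ⟩ := exists_evalEval_antideriv (∑ j, Qj j * (P j).derivative.map C)
    refine ⟨Q + C R, ?_⟩
    have hderiv : (fun z : ℝ × ℝ => ∑ j, G j z.1 (fun i => (P i).eval z.2) *
        (P j).derivative.eval z.2 - evalEval (z.1 - p) z.2 (∑ j, Qj j * (P j).derivative.map C))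
          =o[𝓝[T] p ×ˢ 𝓝 0] fun z => (|z.1 - p| + |z.2|) ^ n := by
      have h1 : ∀ j, (fun z : ℝ × ℝ => (G j z.1 (fun i => (P i).eval z.2) -
          evalEval (z.1 - p) z.2 (Qj j)) * (P j).derivative.eval z.2)
            =o[𝓝[T] p ×ˢ 𝓝 0] fun z => (|z.1 - p| + |z.2|) ^ n := fun j => by
        have h2 : (fun z : ℝ × ℝ => (P j).derivative.eval z.2) =O[𝓝[T] p ×ˢ 𝓝 0]
            fun _ => (1 : ℝ) :=
          (((P j).derivative.continuous.tendsto 0).comp tendsto_snd).isBigO_one ℝ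
        simpa using (hQj j).mul_isBigO h2
      refine (IsLittleO.sum fun j (_ : j ∈ Finset.univ) => h1 j).congr_left fun z => ?_
      rw [evalEval_finsetSum, Finset.sum_apply, ← Finset.sum_sub_distrib]
      exact Finset.sum_congr rfl fun j _ => by rw [evalEval_mul, evalEval_map_C]; ring
    have hR' : (fun z : ℝ × ℝ => F z.1 (fun i => (P i).eval 0) - R.eval (z.1 - p))
        =o[𝓝[T] p ×ˢ 𝓝 0] fun z => (|z.1 - p| + |z.2|) ^ (n + 1) := by
      refine (hR.comp_tendsto (tendsto_fst (g := 𝓝 (0 : ℝ)))).trans_le fun z => ?_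
      simp only [Function.comp_def, norm_pow, Real.norm_eq_abs]
      refine pow_le_pow_left₀ (abs_nonneg _) ?_ _
      exact (le_add_of_nonneg_right (abs_nonneg _)).trans (le_abs_self _)
    -- the derivative in `s` of the left-hand side is the remainder in `hderiv`, which is integrated
    -- over the segment from `0` to `z.2`
    have hmain : (fun z : ℝ × ℝ => (F z.1 (fun i => (P i).eval z.2) - evalEval (z.1 - p) z.2 Q) -
        F z.1 (fun i => (P i).eval 0))
          =o[𝓝[T] p ×ˢ 𝓝 0] fun z => (|z.1 - p| + |z.2|) ^ (n + 1) := by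
      rw [isLittleO_iff] at hderiv ⊢
      intro ε hε
      obtain ⟨A, hA, B, hB, hAB⟩ := mem_prod_iff.1 (hderiv hε)
      obtain ⟨δ, hδ, hδB⟩ := Metric.mem_nhds_iff.1 hB
      filter_upwards [prod_mem_prod (inter_mem hA self_mem_nhdsWithin) (Metric.ball_mem_nhds 0 hδ)]
        with z hz
      obtain ⟨⟨hzA, hzT⟩, hz2⟩ := hz
      have h1 := Convex.norm_image_sub_le_of_norm_hasDerivWithin_le
        (f := fun s => F z.1 (fun i => (P i).eval s) - evalEval (z.1 - p) s Q)
        (f' := fun s => ∑ j, G j z.1 (fun i => (P i).eval s) * (P j).derivative.eval s -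
          evalEval (z.1 - p) s (∑ j, Qj j * (P j).derivative.map C))
        (C := ε * (|z.1 - p| + |z.2|) ^ n) (s := uIcc 0 z.2) (x := 0) (y := z.2)
        (fun s _ => ((hG.hasDerivAt_curve hzT fun i => (P i).hasDerivAt s).sub
          ((hQ _).2 s)).hasDerivWithinAt)
        (fun s hs => by
          have hs' : |s| ≤ |z.2| := by simpa using abs_sub_left_of_mem_uIcc hs
          have hsB : s ∈ B := hδB (by
            rw [Metric.mem_ball, dist_zero_right, Real.norm_eq_abs] at hz2 ⊢
            exact hs'.trans_lt hz2)
          have h2 : ‖_‖ ≤ ε * ‖(|z.1 - p| + |s|) ^ n‖ := @hAB (z.1, s) ⟨hzA, hsB⟩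
          refine h2.trans ?_
          rw [norm_pow, Real.norm_eq_abs, abs_of_nonneg (show 0 ≤ |z.1 - p| + |s| by positivity)]
          gcongr)
        (convex_uIcc _ _) left_mem_uIcc right_mem_uIcc
      rw [(hQ _).1, sub_zero, sub_zero, Real.norm_eq_abs z.2] at h1
      refine h1.trans ?_
      rw [norm_pow, Real.norm_eq_abs, abs_of_nonneg (show 0 ≤ |z.1 - p| + |z.2| by positivity),
        pow_succ, ← mul_assoc]
      gcongr
      exact le_add_of_nonneg_left (abs_nonneg _)
    refine (hmain.add hR').congr_left fun z => ?_
    rw [evalEval_add]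
    simp only [evalEval, eval_C]
    ring

/-- The composite of a function of class `C^n` with functions that have expansions of order `n` has
such an expansion. -/
theorem MixedC.hasExpansion_comp {m n : ℕ} {F : ℝ → (Fin m → ℝ) → ℝ} (hT : IsGeometric T p q)
    (hF : MixedC n T F) {v : ℝ → Fin m → ℝ} (hv : ∀ i, HasExpansion T p n fun t => v t i) :
    HasExpansion T p n fun t => F t (v t) := by
  have hvc : ContinuousOn v T := continuousOn_pi.2 fun i => (hv i).continuousOn hT
  cases n with
  | zero =>
    exact hasExpansion_zero_of_continuousOn
      (hF.continuousOn.comp (continuousOn_id.prodMk hvc) fun t ht => ⟨ht, mem_univ _⟩)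
  | succ n =>
    intro hp
    choose P hP using fun i => hv i hp
    -- along the polynomial curve given by the expansions of `v`, take `s = t - p`
    obtain ⟨Q, hQ⟩ := MixedC.exists_expansion_along_curve (n + 1) hT hp hF P
    obtain ⟨R, hR⟩ := exists_evalEval_diagonal Q
    refine ⟨R, ?_⟩
    have hsub : Tendsto (fun t : ℝ => t - p) (𝓝[T] p) (𝓝 0) := by
      have : Continuous fun t : ℝ => t - p := by fun_prop
      have h1 := this.tendsto p
      rw [sub_self] at h1
      exact h1.mono_left inf_le_left
    have h1 : (fun t => F t (fun i => (P i).eval (t - p)) - R.eval (t - p))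
        =o[𝓝[T] p] fun t => (t - p) ^ (n + 1) := by
      have h2 := hQ.comp_tendsto (tendsto_id.prodMk hsub)
      refine (h2.congr_left fun t => ?_).trans_isBigO ?_
      · simp only [Function.comp_def, id, hR]
      · refine IsBigO.of_bound (2 ^ (n + 1)) (Eventually.of_forall fun t => ?_)
        simp only [Function.comp_def, id, norm_pow, Real.norm_eq_abs]
        rw [← two_mul, abs_mul, abs_abs, mul_pow, abs_two]
    obtain ⟨G, hG, -⟩ := hF.exists_hasPartials
    have hw : Tendsto (fun t => fun i => (P i).eval (t - p)) (𝓝[T] p) (𝓝 (v p)) := by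
      refine tendsto_pi_nhds.2 fun i => ?_
      have h2 := eq_eval_zero_of_isLittleO (f := fun t => v t i) hp (hP i)
      rw [h2]
      exact ((P i).continuous.tendsto 0).comp hsub
    -- replacing `v` by its expansion costs `o((t - p)^(n+1))`, as `F` is Lipschitz in `u` near `p`
    have h3 : (fun t => F t (v t) - F t (fun i => (P i).eval (t - p)))
        =o[𝓝[T] p] fun t => (t - p) ^ (n + 1) := by
      obtain ⟨δ, hδ, hstrict⟩ := hG.exists_forall_abs_sub_le hp (v p) one_pos
      have h4 : (fun t => ∑ i, (|G i p (v p)| + 1) * |v t i - (P i).eval (t - p)|)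
          =o[𝓝[T] p] fun t => (t - p) ^ (n + 1) :=
        (IsLittleO.sum (s := Finset.univ) fun i _ =>
          (hP i).abs_left.const_mul_left (|G i p (v p)| + 1)).congr_left fun t =>
            Finset.sum_apply _ _ _
      refine IsBigO.trans_isLittleO (IsBigO.of_bound 1 ?_) h4
      filter_upwards [self_mem_nhdsWithin, (hvc p hp).tendsto (Metric.ball_mem_nhds _ hδ),
        hw (Metric.ball_mem_nhds _ hδ),
        mem_nhdsWithin_of_mem_nhds (Metric.ball_mem_nhds p hδ)] with t ht h5 h6 h7
      have h8 := hstrict t ht h7 _ _ h5 h6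
      rw [one_mul, Real.norm_eq_abs, Real.norm_eq_abs,
        abs_of_nonneg (a := ∑ i, (|G i p (v p)| + 1) * |v t i - (P i).eval (t - p)|)
          (Finset.sum_nonneg fun i _ => by positivity)]
      have h9 : |∑ i, G i p (v p) * (v t i - (P i).eval (t - p))| ≤
          ∑ i, |G i p (v p)| * |v t i - (P i).eval (t - p)| := by
        refine (Finset.abs_sum_le_sum_abs _ _).trans_eq ?_
        simp only [abs_mul]
      simp only [add_mul, Finset.sum_add_distrib, one_mul]
      have h10 := abs_sub_abs_le_abs_sub (F t (v t) - F t (fun i => (P i).eval (t - p)))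
        (∑ i, G i p (v p) * (v t i - (P i).eval (t - p)))
      linarith
    refine (h3.add h1).congr_left fun t => ?_
    ring

end TimeScale

namespace TimeScale

open Set Filter Topology MeasureTheory

/-! ### Summation by parts for sequences -/

/-- The difference quotient of a sequence with respect to the step sizes `a₁ ^ k * μ`. -/
noncomputable def seqQuot (a₁ μ : ℝ) (g : ℕ → ℝ) (k : ℕ) : ℝ :=
  (g (k + 1) - g k) / (a₁ ^ k * μ)

section

variable {a₁ μ : ℝ}

theorem seqQuot_iterate_shift (n : ℕ) (g : ℕ → ℝ) (k : ℕ) :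
    (seqQuot a₁ μ)^[n] g (k + 1) = (1 / a₁) ^ n * (seqQuot a₁ μ)^[n] (fun j => g (j + 1)) k := by
  induction n generalizing k with
  | zero => simp
  | succ n ih =>
    rw [Function.iterate_succ_apply', Function.iterate_succ_apply', seqQuot, seqQuot, ih, ih,
      pow_succ a₁, pow_succ]
    simp only [div_eq_mul_inv, mul_inv]
    ring

theorem seqQuot_iterate_eq_zero {n : ℕ} {g : ℕ → ℝ} {k : ℕ} (h : ∀ j, k ≤ j → j ≤ k + n → g j = 0) :
    (seqQuot a₁ μ)^[n] g k = 0 := by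
  induction n generalizing k with
  | zero => exact h k le_rfl le_rfl
  | succ n ih =>
    rw [Function.iterate_succ_apply', seqQuot, ih fun j h1 h2 => h j (by omega) (by omega),
      ih fun j h1 h2 => h j (by omega) (by omega)]
    simp

/-- Repeated summation by parts against a delta sequence. Each step shifts the sequence by one
place, and the shift contributes a power of `1 / a₁`. -/
theorem sum_mul_seqQuot_iterate_single (ha : a₁ ≠ 0) (hμ : μ ≠ 0) (i : ℕ) {n : ℕ} (hn : i ≤ n)
    (W : ℕ → ℝ) :
    ∑ k ∈ Finset.range (n + 1), a₁ ^ k * μ * (W k * (seqQuot a₁ μ)^[i] (Pi.single i 1) k) =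
      μ * ((-1) ^ i * (1 / a₁) ^ (i * (i - 1) / 2) * (seqQuot a₁ μ)^[i] W 0) := by
  induction i generalizing W with
  | zero =>
    rw [Finset.sum_eq_single 0]
    · simp
    · intro k _ hk
      simp [hk]
    · simp
  | succ i ih =>
    set g : ℕ → ℝ := (seqQuot a₁ μ)^[i] (Pi.single (i + 1) 1) with hg
    have hg0 : g 0 = 0 := seqQuot_iterate_eq_zero fun j _ hj => Pi.single_eq_of_ne (by omega) _
    have hgn : g (n + 1) = 0 :=
      seqQuot_iterate_eq_zero fun j hj _ => Pi.single_eq_of_ne (by omega) _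
    have hgs : ∀ k, g (k + 1) = (1 / a₁) ^ i * (seqQuot a₁ μ)^[i] (Pi.single i 1) k := fun k => by
      have h1 : (fun j => (Pi.single (i + 1) 1 : ℕ → ℝ) (j + 1)) = Pi.single i 1 := by
        funext j
        simp [Pi.single_apply]
      rw [hg, seqQuot_iterate_shift, h1]
    have hstep : ∀ k, a₁ ^ k * μ ≠ 0 := fun k => mul_ne_zero (pow_ne_zero k ha) hμ
    have h1 : ∀ k, a₁ ^ k * μ * (W k * (seqQuot a₁ μ)^[i + 1] (Pi.single (i + 1) 1) k) =
        (W (k + 1) * g (k + 1) - W k * g k) - (1 / a₁) ^ i *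
          (a₁ ^ k * μ * (seqQuot a₁ μ W k * (seqQuot a₁ μ)^[i] (Pi.single i 1) k)) := fun k => by
      have h2 : a₁ ^ k * μ * (seqQuot a₁ μ)^[i + 1] (Pi.single (i + 1) 1) k = g (k + 1) - g k := by
        rw [Function.iterate_succ_apply', ← hg, seqQuot, mul_div_cancel₀ _ (hstep k)]
      have h3 : a₁ ^ k * μ * seqQuot a₁ μ W k = W (k + 1) - W k := by
        rw [seqQuot, mul_div_cancel₀ _ (hstep k)]
      linear_combination W k * h2 + g (k + 1) * h3 - a₁ ^ k * μ * seqQuot a₁ μ W k * hgs k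
    rw [Finset.sum_congr rfl fun k _ => h1 k, Finset.sum_sub_distrib, Finset.sum_range_sub
      fun k => W k * g k, hg0, hgn, ← Finset.mul_sum, ih (by omega), ← Function.iterate_succ_apply]
    have h4 : (i + 1) * (i + 1 - 1) / 2 = i + i * (i - 1) / 2 := by
      have h5 : (i + 1) * (i + 1 - 1) = 2 * i + i * (i - 1) := by
        cases i with
        | zero => rfl
        | succ i => simp only [Nat.add_sub_cancel]; ring
      rw [h5, Nat.mul_add_div (by norm_num)]
    rw [h4, pow_add, pow_succ]
    ring

end

/-! ### Iterated difference quotients along the orbits of `σ` -/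

variable {T : Set ℝ} {p q : ℝ} {f g : ℝ → ℝ} {t : ℝ}

theorem deltaQuot_iterate_eq_zero {n : ℕ} (h : ∀ j ≤ n, f ((sigma T)^[j] t) = 0) :
    (deltaQuot T)^[n] f t = 0 := by
  induction n generalizing t with
  | zero => exact h 0 le_rfl
  | succ n ih =>
    rw [Function.iterate_succ_apply', deltaQuot, ih fun j hj => h j (by omega),
      ih fun j hj => by rw [← Function.iterate_succ_apply]; exact h (j + 1) (by omega)]
    simp

theorem iterate_sigma_mem (hT : IsCompact T) (ht : t ∈ T) (n : ℕ) : (sigma T)^[n] t ∈ T := by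
  induction n with
  | zero => exact ht
  | succ n ih => rw [Function.iterate_succ_apply']; exact sigma_mem hT ih

theorem iterate_sigma_le_iterate_sigma (hT : IsCompact T) {s : ℝ} (ht : t ∈ T)
    (h : s ≤ t) (n : ℕ) : (sigma T)^[n] s ≤ (sigma T)^[n] t := by
  induction n with
  | zero => exact h
  | succ n ih =>
    rw [Function.iterate_succ_apply', Function.iterate_succ_apply']
    exact sigma_le_sigma hT (iterate_sigma_mem hT ht n) ih

theorem monotone_iterate_sigma (hT : IsCompact T) (ht : t ∈ T) :
    Monotone fun n => (sigma T)^[n] t :=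
  monotone_nat_of_le_succ fun n => by
    simp only [Function.iterate_succ_apply']
    exact le_sigma hT (iterate_sigma_mem hT ht n)

namespace IsGeometric

theorem lt_sigma (h : IsGeometric T p q) (hb : ∃ s ∈ T, t < s) (ht : t ∈ T) (htp : t ≠ p) :
    t < sigma T t := by
  refine (le_sigma h.isCompact ht).lt_of_ne fun hσ => ?_
  obtain ⟨s, hs, hts⟩ := hb
  obtain ⟨δ, hδ, h1⟩ := h.isolated t ht htp
  obtain ⟨x, hx, h2, h3⟩ := exists_right_near hs hts hσ.symm hδ
  exact h2.ne' (h1 x hx (by rw [abs_lt]; constructor <;> linarith))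

/-- Away from `p`, the points of `T^κ` are those that are not maximal. -/
theorem exists_lt_of_mem_kappa (h : IsGeometric T p q) (hn : T.Nontrivial) (ht : t ∈ kappa T)
    (htp : t ≠ p) : ∃ s ∈ T, t < s := by
  by_contra! hc
  have hg : IsGreatest T t := ⟨ht.1, hc⟩
  have hρ : rho T t = t := ht.2.resolve_left (not_not.2 hg)
  obtain ⟨s, hs, hst⟩ := hn.exists_ne t
  obtain ⟨δ, hδ, h1⟩ := h.isolated t ht.1 htp
  obtain ⟨x, hx, h2, h3⟩ := exists_left_near hs ((hc s hs).lt_of_ne hst) hρ hδ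
  exact h3.ne (h1 x hx (by rw [abs_lt]; constructor <;> linarith))

theorem sigma_kappaIter (h : IsGeometric T p q) {n : ℕ} (hn : (kappaIter T n).Nontrivial)
    (ht : t ∈ kappaIter T (n + 1)) (htp : t ≠ p) :
    sigma (kappaIter T n) t = sigma T t ∧ t < sigma T t ∧ sigma T t ∈ kappaIter T n := by
  rw [kappaIter_succ] at ht
  obtain ⟨s, hs, hts⟩ := (h.kappaIter n).exists_lt_of_mem_kappa hn ht htp
  have h1 : sigma (kappaIter T n) t = sigma T t := by
    have hb := h.isCompact.isGreatest_sSup ⟨s, kappaIter_antitone T n.zero_le hs⟩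
    rw [kappaIter_eq h.isCompact hb] at hs ⊢
    exact sigma_inter_Iic (iterate_rho_mem h.isCompact hb.1 n) (hts.trans_le hs.2)
  rw [← h1]
  exact ⟨rfl, (h.kappaIter n).lt_sigma ⟨s, hs, hts⟩ ht.1 htp,
    sigma_mem (isCompact_kappaIter h.isCompact n) ht.1⟩

/-- At the isolated points, the iterated `Δ`-derivatives are iterated difference quotients. -/
theorem deltaIter_eq_deltaQuot (h : IsGeometric T p q) {m N : ℕ}
    (hn : ∀ k < N, (kappaIter T k).Nontrivial) (f : ℝ → ℝ) {n : ℕ} (hmn : m + n ≤ N)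
    (ht : t ∈ kappaIter T (m + n)) (htp : t ≠ p) :
    deltaIter (kappaIter T m) f n t = (deltaQuot T)^[n] f t := by
  induction n generalizing t with
  | zero => rfl
  | succ n ih =>
    have hnt := hn (m + n) (by omega)
    obtain ⟨h1, h2, h3⟩ := h.sigma_kappaIter hnt ht htp
    have htm : t ∈ kappaIter T (m + n) := kappaIter_antitone T (Nat.le_succ _) ht
    have htκ : t ∈ kappa (kappaIter T (m + n)) := by rwa [← kappaIter_succ]
    have hσp : sigma T t ≠ p := h.sigma_ne t (kappaIter_antitone T (Nat.zero_le _) ht) htp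
    have h4 : deltaIter (kappaIter T m) f (n + 1) t =
        deltaQuot (kappaIter T (m + n)) (deltaIter (kappaIter T m) f n) t := by
      rw [← kappaIter_add] at hnt htκ htm ⊢
      exact (((kappaIter_add T m n ▸ h.kappaIter (m + n) :
        IsGeometric (kappaIter (kappaIter T m) n) p q)).hasDeltaDerivAt_of_ne htm htp
          _).deltaDeriv_eq hnt htκ
    rw [h4, deltaQuot, h1, ih (by omega) h3 hσp, ih (by omega) htm htp,
      Function.iterate_succ_apply', deltaQuot]

/-- Having germ `0` at `p` is inherited by the `Δ`-derivative. -/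
theorem deltaDeriv_eventually_eq_zero (h : IsGeometric T p q) (hp : p ∈ T)
    (hf : ∀ᶠ t in 𝓝[T] p, f t = 0) : ∀ᶠ t in 𝓝[kappa T] p, deltaDeriv T f t = 0 := by
  have h1 : ∀ᶠ t in 𝓝[kappa T] p, f t = 0 ∧ f (sigma T t) = 0 := by
    rw [h.nhdsWithin_kappa hp]
    exact hf.and (h.tendsto_sigma.eventually hf)
  filter_upwards [h1, self_mem_nhdsWithin] with t ht htκ
  refine HasDeltaDerivAt.deltaDeriv_eq (h.nontrivial hp) htκ ?_
  rcases eq_or_ne t p with rfl | htp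
  · exact (hasDeltaDerivAt_iff_hasDerivWithinAt (h.sigma_self hp)).2
      ((hasDerivWithinAt_const t T (0 : ℝ)).congr_of_eventuallyEq hf ht.1)
  · have h2 := h.hasDeltaDerivAt_of_ne htκ.1 htp f
    rwa [deltaQuot, ht.1, ht.2, sub_zero, zero_div] at h2

theorem deltaIter_eq_zero_of_eventually (h : IsGeometric T p q) (hp : p ∈ T)
    (hf : ∀ᶠ t in 𝓝[T] p, f t = 0) (n : ℕ) : deltaIter T f n p = 0 := by
  suffices H : ∀ᶠ t in 𝓝[kappaIter T n] p, deltaIter T f n t = 0 from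
    H.self_of_nhdsWithin (h.mem_kappaIter hp n)
  induction n with
  | zero => exact hf
  | succ n ih =>
    rw [kappaIter_succ]
    exact (h.kappaIter n).deltaDeriv_eventually_eq_zero (h.mem_kappaIter hp n) ih

/-- A step of `σ` leads from `T^{κ^(n+1)}` to `T^{κ^n}`, and the orbit of an isolated point does not
reach `p`. -/
theorem iterate_sigma (h : IsGeometric T p q) {N : ℕ} (hn : ∀ k < N, (kappaIter T k).Nontrivial)
    (ht : t ∈ kappaIter T N) (htp : t ≠ p) {k : ℕ} (hk : k ≤ N) :
    (sigma T)^[k] t ∈ kappaIter T (N - k) ∧ (sigma T)^[k] t ≠ p := by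
  induction k with
  | zero => exact ⟨ht, htp⟩
  | succ k ih =>
    obtain ⟨h1, h2⟩ := ih (by omega)
    rw [Function.iterate_succ_apply']
    have h3 := (h.sigma_kappaIter (n := N - (k + 1)) (hn _ (by omega))
      (by rwa [show N - (k + 1) + 1 = N - k by omega]) h2).2.2
    exact ⟨h3, h.sigma_ne _ (kappaIter_antitone T (Nat.zero_le _) h1) h2⟩

theorem iterate_sigma_lt (h : IsGeometric T p q) {N : ℕ} (hn : ∀ k < N, (kappaIter T k).Nontrivial)
    (ht : t ∈ kappaIter T N) (htp : t ≠ p) {k : ℕ} (hk : k < N) :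
    (sigma T)^[k] t < (sigma T)^[k + 1] t := by
  obtain ⟨h1, h2⟩ := h.iterate_sigma hn ht htp hk.le
  rw [Function.iterate_succ_apply']
  exact (h.sigma_kappaIter (n := N - (k + 1)) (hn _ (by omega))
      (by rwa [show N - (k + 1) + 1 = N - k by omega]) h2).2.1

/-- If `σ` is affine, then the iterated difference quotients along the orbit of `t` are those of
sequences with geometric step sizes. -/
theorem deltaQuot_iterate_eq_seqQuot {a₁ μ : ℝ} {N : ℕ}
    (hstep : ∀ k < N, (sigma T)^[k + 1] t - (sigma T)^[k] t = a₁ ^ k * μ) (f : ℝ → ℝ) {n k : ℕ}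
    (hk : k + n ≤ N) :
    (deltaQuot T)^[n] f ((sigma T)^[k] t) =
      (seqQuot a₁ μ)^[n] (fun j => f ((sigma T)^[j] t)) k := by
  induction n generalizing k with
  | zero => rfl
  | succ n ih =>
    rw [Function.iterate_succ_apply', Function.iterate_succ_apply', deltaQuot, seqQuot,
      ← Function.iterate_succ_apply' (sigma T), ih (by omega), ih (by omega), hstep k (by omega)]

end IsGeometric

theorem integral_eq_mul_of_eqOn_Ioo {φ : ℝ → ℝ} {c d v : ℝ} (hcd : c ≤ d)
    (h : ∀ x ∈ Ioo c d, φ x = v) :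
    IntervalIntegrable φ volume c d ∧ ∫ x in c..d, φ x = (d - c) * v := by
  have hae : ∀ᵐ x, x ∈ uIoc c d → v = φ x := by
    filter_upwards [Measure.ae_ne volume d] with x hx hxI
    rw [uIoc_of_le hcd] at hxI
    exact (h x ⟨hxI.1, hxI.2.lt_of_ne hx⟩).symm
  refine ⟨(intervalIntegrable_const (c := v)).congr_ae
    ((ae_restrict_iff' measurableSet_uIoc).2 hae), ?_⟩
  rw [← intervalIntegral.integral_congr_ae hae, intervalIntegral.integral_const, smul_eq_mul]

end TimeScale

namespace TimeScale

open Set Filter Topology MeasureTheory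

/-! ### The Euler–Lagrange equation on a geometric time scale -/

variable {T : Set ℝ} {p q : ℝ} {a b : ℝ} {r : ℕ} {y : ℝ → ℝ}

/-- The Euler–Lagrange equation at an isolated point `t`: the variation is the indicator function
of the point `σ^r(t)`, for which the first variation is a finite sum over `t, σ(t), …, σ^r(t)`. -/
theorem IsWeakLocalMin.eulerLagrange_of_ne (hT : IsGeometric T p q) (ha : IsLeast T a)
    (hb : IsGreatest T b) (hr : 1 ≤ r) (hn : ∀ k < 2 * r, (kappaIter T k).Nontrivial)
    {a₁ a₀ : ℝ} (ha₁ : 0 < a₁) (hσ : ∀ t ∈ T, t ≤ rho T b → sigma T t = a₁ * t + a₀)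
    {L : ℝ → (Fin (r + 1) → ℝ) → ℝ} {G : Fin (r + 1) → ℝ → (Fin (r + 1) → ℝ) → ℝ}
    (hL : HasPartials (kappaIter T r) L G) {α β : Fin r → ℝ} (hy : IsWeakLocalMin T a b r L α β y)
    {t : ℝ} (ht : t ∈ kappaIter T (2 * r)) (htp : t ≠ p) :
    ∑ i : Fin (r + 1), (-1 : ℝ) ^ (i : ℕ) * (1 / a₁) ^ ((i : ℕ) * ((i : ℕ) - 1) / 2) *
      deltaIter (kappaIter T r) (partialAlong T r L y i) i t = 0 := by
  have hc := hT.isCompact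
  have htT : t ∈ T := kappaIter_antitone T (Nat.zero_le _) ht
  set x : ℕ → ℝ := fun k => (sigma T)^[k] t with hxdef
  have hx : ∀ k ≤ 2 * r, x k ∈ kappaIter T (2 * r - k) ∧ x k ≠ p := fun k hk =>
    hT.iterate_sigma hn ht htp hk
  have hlt : ∀ k < 2 * r, x k < x (k + 1) := fun k hk => hT.iterate_sigma_lt hn ht htp hk
  have hmono : Monotone x := monotone_iterate_sigma hc htT
  set μ := x 1 - x 0 with hμdef
  have hμ : 0 < μ := sub_pos.2 (hlt 0 (by omega))
  have haff : ∀ k < 2 * r, x (k + 1) = a₁ * x k + a₀ := fun k hk => by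
    have h1 := kappaIter_antitone T (show 1 ≤ 2 * r - k by omega) (hx k hk.le).1
    rw [kappaIter_eq hc hb 1] at h1
    rw [← hσ (x k) h1.1 h1.2]
    exact Function.iterate_succ_apply' _ _ _
  have hstep : ∀ k < 2 * r, x (k + 1) - x k = a₁ ^ k * μ := by
    intro k
    induction k with
    | zero => intro _; rw [pow_zero, one_mul]
    | succ k ih =>
      intro hk
      rw [haff (k + 1) hk, pow_succ]
      have h1 := ih (by omega)
      have h2 := haff k (by omega)
      linear_combination a₁ * h1 - h2
  have hxr : ∀ k, x k = x r ↔ k = r := by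
    refine fun k => ⟨fun h => ?_, fun h => by rw [h]⟩
    rcases lt_trichotomy k r with h1 | h1 | h1
    · have h2 := hmono (show k ≤ r - 1 by omega)
      have h3 := hlt (r - 1) (by omega)
      rw [Nat.sub_add_cancel hr] at h3
      linarith
    · exact h1
    · have h2 := hmono (show r + 1 ≤ k by omega)
      have h3 := hlt r (by omega)
      linarith
  have hxU : ∀ k ≤ r, x k ∈ kappaIter T r := fun k hk =>
    kappaIter_antitone T (by omega) (hx k (by omega)).1
  -- the variation vanishes near `p`, hence has all expansions there
  set η : ℝ → ℝ := fun s => if s = x r then 1 else 0 with hη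
  have hη0 : ∀ s, s ≠ x r → η s = 0 := fun s hs => if_neg hs
  have hηp : ∀ᶠ s in 𝓝[T] p, η s = 0 := by
    filter_upwards [mem_nhdsWithin_of_mem_nhds
      (isOpen_ne.mem_nhds (hx r (by omega)).2.symm)] with s hs
    exact hη0 s hs
  have hηexp : ∀ n, HasExpansion T p n η := fun n _ => ⟨0, by
    refine (Asymptotics.isLittleO_zero _ _).congr' ?_ EventuallyEq.rfl
    filter_upwards [hηp] with s hs
    simp [hs]⟩
  have hηit : p ∈ T → ∀ j n, deltaIter T (η ∘ (sigma T)^[j]) n p = 0 := fun hp j n =>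
    hT.deltaIter_eq_zero_of_eventually hp ((hT.tendsto_sigma.iterate j).eventually hηp) n
  have hDQ : ∀ (f : ℝ → ℝ) (n : ℕ) {s : ℝ}, n ≤ 2 * r → s ∈ kappaIter T n → s ≠ p →
      deltaIter T f n s = (deltaQuot T)^[n] f s := fun f n s hnr hs hsp =>
    hT.deltaIter_eq_deltaQuot (m := 0) hn f (by omega) (by rwa [zero_add]) hsp
  -- points whose orbits do not meet `x r` within `r` steps
  have hoff : ∀ s ∈ T, s < t ∨ x r < s → ∀ l ≤ r, η ((sigma T)^[l] s) = 0 := by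
    intro s hs h l hl
    refine hη0 _ ?_
    rcases h with h | h
    · refine ne_of_lt ?_
      cases l with
      | zero => exact h.trans_le (hmono r.zero_le)
      | succ l =>
        rw [Function.iterate_succ_apply]
        calc _ ≤ x l := iterate_sigma_le_iterate_sigma hc htT (sigma_le htT h) l
          _ < x (l + 1) := hlt l (by omega)
          _ ≤ x r := hmono hl
    · exact (h.trans_le (monotone_iterate_sigma hc hs l.zero_le)).ne'
  -- the jet of `η` is supported on `t, σ(t), …, σ^r(t)`
  have hjet0 : ∀ s ∈ kappaIter T r, s < t ∨ x r < s → ∀ i, jet T r η s i = 0 := by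
    intro s hs h i
    have hi := Nat.lt_succ_iff.1 i.2
    have hsT := kappaIter_antitone T (Nat.zero_le _) hs
    by_cases hsp : s = p
    · rw [jet, hsp]
      exact hηit (hsp ▸ hsT) _ _
    · rw [jet, hDQ _ _ (by omega) (kappaIter_antitone T hi hs) hsp]
      refine deltaQuot_iterate_eq_zero fun j hj => ?_
      rw [Function.comp_apply, ← Function.iterate_add_apply]
      exact hoff s hsT h _ (by omega)
  have hjet : ∀ k ≤ r, ∀ i : Fin (r + 1),
      jet T r η (x k) i = (seqQuot a₁ μ)^[i] (Pi.single (i : ℕ) 1) k := by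
    intro k hk i
    have hi := Nat.lt_succ_iff.1 i.2
    rw [jet, hDQ _ _ (by omega) (kappaIter_antitone T hi (hxU k hk)) (hx k (by omega)).2,
      IsGeometric.deltaQuot_iterate_eq_seqQuot hstep _ (by omega)]
    refine congrFun (congrArg _ (funext fun j => ?_)) k
    rw [Function.comp_apply, ← Function.iterate_add_apply]
    have h1 : x (r - i + j) = x r ↔ j = (i : ℕ) := by rw [hxr]; omega
    change (if x (r - i + j) = x r then (1 : ℝ) else 0) = _
    simp only [h1, Pi.single_apply]
  -- the right end of the domain of integration
  set d := (rho T)^[r - 1] b with hd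
  set V := kappaIter T (r - 1) with hV
  have hVc : IsCompact V := isCompact_kappaIter hc _
  have hκ : kappa V = kappaIter T r := by
    rw [hV, ← kappaIter_succ, Nat.sub_add_cancel hr]
  have hdV : IsGreatest V d := isGreatest_kappaIter hc hb (r - 1)
  have had : a ≤ d := ha.2 (iterate_rho_mem hc hb.1 _)
  have haV : a ∈ V := by
    rw [hV, kappaIter_eq hc hb]
    exact ⟨ha.1, had⟩
  have hxσ : ∀ k ≤ r, sigma V (x k) = x (k + 1) ∧ x (k + 1) ∈ V := by
    intro k hk
    have h1 := hT.sigma_kappaIter (hn (r - 1) (by omega))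
      (by rw [Nat.sub_add_cancel hr]; exact hxU k hk) (hx k (by omega)).2
    have h2 : x (k + 1) = sigma T (x k) := Function.iterate_succ_apply' _ _ _
    rw [h2]
    exact ⟨h1.1, h1.2.2⟩
  -- `η` satisfies the homogeneous boundary conditions: `σ^j(a) < σ^r(t)` for `j < r`, and
  -- `σ^r(t) < σ^{r+1}(t) ≤ d`
  have h0 : ∀ k : Fin r, deltaIter T η k a = 0 ∧ deltaIter T η k d = 0 := by
    intro k
    have hk := k.2
    constructor
    · by_cases hap : a = p
      · rw [hap]; exact hηit (hap ▸ ha.1) 0 k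
      · rw [hDQ _ _ (by omega) (kappaIter_antitone T (by omega) haV) hap]
        refine deltaQuot_iterate_eq_zero fun j hj => hη0 _ (ne_of_lt ?_)
        calc _ ≤ x j := iterate_sigma_le_iterate_sigma hc htT (ha.2 htT) j
          _ < x (j + 1) := hlt j (by omega)
          _ ≤ x r := hmono (by omega)
    · by_cases hdp : d = p
      · rw [hdp]; exact hηit (hdp ▸ iterate_rho_mem hc hb.1 _) 0 k
      · rw [hDQ _ _ (by omega) (kappaIter_antitone T (by omega) hdV.1) hdp]
        refine deltaQuot_iterate_eq_zero fun j hj =>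
          hoff d (iterate_rho_mem hc hb.1 _) (Or.inr ?_) j (by omega)
        exact (hlt r (by omega)).trans_le (hdV.2 (hxσ r le_rfl).2)
  have hyr : JetRegular T r y := ((hy.1.1.hasExpansion hT).mono_order (by omega)).jetRegular hT
  have hvar := hy.first_variation hc ha hb hr hn hL hyr ((hηexp _).deltaC hT)
    ((hηexp _).jetRegular hT) h0
  rw [← hV, ← hd] at hvar
  set φ : ℝ → ℝ := fun s => ∑ i, G i (floorPt V s) (jet T r y (floorPt V s)) *
    jet T r η (floorPt V s) i with hφ
  -- the first variation as a finite sum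
  have hφ0 : ∀ s, a < s → s < d → s < t ∨ x (r + 1) < s → φ s = 0 := by
    intro s has hsd h
    have hm := floorPt_mem_kappa hVc haV hdV.1 has.le hsd
    rw [hκ] at hm
    refine Finset.sum_eq_zero fun i _ => ?_
    rw [hjet0 _ hm ?_ i, mul_zero]
    rcases h with h | h
    · exact Or.inl ((floorPt_le hVc haV has.le).trans_lt h)
    · exact Or.inr ((hlt r (by omega)).trans_le (le_floorPt hVc (hxσ r le_rfl).2 h.le))
  have hxd : x (r + 1) ≤ d := hdV.2 (hxσ r le_rfl).2
  have I1 := integral_eq_mul_of_eqOn_Ioo (φ := φ) (c := a) (d := x 0) (v := 0) (ha.2 htT)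
    fun s hs => hφ0 s hs.1 ((hs.2.trans_le (hmono (Nat.zero_le _))).trans_le hxd) (Or.inl hs.2)
  have I3 := integral_eq_mul_of_eqOn_Ioo (φ := φ) (c := x (r + 1)) (d := d) (v := 0) hxd
    fun s hs => hφ0 s ((ha.2 htT).trans_lt ((hmono (Nat.zero_le (r + 1))).trans_lt hs.1)) hs.2
      (Or.inr hs.1)
  have I2 : ∀ k < r + 1, IntervalIntegrable φ volume (x k) (x (k + 1)) ∧
      ∫ s in x k..x (k + 1), φ s = (x (k + 1) - x k) * ∑ i : Fin (r + 1),
        partialAlong T r L y i (x k) * (seqQuot a₁ μ)^[i] (Pi.single (i : ℕ) 1) k := by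
    intro k hk
    have hk' := Nat.lt_succ_iff.1 hk
    refine integral_eq_mul_of_eqOn_Ioo (hmono k.le_succ) fun s hs => ?_
    have h1 : floorPt V s = x k := by
      refine floorPt_eq hVc (kappaIter_antitone T (by omega) (hxU k hk')) hs.1.le ?_
      rw [(hxσ k hk').1]
      exact hs.2
    simp only [hφ, h1]
    refine Finset.sum_congr rfl fun i _ => ?_
    rw [hjet k hk' i, partialAlong, hL.partialU_eq i (hxU k hk')]
  have hsum : ∑ k ∈ Finset.range (r + 1), (x (k + 1) - x k) * ∑ i : Fin (r + 1),
      partialAlong T r L y i (x k) * (seqQuot a₁ μ)^[i] (Pi.single (i : ℕ) 1) k = 0 := by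
    rw [← Finset.sum_congr rfl fun k hk => (I2 k (Finset.mem_range.1 hk)).2,
      intervalIntegral.sum_integral_adjacent_intervals fun k hk => (I2 k hk).1]
    have h1 := IntervalIntegrable.trans_iterate fun k hk => (I2 k hk).1
    have h2 := intervalIntegral.integral_add_adjacent_intervals I1.1 h1
    have h3 := intervalIntegral.integral_add_adjacent_intervals (I1.1.trans h1) I3.1
    rw [I1.2, mul_zero, zero_add] at h2
    rw [I3.2, mul_zero, add_zero, ← h2, hvar] at h3
    exact h3
  have hfinal : ∀ i : Fin (r + 1), deltaIter (kappaIter T r) (partialAlong T r L y i) i t =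
      (seqQuot a₁ μ)^[i] (fun k => partialAlong T r L y i (x k)) 0 := fun i => by
    have hi := Nat.lt_succ_iff.1 i.2
    rw [hT.deltaIter_eq_deltaQuot (m := r) (n := i) hn _ (by omega)
      (kappaIter_antitone T (show r + i ≤ 2 * r by omega) ht) htp]
    exact IsGeometric.deltaQuot_iterate_eq_seqQuot (k := 0) (n := i) hstep _ (by omega)
  have hμsum : μ * ∑ i : Fin (r + 1), (-1 : ℝ) ^ (i : ℕ) *
      (1 / a₁) ^ ((i : ℕ) * ((i : ℕ) - 1) / 2) *
        deltaIter (kappaIter T r) (partialAlong T r L y i) i t = 0 := by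
    rw [← hsum, Finset.mul_sum]
    simp only [hfinal]
    rw [Finset.sum_congr rfl fun (i : Fin (r + 1)) _ =>
      (sum_mul_seqQuot_iterate_single ha₁.ne' hμ.ne' i (Nat.lt_succ_iff.1 i.2) _).symm,
      Finset.sum_comm]
    refine Finset.sum_congr rfl fun k hk => ?_
    rw [hstep k (by have := Finset.mem_range.1 hk; omega), Finset.mul_sum]
  exact (mul_eq_zero.1 hμsum).resolve_left hμ.ne'

/-- On a geometric time scale the derivatives in the Euler–Lagrange equation exist, because the
functions `L_{u_i}(·)` have expansions at the accumulation point. There the equation holds by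
continuity. -/
theorem IsWeakLocalMin.eulerLagrange_of_isGeometric (hT : IsGeometric T p q) (ha : IsLeast T a)
    (hb : IsGreatest T b) (hr : 1 ≤ r) (hn : ∀ k < 2 * r, (kappaIter T k).Nontrivial)
    {a₁ a₀ : ℝ} (ha₁ : 0 < a₁) (hσ : ∀ t ∈ T, t ≤ rho T b → sigma T t = a₁ * t + a₀)
    {L : ℝ → (Fin (r + 1) → ℝ) → ℝ} (hL : MixedC (r + 1) (kappaIter T r) L) {α β : Fin r → ℝ}
    (hy : IsWeakLocalMin T a b r L α β y) :
    (∀ i : Fin (r + 1), DeltaDifferentiable (kappaIter T r) i (partialAlong T r L y i)) ∧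
    ∀ t ∈ kappaIter T (2 * r),
      ∑ i : Fin (r + 1), (-1 : ℝ) ^ (i : ℕ) * (1 / a₁) ^ ((i : ℕ) * ((i : ℕ) - 1) / 2) *
        deltaIter (kappaIter T r) (partialAlong T r L y i) i t = 0 := by
  obtain ⟨G, hG, hGr⟩ := hL.exists_hasPartials
  have hyexp := hy.1.1.hasExpansion hT
  have hU := hT.kappaIter r
  have hjet : ∀ i : Fin (r + 1), HasExpansion (kappaIter T r) p r fun t => jet T r y t i := by
    intro i
    have hi := Nat.lt_succ_iff.1 i.2
    exact (((hyexp.comp_iterate_sigma hT (r - i)).deltaIter hT (show (i : ℕ) ≤ 2 * r by omega)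
      ).2.mono_set (kappaIter_antitone T hi)).mono_order (by omega)
  have hW : ∀ i : Fin (r + 1), HasExpansion (kappaIter T r) p r (partialAlong T r L y i) :=
    fun i => ((hGr i).hasExpansion_comp hU hjet).congr fun t ht => (hG.partialU_eq i ht _).symm
  refine ⟨fun i => ((hW i).deltaIter hU (Nat.lt_succ_iff.1 i.2)).1, fun t ht => ?_⟩
  have hne : ∀ s ∈ kappaIter T (2 * r) \ {p}, _ = (0 : ℝ) := fun s hs =>
    hy.eulerLagrange_of_ne hT ha hb hr hn ha₁ hσ hG hs.1 hs.2
  rcases eq_or_ne t p with rfl | htp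
  · have hcont : ContinuousOn (fun t => ∑ i : Fin (r + 1), (-1 : ℝ) ^ (i : ℕ) *
        (1 / a₁) ^ ((i : ℕ) * ((i : ℕ) - 1) / 2) *
          deltaIter (kappaIter T r) (partialAlong T r L y i) i t) (kappaIter T (2 * r)) := by
      refine continuousOn_finsetSum _ fun i _ => continuousOn_const.mul ?_
      have hi := Nat.lt_succ_iff.1 i.2
      refine (((hW i).deltaIter hU hi).2.continuousOn (hU.kappaIter i)).mono ?_
      rw [kappaIter_add]
      exact kappaIter_antitone T (by omega)
    have := (hT.kappaIter (2 * r)).accPt ht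
    refine tendsto_nhds_unique ((hcont t ht).tendsto.mono_left (nhdsWithin_mono _
      (show kappaIter T (2 * r) \ {t} ⊆ kappaIter T (2 * r) from sdiff_subset))) ?_
    refine tendsto_const_nhds.congr' ?_
    filter_upwards [self_mem_nhdsWithin] with s hs
    exact (hne s hs).symm
  · exact hne t ⟨ht, htp⟩

end TimeScale

namespace TimeScale

open Set Filter Topology MeasureTheory Asymptotics
open scoped ContDiff

/-! ### The real interval as a time scale -/

variable {a b t : ℝ} {f : ℝ → ℝ}

theorem sigma_Icc (ht : t ∈ Icc a b) : sigma (Icc a b) t = t := by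
  rcases ht.2.eq_or_lt with rfl | h
  · exact sigma_eq_of_isGreatest (isGreatest_Icc ht.1)
  · have h1 : Icc a b ∩ Ioi t = Ioc t b := by
      ext x
      exact ⟨fun hx => ⟨hx.2, hx.1.2⟩, fun hx => ⟨⟨ht.1.trans hx.1.le, hx.2⟩, hx.1⟩⟩
    have h2 := isGLB_sigma (T := Icc a b) (t := t) (h1 ▸ nonempty_Ioc.2 h)
    rw [h1] at h2
    exact h2.unique (isGLB_Ioc h)

theorem iterate_sigma_Icc (ht : t ∈ Icc a b) (n : ℕ) : (sigma (Icc a b))^[n] t = t :=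
  Function.iterate_fixed (sigma_Icc ht) n

theorem rho_Icc (hab : a < b) : rho (Icc a b) b = b := by
  have h1 : Icc a b ∩ Iio b = Ico a b := by
    ext x
    exact ⟨fun hx => ⟨hx.1.1, hx.2⟩, fun hx => ⟨⟨hx.1, hx.2.le⟩, hx.2⟩⟩
  have h2 := isLUB_rho (T := Icc a b) (t := b) (h1 ▸ nonempty_Ico.2 hab)
  rw [h1] at h2
  exact h2.unique (isLUB_Ico hab)

theorem kappaIter_Icc (hab : a < b) (n : ℕ) : kappaIter (Icc a b) n = Icc a b := by
  rw [kappaIter_eq isCompact_Icc (isGreatest_Icc hab.le), Function.iterate_fixed (rho_Icc hab)]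
  exact inter_eq_left.2 fun x hx => hx.2

theorem nontrivial_Icc_of_lt (hab : a < b) : (Icc a b).Nontrivial :=
  ⟨a, left_mem_Icc.2 hab.le, b, right_mem_Icc.2 hab.le, hab.ne⟩

theorem kappa_Icc (hab : a < b) : kappa (Icc a b) = Icc a b :=
  kappaIter_Icc hab 1

theorem deltaDeriv_Icc (hab : a < b) (ht : t ∈ Icc a b) (f : ℝ → ℝ) :
    deltaDeriv (Icc a b) f t = derivWithin f (Icc a b) t := by
  by_cases h : DifferentiableWithinAt ℝ f (Icc a b) t
  · exact ((hasDeltaDerivAt_iff_hasDerivWithinAt (sigma_Icc ht)).2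
      h.hasDerivWithinAt).deltaDeriv_eq (nontrivial_Icc_of_lt hab) (by rwa [kappa_Icc hab])
  · rw [derivWithin_zero_of_not_differentiableWithinAt h, deltaDeriv, dif_neg]
    rintro ⟨d, hd⟩
    exact h ((hasDeltaDerivAt_iff_hasDerivWithinAt (sigma_Icc ht)).1 hd).differentiableWithinAt

theorem deltaIter_Icc (hab : a < b) (ht : t ∈ Icc a b) (f : ℝ → ℝ) (n : ℕ) :
    deltaIter (Icc a b) f n t = iteratedDerivWithin n f (Icc a b) t := by
  induction n generalizing t with
  | zero => rw [iteratedDerivWithin_zero]; rfl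
  | succ n ih =>
    rw [deltaIter, kappaIter_Icc hab, deltaDeriv_congr isCompact_Icc ht fun s hs => ih hs,
      deltaDeriv_Icc hab ht, iteratedDerivWithin_succ]

theorem deltaDifferentiable_Icc_iff (hab : a < b) {n : ℕ} :
    DeltaDifferentiable (Icc a b) n f ↔
      ∀ k < n, DifferentiableOn ℝ (iteratedDerivWithin k f (Icc a b)) (Icc a b) := by
  refine forall_congr' fun k => forall_congr' fun _ => ?_
  rw [kappaIter_Icc hab, kappaIter_Icc hab]
  refine forall_congr' fun t => forall_congr' fun ht => ?_
  simp only [hasDeltaDerivAt_congr isCompact_Icc ht fun s hs => deltaIter_Icc hab hs f k,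
    hasDeltaDerivAt_iff_hasDerivWithinAt (sigma_Icc ht)]
  exact ⟨fun ⟨d, hd⟩ => hd.differentiableWithinAt, fun h => ⟨_, h.hasDerivWithinAt⟩⟩

theorem deltaC_Icc_iff (hab : a < b) {n : ℕ} :
    DeltaC (Icc a b) n f ↔ ContDiffOn ℝ n f (Icc a b) := by
  have hu := uniqueDiffOn_Icc hab
  have hc : ContinuousOn (deltaIter (Icc a b) f n) (kappaIter (Icc a b) n) ↔
      ContinuousOn (iteratedDerivWithin n f (Icc a b)) (Icc a b) := by
    rw [kappaIter_Icc hab]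
    exact continuousOn_congr fun s hs => deltaIter_Icc hab hs f n
  rw [DeltaC, deltaDifferentiable_Icc_iff hab, hc]
  constructor
  · rintro ⟨h1, h2⟩
    refine (contDiffOn_iff_continuousOn_differentiableOn_deriv (n := n) hu).2
      ⟨fun m hm => ?_, fun m hm => h1 m (by exact_mod_cast hm)⟩
    rcases (show m ≤ n by exact_mod_cast hm).eq_or_lt with rfl | hlt
    · exact h2
    · exact (h1 m hlt).continuousOn
  · intro h
    exact ⟨fun k hk => h.differentiableOn_iteratedDerivWithin (by exact_mod_cast hk) hu,
      h.continuousOn_iteratedDerivWithin le_rfl hu⟩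

theorem jet_Icc (hab : a < b) (r : ℕ) (f : ℝ → ℝ) (ht : t ∈ Icc a b) (i : Fin (r + 1)) :
    jet (Icc a b) r f t i = iteratedDerivWithin i f (Icc a b) t := by
  rw [jet, ← deltaIter_Icc hab ht]
  refine deltaIter_congr isCompact_Icc (fun s hs => ?_) i (by rwa [kappaIter_Icc hab])
  rw [Function.comp_apply, iterate_sigma_Icc hs]

theorem contDiffOn_iteratedDerivWithin (hab : a < b) {n : ℕ} (k : ℕ)
    (hf : ContDiffOn ℝ (n + k : ℕ) f (Icc a b)) :
    ContDiffOn ℝ n (iteratedDerivWithin k f (Icc a b)) (Icc a b) := by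
  induction k generalizing n with
  | zero => simpa using hf
  | succ k ih =>
    rw [iteratedDerivWithin_succ]
    have h1 := ih (n := n + 1) (by rwa [show n + 1 + k = n + (k + 1) by omega])
    push_cast at h1
    exact ((contDiffOn_succ_iff_derivWithin (uniqueDiffOn_Icc hab)).1 h1).2.2

theorem jetRegular_Icc (hab : a < b) {r : ℕ} (hf : ContDiffOn ℝ r f (Icc a b)) :
    JetRegular (Icc a b) r f := by
  intro i hi
  have h1 : ∀ s ∈ Icc a b, f s = (f ∘ (sigma (Icc a b))^[r - i]) s := fun s hs => by
    rw [Function.comp_apply, iterate_sigma_Icc hs]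
  have h2 : DeltaC (Icc a b) i f := (deltaC_Icc_iff hab).2 (hf.of_le (by exact_mod_cast hi))
  refine ⟨h2.1.congr isCompact_Icc h1, ?_⟩
  have h3 := h2.2
  rw [kappaIter_Icc hab] at h3 ⊢
  exact h3.congr fun s hs =>
    (deltaIter_congr isCompact_Icc h1 i (by rwa [kappaIter_Icc hab])).symm

/-- The chain rule for functions of `t` and `u` with continuous partial derivatives. -/
theorem HasPartials.hasDerivWithinAt_comp {m : ℕ} {K : Set ℝ} {F D : ℝ → (Fin m → ℝ) → ℝ}
    {G : Fin m → ℝ → (Fin m → ℝ) → ℝ} (hF : HasPartials K F G) (ht : t ∈ K) {v : ℝ → Fin m → ℝ}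
    {v' : Fin m → ℝ} (hD : HasDerivWithinAt (fun s => F s (v t)) (D t (v t)) K t)
    (hv : ∀ i, HasDerivWithinAt (fun s => v s i) (v' i) K t) :
    HasDerivWithinAt (fun s => F s (v s)) (D t (v t) + ∑ i, G i t (v t) * v' i) K t := by
  have hvc : Tendsto v (𝓝[K] t) (𝓝 (v t)) :=
    tendsto_pi_nhds.2 fun i => (hv i).continuousWithinAt
  have h1 : (fun s => F s (v s) - F s (v t) - ∑ i, G i t (v t) * (v s i - v t i))
      =o[𝓝[K] t] fun s => s - t := by
    have hO : (fun s => ∑ i, |v s i - v t i|) =O[𝓝[K] t] fun s => s - t :=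
      (IsBigO.sum (s := Finset.univ) fun i _ =>
        (hv i).differentiableWithinAt.isBigO_sub.abs_left).congr_left
          fun s => Finset.sum_apply _ _ _
    refine IsLittleO.trans_isBigO ?_ hO
    rw [isLittleO_iff]
    intro ε hε
    obtain ⟨δ, hδ, h2⟩ := hF.exists_forall_abs_sub_le ht (v t) hε
    filter_upwards [self_mem_nhdsWithin, hvc (Metric.ball_mem_nhds _ hδ),
      mem_nhdsWithin_of_mem_nhds (Metric.ball_mem_nhds t hδ)] with s hs h3 h4
    rw [Real.norm_eq_abs, Real.norm_eq_abs,
      abs_of_nonneg (a := ∑ i, |v s i - v t i|) (Finset.sum_nonneg fun i _ => abs_nonneg _)]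
    exact h2 s hs h4 _ _ h3 (by simpa using hδ)
  have h2 : (fun s => ∑ i, G i t (v t) * (v s i - v t i - (s - t) • v' i))
      =o[𝓝[K] t] fun s => s - t :=
    (IsLittleO.sum (s := Finset.univ) fun i _ =>
      (hasDerivWithinAt_iff_isLittleO.1 (hv i)).const_mul_left (G i t (v t))).congr_left
        fun s => Finset.sum_apply _ _ _
  rw [hasDerivWithinAt_iff_isLittleO] at hD ⊢
  refine ((h1.add h2).add hD).congr_left fun s => ?_
  simp only [smul_eq_mul, mul_sub, Finset.sum_sub_distrib, mul_add, Finset.mul_sum]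
  have h3 : ∑ i, G i t (v t) * ((s - t) * v' i) = ∑ i, (s - t) * (G i t (v t) * v' i) :=
    Finset.sum_congr rfl fun i _ => by ring
  rw [h3]
  ring

/-- By induction on `n`, since the chain rule expresses the derivative of the composite through the
partial derivatives of `F`, which are of class `C^(n-1)` in the mixed sense. -/
theorem MixedC.contDiffOn_comp (hab : a < b) {m : ℕ} (n : ℕ) :
    ∀ {F : ℝ → (Fin m → ℝ) → ℝ}, MixedC n (Icc a b) F → ∀ {v : ℝ → Fin m → ℝ},
      (∀ i, ContDiffOn ℝ n (fun t => v t i) (Icc a b)) →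
        ContDiffOn ℝ n (fun t => F t (v t)) (Icc a b) := by
  have hu := uniqueDiffOn_Icc hab
  induction n with
  | zero =>
    intro F hF v hv
    rw [Nat.cast_zero, contDiffOn_zero]
    exact hF.continuousOn.comp
      (continuousOn_id.prodMk (continuousOn_pi.2 fun i => (hv i).continuousOn))
      fun t ht => ⟨ht, mem_univ _⟩
  | succ n ih =>
    intro F hF v hv
    obtain ⟨G, hG, hGn⟩ := hF.exists_hasPartials
    obtain ⟨D, hD, hDn⟩ := hF.2.2
    rw [kappa_Icc hab] at hD hDn
    push_cast at hv ⊢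
    have hv1 := fun i => (contDiffOn_succ_iff_derivWithin hu).1 (hv i)
    have hder : ∀ t ∈ Icc a b, HasDerivWithinAt (fun s => F s (v s)) (D t (v t) +
        ∑ i, G i t (v t) * derivWithin (fun s => v s i) (Icc a b) t) (Icc a b) t := fun t ht =>
      hG.hasDerivWithinAt_comp (D := D) ht
        ((hasDeltaDerivAt_iff_hasDerivWithinAt (sigma_Icc ht)).1 (hD t ht (v t)))
        fun i => ((hv1 i).1 t ht).hasDerivWithinAt
    have hvn : ∀ i, ContDiffOn ℝ n (fun t => v t i) (Icc a b) := fun i =>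
      (hv i).of_le (by exact_mod_cast n.le_succ)
    refine (contDiffOn_succ_iff_derivWithin hu).2
      ⟨fun t ht => (hder t ht).differentiableWithinAt, fun h => by simp at h, ?_⟩
    refine ContDiffOn.congr ?_ fun t ht => (hder t ht).derivWithin (hu t ht)
    exact (ih hDn hvn).add (ContDiffOn.sum fun i _ => (ih (hGn i) hvn).mul (hv1 i).2.2)

/-- Repeated integration by parts against a test function. -/
theorem integral_mul_iteratedDeriv (hab : a < b) {η : ℝ → ℝ} (hη : ContDiff ℝ ∞ η)
    (hsupp : tsupport η ⊆ Ioo a b) (i : ℕ) :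
    ∀ {w : ℝ → ℝ}, ContDiffOn ℝ i w (Icc a b) → ∫ x in a..b, w x * iteratedDeriv i η x =
      (-1) ^ i * ∫ x in a..b, iteratedDerivWithin i w (Icc a b) x * η x := by
  have hu := uniqueDiffOn_Icc hab
  have hzero : ∀ (k : ℕ) (c : ℝ), c ∉ Ioo a b → iteratedDeriv k η c = 0 := fun k c hc => by
    have h1 : η =ᶠ[𝓝 c] fun _ => 0 := notMem_tsupport_iff_eventuallyEq.1 fun h => hc (hsupp h)
    rw [h1.iteratedDeriv_eq k]
    simp
  induction i with
  | zero => intro w _; simp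
  | succ i ih =>
    intro w hw
    push_cast at hw
    have hw1 := (contDiffOn_succ_iff_derivWithin hu).1 hw
    have hcont : ∀ k, Continuous (iteratedDeriv k η) := fun k =>
      hη.continuous_iteratedDeriv k (by exact_mod_cast le_top)
    have h1 := intervalIntegral.integral_mul_deriv_eq_deriv_mul_of_hasDerivWithinAt (a := a) (b := b)
      (u := w) (v := iteratedDeriv i η) (u' := derivWithin w (Icc a b))
      (v' := iteratedDeriv (i + 1) η)
      (by
        rw [uIcc_of_le hab.le]
        exact fun x hx => (hw1.1 x hx).hasDerivWithinAt)
      (fun x _ => by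
        have h2 : DifferentiableAt ℝ (iteratedDeriv i η) x :=
          hη.differentiable_iteratedDeriv i (by exact_mod_cast ENat.natCast_lt_top i) x
        rw [iteratedDeriv_succ]
        exact h2.hasDerivAt.hasDerivWithinAt)
      (ContinuousOn.intervalIntegrable (by rw [uIcc_of_le hab.le]; exact hw1.2.2.continuousOn))
      ((hcont _).intervalIntegrable _ _)
    rw [h1, hzero i a (by simp), hzero i b (by simp), ih hw1.2.2, pow_succ]
    have h2 : ∫ x in a..b, iteratedDerivWithin i (derivWithin w (Icc a b)) (Icc a b) x * η x =
        ∫ x in a..b, iteratedDerivWithin (i + 1) w (Icc a b) x * η x := by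
      refine intervalIntegral.integral_congr fun x hx => ?_
      rw [uIcc_of_le hab.le] at hx
      simp only [iteratedDerivWithin_succ']
    rw [h2]
    ring

/-- The classical Euler–Lagrange equation: integrate the first variation by parts and apply the
fundamental lemma of the calculus of variations. Here `σ` is the identity, so that the powers of
`1 / a₁` are absent. -/
theorem IsWeakLocalMin.eulerLagrange_Icc (hab : a < b) {r : ℕ} (hr : 1 ≤ r)
    {L : ℝ → (Fin (r + 1) → ℝ) → ℝ} (hL : MixedC (r + 1) (Icc a b) L) {α β : Fin r → ℝ}
    {y : ℝ → ℝ} (hy : IsWeakLocalMin (Icc a b) a b r L α β y) :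
    (∀ i : Fin (r + 1), DeltaDifferentiable (Icc a b) i (partialAlong (Icc a b) r L y i)) ∧
    ∀ t ∈ Icc a b, ∑ i : Fin (r + 1), (-1 : ℝ) ^ (i : ℕ) *
      deltaIter (Icc a b) (partialAlong (Icc a b) r L y i) i t = 0 := by
  have hu := uniqueDiffOn_Icc hab
  obtain ⟨G, hG, hGr⟩ := hL.exists_hasPartials
  have hyc : ContDiffOn ℝ (2 * r : ℕ) y (Icc a b) := (deltaC_Icc_iff hab).1 hy.1.1
  have hjet : ∀ i : Fin (r + 1), ContDiffOn ℝ r (fun t => jet (Icc a b) r y t i) (Icc a b) := by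
    intro i
    have hi := Nat.lt_succ_iff.1 i.2
    have h1 : ContDiffOn ℝ r (iteratedDerivWithin i y (Icc a b)) (Icc a b) :=
      contDiffOn_iteratedDerivWithin hab i
        (hyc.of_le (by exact_mod_cast (by omega : r + (i : ℕ) ≤ 2 * r)))
    exact h1.congr fun t ht => jet_Icc hab r y ht i
  have hW : ∀ i : Fin (r + 1), ContDiffOn ℝ r (partialAlong (Icc a b) r L y i) (Icc a b) :=
    fun i => (MixedC.contDiffOn_comp hab r (hGr i) hjet).congr fun t ht => hG.partialU_eq i ht _
  have hWi : ∀ i : Fin (r + 1),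
      ContDiffOn ℝ (i : ℕ) (partialAlong (Icc a b) r L y i) (Icc a b) := fun i =>
    (hW i).of_le (by exact_mod_cast Nat.lt_succ_iff.1 i.2)
  refine ⟨fun i => ((deltaC_Icc_iff hab).2 (hWi i)).1, ?_⟩
  set E : ℝ → ℝ := fun t => ∑ i : Fin (r + 1), (-1 : ℝ) ^ (i : ℕ) *
    iteratedDerivWithin i (partialAlong (Icc a b) r L y i) (Icc a b) t with hE
  have hiter : ∀ i : Fin (r + 1), ContinuousOn
      (iteratedDerivWithin i (partialAlong (Icc a b) r L y i) (Icc a b)) (Icc a b) := fun i =>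
    (hWi i).continuousOn_iteratedDerivWithin le_rfl hu
  have hEc : ContinuousOn E (Icc a b) :=
    continuousOn_finsetSum _ fun i _ => continuousOn_const.mul (hiter i)
  suffices hEq : EqOn E (fun _ => 0) (Icc a b) by
    intro t ht
    refine Eq.trans ?_ (hEq ht)
    exact Finset.sum_congr rfl fun i _ => by rw [deltaIter_Icc hab ht]
  refine Measure.eqOn_Icc_of_ae_eq volume hab.ne ?_ hEc continuousOn_const
  have hae : ∀ᵐ x, x ∈ Ioo a b → E x = 0 := by
    refine isOpen_Ioo.ae_eq_zero_of_integral_contDiff_smul_eq_zero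
      ((hEc.mono Ioo_subset_Icc_self).locallyIntegrableOn measurableSet_Ioo) ?_
    intro η hη _ hsupp
    have hηi : ∀ x ∈ Icc a b, ∀ k : ℕ, iteratedDerivWithin k η (Icc a b) x = iteratedDeriv k η x :=
      fun x hx k => iteratedDerivWithin_eq_iteratedDeriv hu
        ((hη.of_le (by exact_mod_cast le_top)).contDiffAt) hx
    have hηzero : ∀ (k : ℕ) (c : ℝ), c ∈ Icc a b → c ∉ Ioo a b →
        deltaIter (Icc a b) η k c = 0 := fun k c hc hc' => by
      have h1 : η =ᶠ[𝓝 c] fun _ => 0 := notMem_tsupport_iff_eventuallyEq.1 fun h => hc' (hsupp h)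
      rw [deltaIter_Icc hab hc, hηi c hc, h1.iteratedDeriv_eq k]
      simp
    have hηn : ∀ n : ℕ, ContDiffOn ℝ n η (Icc a b) := fun n =>
      (hη.of_le (by exact_mod_cast le_top)).contDiffOn
    have hρ : (rho (Icc a b))^[r - 1] b = b := Function.iterate_fixed (rho_Icc hab) _
    have hvar := hy.first_variation isCompact_Icc (isLeast_Icc hab.le) (isGreatest_Icc hab.le) hr
      (fun k _ => by rw [kappaIter_Icc hab]; exact nontrivial_Icc_of_lt hab)
      (G := G) (by rwa [kappaIter_Icc hab])
      (jetRegular_Icc hab (hyc.of_le (by exact_mod_cast (by omega : r ≤ 2 * r))))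
      ((deltaC_Icc_iff hab).2 (hηn _)) (jetRegular_Icc hab (hηn _))
      (fun k => by
        rw [hρ]
        exact ⟨hηzero k a (left_mem_Icc.2 hab.le) (by simp),
          hηzero k b (right_mem_Icc.2 hab.le) (by simp)⟩)
    rw [hρ, kappaIter_Icc hab] at hvar
    have hint : ∀ i : Fin (r + 1), IntervalIntegrable
        (fun x => partialAlong (Icc a b) r L y i x * iteratedDeriv i η x) volume a b := fun i => by
      refine ContinuousOn.intervalIntegrable ?_
      rw [uIcc_of_le hab.le]
      exact (hW i).continuousOn.mul
        (hη.continuous_iteratedDeriv i (by exact_mod_cast le_top)).continuousOn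
    have h1 : ∑ i : Fin (r + 1), ∫ x in a..b,
        partialAlong (Icc a b) r L y i x * iteratedDeriv i η x = 0 := by
      rw [← intervalIntegral.integral_finsetSum fun i _ => hint i, ← hvar]
      refine intervalIntegral.integral_congr fun x hx => ?_
      rw [uIcc_of_le hab.le] at hx
      simp only [floorPt_of_mem isCompact_Icc hx]
      refine Finset.sum_congr rfl fun i _ => ?_
      rw [jet_Icc hab r η hx, hηi x hx, partialAlong, hG.partialU_eq i hx]
    have h2 : ∫ x, η x • E x = ∫ x in a..b, η x • E x := by
      refine (intervalIntegral.integral_eq_integral_of_support_subset fun x hx => ?_).symm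
      have h3 : x ∈ tsupport η := subset_tsupport η fun h0 => hx (by simp [h0])
      exact Ioo_subset_Ioc_self (hsupp h3)
    rw [h2, ← h1]
    rw [Finset.sum_congr rfl fun (i : Fin (r + 1)) _ =>
      integral_mul_iteratedDeriv hab hη hsupp i (hWi i)]
    simp only [← intervalIntegral.integral_const_mul]
    rw [← intervalIntegral.integral_finsetSum]
    · refine intervalIntegral.integral_congr fun x _ => ?_
      simp only [hE, smul_eq_mul, Finset.mul_sum]
      exact Finset.sum_congr rfl fun i _ => by ring
    · intro i _
      refine ContinuousOn.intervalIntegrable ?_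
      rw [uIcc_of_le hab.le]
      exact continuousOn_const.mul ((hiter i).mul hη.continuous.continuousOn)
  refine (ae_restrict_iff' measurableSet_Icc).2 ?_
  filter_upwards [hae, Measure.ae_ne volume a, Measure.ae_ne volume b] with x hx hxa hxb hxI
  exact hx ⟨hxI.1.lt_of_ne hxa.symm, hxI.2.lt_of_ne hxb⟩

end TimeScale

namespace TimeScale

open Set Filter Topology

/-! ### Time scales with an affine forward jump operator -/

variable {T : Set ℝ} {a b : ℝ}

/-- Without right-scattered points there is no gap: the left end `floorPt T x` of a gap containing `x`
would be right-scattered. -/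
theorem eq_Icc_of_sigma_eq_self (hT : IsCompact T) (ha : IsLeast T a) (hb : IsGreatest T b)
    (hσ : ∀ t ∈ T, t ≤ rho T b → sigma T t = t) : T = Icc a b := by
  refine Subset.antisymm (fun x hx => ⟨ha.2 hx, hb.2 hx⟩) fun x hx => ?_
  have hc := floorPt_mem hT ⟨a, ha.1⟩ x
  rcases (floorPt_le hT ha.1 hx.1).eq_or_lt with h | h
  · rwa [← h]
  · have hcb := h.trans_le hx.2
    obtain ⟨y, hy, h1, h2⟩ := exists_right_near hb.1 hcb (hσ _ hc (le_rho hc hcb)) (sub_pos.2 h)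
    exact absurd (le_floorPt hT hy (by linarith)) h1.not_ge

/-- If `σ` is affine, then a point that the affine map does not fix is isolated: if it were
left-dense, then it would be fixed by continuity. -/
theorem exists_forall_eq_of_affine (hT : IsCompact T) (hb : IsGreatest T b) {a₁ a₀ : ℝ}
    (ha₁ : 0 < a₁) (hσ : ∀ t ∈ T, t ≤ rho T b → sigma T t = a₁ * t + a₀) {t : ℝ} (ht : t ∈ T)
    (hne : a₁ * t + a₀ ≠ t) : ∃ δ > 0, ∀ s ∈ T, |s - t| < δ → s = t := by
  obtain ⟨δ₁, hδ₁, h1⟩ : ∃ δ > 0, ∀ s ∈ T, t < s → t + δ ≤ s := by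
    rcases (hb.2 ht).eq_or_lt with rfl | htb
    · exact ⟨1, one_pos, fun s hs hts => absurd (hb.2 hs) hts.not_ge⟩
    · have h2 : sigma T t ≠ t := by rwa [hσ t ht (le_rho ht htb)]
      refine ⟨sigma T t - t, sub_pos.2 ((le_sigma hT ht).lt_of_ne h2.symm), fun s hs hts => ?_⟩
      have := sigma_le hs hts
      linarith
  have hc : 0 < |a₁ * t + a₀ - t| := abs_pos.2 (sub_ne_zero.2 hne)
  refine ⟨min δ₁ (|a₁ * t + a₀ - t| / (1 + a₁)), by positivity, fun s hs hst => ?_⟩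
  obtain ⟨h2, h3⟩ := lt_min_iff.1 hst
  rcases lt_trichotomy s t with h | h | h
  · exfalso
    -- as `s ≤ σ(s) ≤ t`, the number `a₁ * t + a₀ - t` is at most `(1 + a₁) * (t - s)` in size
    have h4 := hσ s hs (le_rho hs (h.trans_le (hb.2 ht)))
    have h5 := sigma_le ht h
    have h6 := le_sigma hT hs
    rw [h4] at h5 h6
    rw [lt_div_iff₀ (by positivity), abs_of_neg (sub_neg.2 h)] at h3
    refine absurd h3 (not_lt.2 (abs_le.2 ⟨?_, ?_⟩)) <;> nlinarith
  · exact h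
  · exfalso
    have h4 := h1 s hs h
    have h5 := (le_abs_self _).trans_lt h2
    linarith

/-- A compact time scale with an affine forward jump operator other than the identity consists of
isolated points and at most one accumulation point, the fixed point of the affine map. -/
theorem exists_isGeometric (hT : IsCompact T) (hb : IsGreatest T b) {a₁ a₀ : ℝ}
    (ha₁ : 0 < a₁) (hσ : ∀ t ∈ T, t ≤ rho T b → sigma T t = a₁ * t + a₀)
    (hid : ¬ (a₁ = 1 ∧ a₀ = 0)) : ∃ p q, IsGeometric T p q := by
  by_cases hp : ∃ p ∈ T, a₁ * p + a₀ = p ∧ (𝓝[T \ {p}] p).NeBot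
  · obtain ⟨p, hpT, hfix, hne⟩ := hp
    have h1 : a₁ ≠ 1 := fun h => hid ⟨h, by rw [h] at hfix; linarith⟩
    have hnear : ∀ᶠ t in 𝓝[T] p, t ∈ T ∧ t ≤ rho T b := by
      rcases (hb.2 hpT).eq_or_lt with rfl | hlt
      · filter_upwards [self_mem_nhdsWithin] with t ht
        rw [rho_eq_self_of_neBot hT hb hne]
        exact ⟨ht, hb.2 ht⟩
      · filter_upwards [self_mem_nhdsWithin, mem_nhdsWithin_of_mem_nhds (Iio_mem_nhds hlt)]
          with t ht htb
        exact ⟨ht, le_rho ht htb⟩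
    refine ⟨p, a₁, ⟨hT, fun t ht htp => ?_, fun t ht htp hσp => ?_, fun _ => hne, ha₁,
      fun _ => h1, ?_⟩⟩
    · refine exists_forall_eq_of_affine hT hb ha₁ hσ ht fun h => htp ?_
      have h2 : (a₁ - 1) * (t - p) = 0 := by linear_combination h - hfix
      exact sub_eq_zero.1 ((mul_eq_zero.1 h2).resolve_left (sub_ne_zero.2 h1))
    · rcases (hb.2 ht).eq_or_lt with rfl | htb
      · rw [sigma_eq_of_isGreatest hb] at hσp
        exact htp hσp
      · rw [hσ t ht (le_rho ht htb)] at hσp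
        have h2 : a₁ * (t - p) = 0 := by linear_combination hσp - hfix
        exact htp (sub_eq_zero.1 ((mul_eq_zero.1 h2).resolve_left ha₁.ne'))
    · filter_upwards [hnear] with t ht
      rw [hσ t ht.1 ht.2]
      linear_combination hfix
  · have hiso : ∀ t ∈ T, ∃ δ > 0, ∀ s ∈ T, |s - t| < δ → s = t := by
      intro t ht
      by_cases hfix : a₁ * t + a₀ = t
      · have h1 : 𝓝[T \ {t}] t = ⊥ := not_neBot.1 fun h => hp ⟨t, ht, hfix, h⟩
        have h2 : (∅ : Set ℝ) ∈ 𝓝[T \ {t}] t := by rw [h1]; exact mem_bot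
        obtain ⟨δ, hδ, h3⟩ := Metric.mem_nhdsWithin_iff.1 h2
        refine ⟨δ, hδ, fun s hs hst => ?_⟩
        by_contra hne
        exact h3 ⟨by rwa [Metric.mem_ball, Real.dist_eq], hs, hne⟩
      · exact exists_forall_eq_of_affine hT hb ha₁ hσ ht hfix
    -- all points are isolated, and any number outside `T` can serve as `p`
    have hpT : b + 1 ∉ T := fun h => by linarith [hb.2 h]
    refine ⟨b + 1, 1, ⟨hT, fun t ht _ => hiso t ht,
      fun t ht _ h => hpT (h ▸ sigma_mem hT ht), fun h => absurd h hpT, one_pos,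
      fun h => absurd h hpT, ?_⟩⟩
    rw [← hT.isClosed.closure_eq] at hpT
    rw [notMem_closure_iff_nhdsWithin_eq_bot.1 hpT]
    exact eventually_bot

end TimeScale

theorem mainTheorem4
    (T₀ : Set ℝ) (hT₀ : IsClosed T₀) (a b : ℝ) (ha : a ∈ T₀) (hb : b ∈ T₀)
    -- the working time scale is the interval `[a, b]` of the given one
    (T : Set ℝ) (hT : T = TimeScale.interval T₀ a b)
    (r : ℕ) (hr : 1 ≤ r)
    (hcard : ((2 * r + 1 : ℕ) : ℕ∞) ≤ T.encard)
    -- `σ` is affine on `[a, ρ(b)]`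
    (a₁ a₀ : ℝ) (ha₁ : 0 < a₁)
    (hσ : ∀ t ∈ TimeScale.interval T a (TimeScale.rho T b), TimeScale.sigma T t = a₁ * t + a₀)
    (L : ℝ → (Fin (r + 1) → ℝ) → ℝ)
    (hL : TimeScale.MixedC (r + 1) (TimeScale.kappaIter T r) L)
    (α β : Fin r → ℝ) (y : ℝ → ℝ)
    (hy : TimeScale.IsWeakLocalMin T a b r L α β y) :
    -- the derivatives in the equation exist, and the equation holds
    (∀ i : Fin (r + 1), TimeScale.DeltaDifferentiable (TimeScale.kappaIter T r) i (TimeScale.partialAlong T r L y i)) ∧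
    ∀ t ∈ TimeScale.interval T a ((TimeScale.rho T)^[2 * r] b),
      ∑ i : Fin (r + 1), (-1 : ℝ) ^ (i : ℕ) * (1 / a₁) ^ ((i : ℕ) * ((i : ℕ) - 1) / 2) *
        TimeScale.deltaIter (TimeScale.kappaIter T r) (TimeScale.partialAlong T r L y i) i t = 0 := by
  have hTeq : T = T₀ ∩ Set.Icc a b := hT
  have hTc : IsCompact T := by
    rw [hTeq, Set.inter_comm]
    exact isCompact_Icc.inter_right hT₀
  have hnt : ∀ k < 2 * r, (TimeScale.kappaIter T k).Nontrivial := fun k hk =>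
    TimeScale.nontrivial_kappaIter hTc hcard hk
  have hnt0 : T.Nontrivial := hnt 0 (by omega)
  have hab : a ≤ b := by
    obtain ⟨x, hx⟩ := hnt0.nonempty
    rw [hTeq] at hx
    exact hx.2.1.trans hx.2.2
  have hleast : IsLeast T a := by
    rw [hTeq]
    exact ⟨⟨ha, Set.left_mem_Icc.2 hab⟩, fun x hx => hx.2.1⟩
  have hgreat : IsGreatest T b := by
    rw [hTeq]
    exact ⟨⟨hb, Set.right_mem_Icc.2 hab⟩, fun x hx => hx.2.2⟩
  have hσ' : ∀ t ∈ T, t ≤ TimeScale.rho T b → TimeScale.sigma T t = a₁ * t + a₀ := fun t ht h =>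
    hσ t ⟨ht, hleast.2 ht, h⟩
  have hdom : ∀ t ∈ TimeScale.interval T a ((TimeScale.rho T)^[2 * r] b),
      t ∈ TimeScale.kappaIter T (2 * r) := by
    intro t ht
    rw [TimeScale.kappaIter_eq hTc hgreat]
    exact ⟨ht.1, ht.2.2⟩
  by_cases hid : a₁ = 1 ∧ a₀ = 0
  · obtain ⟨rfl, rfl⟩ := hid
    have hIcc : T = Set.Icc a b := TimeScale.eq_Icc_of_sigma_eq_self hTc hleast hgreat fun t ht h => by
      rw [hσ' t ht h, one_mul, add_zero]
    have hlt : a < b := by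
      refine hab.lt_of_ne fun h => ?_
      rw [hIcc, h, Set.Icc_self] at hnt0
      exact Set.not_nontrivial_singleton hnt0
    rw [hIcc, TimeScale.kappaIter_Icc hlt] at hL
    rw [hIcc] at hy
    obtain ⟨h1, h2⟩ := hy.eulerLagrange_Icc hlt hr hL
    rw [hIcc, TimeScale.kappaIter_Icc hlt]
    refine ⟨h1, fun t ht => ?_⟩
    -- `a₁ = 1`, so the powers of `1 / a₁` are `1`
    simpa using h2 t ht.1
  · obtain ⟨p, q, hgeo⟩ := TimeScale.exists_isGeometric hTc hgreat ha₁ hσ' hid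
    obtain ⟨h1, h2⟩ :=
      hy.eulerLagrange_of_isGeometric hgeo hleast hgreat hr hnt ha₁ hσ' hL
    exact ⟨h1, fun t ht => h2 t (hdom t ht)⟩
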